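/- Let $P=\{x\in\mathbb R^m:\ \ell_r(x)=\langle x,v_r\rangle-\lambda_r\ge 0,\ r=1,\dots,d\}$ be a Delzant lattice polytope with interior $P^o$, and let $M=M_P$ be the associated smooth projective toric variety, i.e. the closure of the image of $(\mathbb C^*)^m\ni z\mapsto[z^\alpha]_{\alpha\in P\cap\mathbb Z^m}$, polarised by $L=\mathcal O(1)|_M$. Put $dd^c=\frac{i}{2\pi}\partial\bar\partial$, let $h_0=e^{-f_0}h_{FS}$ be a $\mathbf T^m$-invariant smooth Hermitian metric on $L$ with positive curvature form $\omega_0$, and let $$\mathcal H_{\mathbf T^m}=\{\phi\in C^\infty(M):\ \phi \text{ is } \mathbf T^m\text{-invariant},\ \omega_\phi=\omega_0+dd^c\phi>0\}.$$ For $\phi\in\mathcal H_{\mathbf T^m}$ also write $\phi(\rho)=\log\sum_{\alpha\in P\cap\mathbb Z^m}e^{\langle\alpha,\rho\rangle}+(f_0+\phi)(e^{\rho/2})$, $\rho\in\mathbb R^m$, for the full Kähler potential on the open orbit in the coordinates $z=e^{\rho/2+i\theta}$, and let $$u_\phi(x)=\sup_{\rho\in\mathbb R^m}\big(\langle x,\rho\rangle-\phi(\rho)\big),\qquad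 x\in P,$$ be its Legendre transform (the symplectic potential). Let $(\phi_t)_{t\in[0,1]}$ be a path in $\mathcal H_{\mathbf T^m}$ that is smooth on $[0,1]\times M$, and write $u_t=u_{\phi_t}$. Then: 1. For all $t\in[0,1]$ and $x\in P^o$ there is exactly one $\rho_{x,t}\in\mathbb R^m$ with $\nabla_\rho\phi_t(\rho_{x,t})=x$, and $u_t(x)=\langle x,\rho_{x,t}\rangle-\phi_t(\rho_{x,t})$; for each $x\in P^o$ the function $t\mapsto u_t(x)$ is $C^2$ on $[0,1]$. 2. The path satisfies the geodesic equation $\ddot\phi_t-\frac12|\nabla\dot\phi_t|^2_{\omega_{\phi_t}}=0$ on $[0,1]\times M$ if and only if $\ddot u_t(x)=0$ for all $t\in[0,1]$ and $x\in P^o$. Here $\frac12|\nabla g|^2_{\omega_\phi}=\sum_{j,k}g^{j\bar k}\,\partial_jg\,\partial_{\bar k}g$ with $g_{j\bar k}=\partial_j\partial_{\bar k}$ of a local Kähler potential of $\omega_\phi$. 3. Let $A=\{s\in\mathbb C:1<|s|<e\}$, $\pi:A\times M\to M$ the projection, and $\Phi(s,p)=\phi_{\log|s|}(p)$. The homogeneous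 complex Monge–Ampère equation $(\pi^*\omega_0+dd^c\Phi)^{m+1}=0$ holds on $A\times M$ if and only if $\ddot u_t(x)=0$ for all $t\in[0,1]$ and $x\in P^o$. 4. If the path is a geodesic (that is, satisfies the equation in 2), then $u_t=u_0+t(u_1-u_0)$ on $P$ for all $t\in[0,1]$. 5. For every $t\in[0,1]$, $\int_M\dot\phi_t^2\,\frac{\omega_{\phi_t}^m}{m!}=\int_P|\dot u_t(x)|^2\,dx$. Consequently the energy of the path is finite and $$\int_0^1\int_M\dot\phi_t^2\,\frac{\omega_{\phi_t}^m}{m!}\,dt=\int_0^1\int_P|\dot u_t(x)|^2\,dx\,dt.$$ -/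

import Mathlib

open Set MeasureTheory
open scoped ContDiff ComplexOrder LinearAlgebra.Projectivization

noncomputable section

/-! ### Delzant lattice polytopes -/

/-- The polyhedron `{x ∈ ℝᵐ : ℓ_r(x) = ⟨x, v_r⟩ - λ_r ≥ 0 for all r}`. -/
def polyhedron {m d : ℕ} (v : Fin d → Fin m → ℤ) (lam : Fin d → ℤ) : Set (Fin m → ℝ) :=
  {x | ∀ r, 0 ≤ (∑ i, (v r i : ℝ) * x i) - lam r}

/-- `I` is the set of indices of the facets through some vertex of the polyhedron. -/
def IsVertexFacets {m d : ℕ} (v : Fin d → Fin m → ℤ) (lam : Fin d → ℤ) (I : Finset (Fin d)) :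
    Prop :=
  ∃ x ∈ extremePoints ℝ (polyhedron v lam), ∀ r, r ∈ I ↔ (∑ i, (v r i : ℝ) * x i) - lam r = 0

/-- A Delzant lattice polytope in `ℝᵐ`: a full-dimensional bounded polyhedron with facets
`ℓ_r = 0`, integral inward normals `v_r` and integral `λ_r`, such that the normals of the facets
meeting at any vertex form a `ℤ`-basis of `ℤᵐ` (so the normals are primitive, exactly `m` facets
meet at each vertex, and integrality of the `λ_r` says that the vertices are lattice points). -/
structure DelzantPolytope (m : ℕ) where
  numFacets : ℕ
  normal : Fin numFacets → Fin m → ℤ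
  offset : Fin numFacets → ℤ
  bounded : Bornology.IsBounded (polyhedron normal offset)
  interior_nonempty : (interior (polyhedron normal offset)).Nonempty
  /-- Each inequality cuts out a facet: some point lies on that hyperplane only. -/
  facet : ∀ r, ∃ x ∈ polyhedron normal offset,
    ∀ s, (∑ i, (normal s i : ℝ) * x i) - offset s = 0 ↔ s = r
  delzant : ∀ I, IsVertexFacets normal offset I →
    LinearIndependent ℤ (fun r : I => normal r) ∧
      Submodule.span ℤ (Set.range fun r : I => normal r) = ⊤

namespace DelzantPolytope

variable {m : ℕ} (P : DelzantPolytope m)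

/-- The closed polytope `P ⊂ ℝᵐ`. -/
def carrier : Set (Fin m → ℝ) := polyhedron P.normal P.offset

/-- The vertices of `P`, each encoded by the set of facets through it. -/
abbrev Vertex : Type := {I : Finset (Fin P.numFacets) // IsVertexFacets P.normal P.offset I}

instance : Fintype P.Vertex := by
  classical
  exact inferInstanceAs (Fintype {I : Finset (Fin P.numFacets) //
    IsVertexFacets P.normal P.offset I})

/-- The lattice points `α ∈ P ∩ ℤᵐ`. -/
abbrev LatticePoint : Type := {α : Fin m → ℤ // (fun i => (α i : ℝ)) ∈ P.carrier}

instance : Finite P.LatticePoint := by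
  obtain ⟨C, hC⟩ := P.bounded.exists_norm_le
  have hfin : (Set.Icc (fun _ : Fin m => -⌈C⌉) (fun _ => ⌈C⌉)).Finite := Set.finite_Icc _ _
  suffices hsub : {α : Fin m → ℤ | (fun i => (α i : ℝ)) ∈ P.carrier} ⊆
      Set.Icc (fun _ : Fin m => -⌈C⌉) (fun _ => ⌈C⌉) from (hfin.subset hsub).to_subtype
  intro α hα
  have h : ∀ i, |(α i : ℝ)| ≤ C := fun i =>
    (norm_le_pi_norm (fun i => (α i : ℝ)) i).trans (hC _ hα)
  constructor
  · intro i
    have h1 := (abs_le.1 (h i)).1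
    have h2 := Int.le_ceil C
    have : (-(⌈C⌉ : ℝ)) ≤ (α i : ℝ) := by linarith
    exact_mod_cast this
  · intro i
    have h1 := (abs_le.1 (h i)).2
    have h2 := Int.le_ceil C
    have : (α i : ℝ) ≤ (⌈C⌉ : ℝ) := by linarith
    exact_mod_cast this

instance : Fintype P.LatticePoint := Fintype.ofFinite _

/-- `ℓ_r(α) = ⟨α, v_r⟩ - λ_r` at a lattice point `α` of `P`. -/
def ell (r : Fin P.numFacets) (α : P.LatticePoint) : ℤ :=
  (∑ i, P.normal r i * α.1 i) - P.offset r

lemma ell_nonneg (r : Fin P.numFacets) (α : P.LatticePoint) : 0 ≤ P.ell r α := by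
  have h : (0 : ℝ) ≤ (∑ i, (P.normal r i : ℝ) * (α.1 i : ℝ)) - P.offset r := α.2 r
  simp only [ell]
  exact_mod_cast h

/-- Every vertex is a lattice point. -/
lemma exists_vertex_latticePoint (I : P.Vertex) :
    ∃ α : P.LatticePoint, ∀ r ∈ I.1, P.ell r α = 0 := by
  obtain ⟨I, hI⟩ := I
  obtain ⟨hli, hsp⟩ := P.delzant I hI
  obtain ⟨x, hx, hxI⟩ := hI
  let b := Module.Basis.mk hli hsp.ge
  let L : (Fin m → ℤ) →ₗ[ℤ] ℤ := b.constr ℤ (fun r : I => P.offset r)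
  let α : Fin m → ℤ := fun i => L (Pi.single i 1)
  have hL : ∀ y : Fin m → ℤ, L y = ∑ i, y i * α i := by
    intro y
    conv_lhs => rw [pi_eq_sum_univ' y]
    rw [map_sum]
    refine Finset.sum_congr rfl fun i _ => ?_
    rw [map_smul, smul_eq_mul]
  have hα : ∀ r : I, ∑ i, P.normal r i * α i = P.offset r := by
    intro r
    rw [← hL]
    have := b.constr_basis ℤ (fun r : I => P.offset r) r
    rwa [Module.Basis.mk_apply] at this
  let D : (Fin m → ℤ) →ₗ[ℤ] ℝ :=
    { toFun := fun y => ∑ i, (y i : ℝ) * (x i - α i)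
      map_add' := by
        intro y z
        simp [add_mul, Finset.sum_add_distrib]
      map_smul' := by
        intro c y
        simp [mul_assoc, Finset.mul_sum] }
  have hD : D = 0 := by
    refine LinearMap.ext_on hsp ?_
    rintro _ ⟨r, rfl⟩
    have h1 := (hxI r).1 r.2
    have h2 : (∑ i, (P.normal r i : ℝ) * α i) = P.offset r := by exact_mod_cast hα r
    change ∑ i, (P.normal r i : ℝ) * (x i - α i) = 0
    simp only [mul_sub, Finset.sum_sub_distrib]
    rw [h2, h1]
  have hxα : x = fun i => (α i : ℝ) := by
    funext i
    have := congrArg (fun T => T (Pi.single i 1)) hD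
    have h3 : ∑ j, (((Pi.single i 1 : Fin m → ℤ) j : ℤ) : ℝ) * (x j - α j) = 0 := this
    rw [Finset.sum_eq_single i] at h3
    · simp at h3
      linarith
    · intro j _ hj
      simp [hj]
    · simp
  refine ⟨⟨α, ?_⟩, fun r hr => ?_⟩
  · rw [← hxα]
    exact hx.1
  · simp only [ell]
    have := hα ⟨r, hr⟩
    simp only at this
    omega

instance : Nonempty P.LatticePoint := by
  classical
  have hcl : IsClosed (polyhedron P.normal P.offset) := by
    have : polyhedron P.normal P.offset =
        ⋂ r, {x | 0 ≤ (∑ i, (P.normal r i : ℝ) * x i) - P.offset r} := by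
      ext x
      simp [polyhedron]
    rw [this]
    refine isClosed_iInter fun r => isClosed_le continuous_const ?_
    fun_prop
  have hc : IsCompact (polyhedron P.normal P.offset) :=
    Metric.isCompact_of_isClosed_isBounded hcl P.bounded
  obtain ⟨x, hx⟩ := hc.extremePoints_nonempty (P.interior_nonempty.mono interior_subset)
  let I : P.Vertex :=
    ⟨Finset.univ.filter fun r => (∑ i, (P.normal r i : ℝ) * x i) - P.offset r = 0,
      x, hx, by simp⟩
  exact ⟨(P.exists_vertex_latticePoint I).choose⟩

/-! ### The toric variety -/

/-- The homogeneous binomial equations of the projective toric variety: `w^a = w^b` whenever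
`a, b ∈ ℕ^(P ∩ ℤᵐ)` have the same degree and `∑ a_α α = ∑ b_α α`. -/
def SatisfiesBinomials (w : P.LatticePoint → ℂ) : Prop :=
  ∀ a b : P.LatticePoint → ℕ, ∑ α, a α = ∑ α, b α →
    (∀ i, ∑ α, (a α : ℤ) * α.1 i = ∑ α, (b α : ℤ) * α.1 i) →
    ∏ α, w α ^ a α = ∏ α, w α ^ b α

/-- The toric variety `M_P`: the Zariski closure, in the projective space with homogeneous
coordinates indexed by `P ∩ ℤᵐ`, of the image of the monomial embedding `z ↦ [z^α]_α` of
`(ℂ*)ᵐ`; the closure is cut out by the binomial equations. -/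
def ToricVariety : Type :=
  {p : ℙ ℂ (P.LatticePoint → ℂ) // P.SatisfiesBinomials p.rep}

lemma SatisfiesBinomials.smul {w : P.LatticePoint → ℂ} (hw : P.SatisfiesBinomials w) (c : ℂ) :
    P.SatisfiesBinomials (c • w) := by
  intro a b hab h
  simp only [Pi.smul_apply, smul_eq_mul, mul_pow, Finset.prod_mul_distrib, hw a b hab h,
    Finset.prod_pow_eq_pow_sum, hab]

/-- The point of `M_P` with given homogeneous coordinates. -/
def mkPoint (w : P.LatticePoint → ℂ) (h0 : w ≠ 0) (hw : P.SatisfiesBinomials w) :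
    P.ToricVariety :=
  ⟨Projectivization.mk ℂ w h0, by
    obtain ⟨c, hc⟩ := Projectivization.exists_smul_eq_mk_rep ℂ w h0
    rw [← hc]
    exact SatisfiesBinomials.smul P hw (c : ℂ)⟩

/-- The monomial `z^α` on the complex torus `(ℂ*)ᵐ`. -/
def monomial (z : Fin m → ℂˣ) (α : P.LatticePoint) : ℂ := ∏ i, (z i : ℂ) ^ α.1 i

lemma monomial_ne_zero (z : Fin m → ℂˣ) (α : P.LatticePoint) : P.monomial z α ≠ 0 :=
  Finset.prod_ne_zero_iff.2 fun i _ => zpow_ne_zero _ (z i).ne_zero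

lemma monomial_satisfiesBinomials (z : Fin m → ℂˣ) : P.SatisfiesBinomials (P.monomial z) := by
  have key : ∀ a : P.LatticePoint → ℕ,
      ∏ α, P.monomial z α ^ a α = ∏ i, (z i : ℂ) ^ (∑ α, (a α : ℤ) * α.1 i) := by
    intro a
    simp only [monomial, ← Finset.prod_pow]
    rw [Finset.prod_comm]
    refine Finset.prod_congr rfl fun i _ => ?_
    have hs : ∀ s : Finset P.LatticePoint, ∏ α ∈ s, ((z i : ℂ) ^ α.1 i) ^ a α =
        (z i : ℂ) ^ (∑ α ∈ s, (a α : ℤ) * α.1 i) := by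
      classical
      intro s
      induction s using Finset.induction_on with
      | empty => simp
      | insert α s hα ih =>
        rw [Finset.prod_insert hα, Finset.sum_insert hα, ih, zpow_add₀ (z i).ne_zero]
        congr 1
        rw [← zpow_natCast, ← zpow_mul, mul_comm]
    exact hs _
  intro a b _ h
  rw [key, key]
  exact Finset.prod_congr rfl fun i _ => by rw [h i]

/-- The embedding of `(ℂ*)ᵐ` onto the open orbit of `M_P`. -/
def torusPoint (z : Fin m → ℂˣ) : P.ToricVariety :=
  P.mkPoint (P.monomial z)
    (fun h => P.monomial_ne_zero z (Classical.arbitrary _) (congrFun h _))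
    (P.monomial_satisfiesBinomials z)

/-- The action of `(ℂ*)ᵐ` on `M_P`, `z · [w_α] = [z^α w_α]`. -/
def torusAction (z : Fin m → ℂˣ) (p : P.ToricVariety) : P.ToricVariety :=
  P.mkPoint (fun α => P.monomial z α * p.1.rep α)
    (fun h => p.1.rep_nonzero (funext fun α =>
      (mul_eq_zero.1 (congrFun h α)).resolve_left (P.monomial_ne_zero z α)))
    (fun a b hab h => by
      simp only [mul_pow, Finset.prod_mul_distrib, p.2 a b hab h,
        P.monomial_satisfiesBinomials z a b hab h])

/-- Homogeneous coordinates in the chart at a vertex `I`, normalised by the coordinate of that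
vertex: `w_α = ∏_{r ∈ I} η_r ^ ℓ_r(α)`. On the open orbit these are the quotients
`z^α / z^v`, with `η_r = z^(v^r)` for the primitive edge vectors `v^r` at the vertex `v`
(the basis dual to the normals at `v`). -/
def chartVec (I : P.Vertex) (η : I.1 → ℂ) (α : P.LatticePoint) : ℂ :=
  ∏ r : I.1, η r ^ (P.ell r α).toNat

lemma chartVec_ne_zero (I : P.Vertex) (η : I.1 → ℂ) : P.chartVec I η ≠ 0 := by
  obtain ⟨α, hα⟩ := P.exists_vertex_latticePoint I
  intro h
  have h1 : P.chartVec I η α = 1 := by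
    simp only [chartVec]
    exact Finset.prod_eq_one fun r _ => by rw [hα r r.2]; simp
  rw [h] at h1
  simp at h1

lemma chartVec_satisfiesBinomials (I : P.Vertex) (η : I.1 → ℂ) :
    P.SatisfiesBinomials (P.chartVec I η) := by
  have key : ∀ a : P.LatticePoint → ℕ,
      ∏ α, P.chartVec I η α ^ a α = ∏ r : I.1, η r ^ (∑ α, (P.ell r α).toNat * a α) := by
    intro a
    simp only [chartVec, ← Finset.prod_pow]
    rw [Finset.prod_comm]
    refine Finset.prod_congr rfl fun r _ => ?_
    simp only [← pow_mul]
    rw [Finset.prod_pow_eq_pow_sum]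
  intro a b hab h
  rw [key, key]
  refine Finset.prod_congr rfl fun r _ => ?_
  congr 1
  have key2 : ∀ a : P.LatticePoint → ℕ, ((∑ α, (P.ell r α).toNat * a α : ℕ) : ℤ) =
      (∑ i, P.normal r i * ∑ α, (a α : ℤ) * α.1 i) - P.offset r * ((∑ α, a α : ℕ) : ℤ) := by
    intro a
    rw [Nat.cast_sum, Nat.cast_sum]
    simp only [Finset.mul_sum]
    rw [Finset.sum_comm, ← Finset.sum_sub_distrib]
    refine Finset.sum_congr rfl fun α _ => ?_
    rw [Nat.cast_mul, Int.toNat_of_nonneg (P.ell_nonneg _ _), ell, sub_mul, Finset.sum_mul]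
    congr 1
    exact Finset.sum_congr rfl fun i _ => by ring
  have : ((∑ α, (P.ell r α).toNat * a α : ℕ) : ℤ) = (∑ α, (P.ell r α).toNat * b α : ℕ) := by
    rw [key2, key2, hab]
    simp only [h]
  exact_mod_cast this

/-- The holomorphic chart `ℂᵐ ≅ U_v ⊂ M_P` at a vertex `v`; these charts form an atlas of the
complex manifold `M_P`. -/
def chart (I : P.Vertex) (η : I.1 → ℂ) : P.ToricVariety :=
  P.mkPoint (P.chartVec I η) (P.chartVec_ne_zero I η) (P.chartVec_satisfiesBinomials I η)

end DelzantPolytope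

/-! ### Wirtinger derivatives on `ℂⁿ` -/

section Wirtinger

variable {ι : Type*} [Fintype ι] [DecidableEq ι]

/-- `∂f/∂z_j = (∂f/∂x_j - i ∂f/∂y_j) / 2`. -/
def wirtinger (f : (ι → ℂ) → ℂ) (z : ι → ℂ) (j : ι) : ℂ :=
  (fderiv ℝ f z (Pi.single j 1) - Complex.I * fderiv ℝ f z (Pi.single j Complex.I)) / 2

/-- `∂f/∂z̄_j = (∂f/∂x_j + i ∂f/∂y_j) / 2`. -/
def wirtingerBar (f : (ι → ℂ) → ℂ) (z : ι → ℂ) (j : ι) : ℂ :=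
  (fderiv ℝ f z (Pi.single j 1) + Complex.I * fderiv ℝ f z (Pi.single j Complex.I)) / 2

/-- The complex Hessian `(∂²f / ∂z_j ∂z̄_k)` of a real function. -/
def complexHessian (f : (ι → ℂ) → ℝ) (z : ι → ℂ) : Matrix ι ι ℂ :=
  Matrix.of fun j k => wirtinger (fun w => wirtingerBar (fun w' => (f w' : ℂ)) w k) z j

end Wirtinger

namespace DelzantPolytope

variable {m : ℕ} (P : DelzantPolytope m)

/-! ### Toric Kähler metrics

A Hermitian metric on the polarising line bundle `L = 𝒪(1)|_{M_P}` is written `e^(-f) h_FS`, where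
`h_FS` is the restriction of the Fubini–Study metric and `f : M_P → ℝ`; its curvature is
`ω = dd^c ψ`, `dd^c = (i/2π) ∂∂̄`, with the local Kähler potentials `ψ` below. -/

/-- The local Kähler potential of `e^(-f) h_FS` in the chart at the vertex `I`:
`log ∑_α |w_α(η)|² + f`. -/
def localPotential (f : P.ToricVariety → ℝ) (I : P.Vertex) (η : I.1 → ℂ) : ℝ :=
  Real.log (∑ α, ‖P.chartVec I η α‖ ^ 2) + f (P.chart I η)

/-- The metric `(g_{j k̄}) = (∂²ψ / ∂η_j ∂η̄_k)` of `e^(-f) h_FS` in the chart at `I`. -/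
def metricMatrix (f : P.ToricVariety → ℝ) (I : P.Vertex) (η : I.1 → ℂ) : Matrix I.1 I.1 ℂ :=
  complexHessian (P.localPotential f I) η

/-- `f ∈ C^∞(M_P)`. -/
def IsSmooth (f : P.ToricVariety → ℝ) : Prop :=
  ∀ I : P.Vertex, ContDiff ℝ ∞ fun η => f (P.chart I η)

/-- Invariance under the real torus `𝐓ᵐ ⊂ (ℂ*)ᵐ`. -/
def IsTorusInvariant (f : P.ToricVariety → ℝ) : Prop :=
  ∀ z : Fin m → ℂˣ, (∀ i, ‖(z i : ℂ)‖ = 1) → ∀ p, f (P.torusAction z p) = f p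

/-- The space `ℋ_𝐓` of toric relative Kähler potentials with respect to the reference metric
`h₀ = e^(-f₀) h_FS`: smooth torus-invariant functions `φ` on `M_P` with `ω₀ + dd^c φ > 0`. -/
def toricPotentials (f₀ : P.ToricVariety → ℝ) : Set (P.ToricVariety → ℝ) :=
  {φ | P.IsSmooth φ ∧ P.IsTorusInvariant φ ∧
    ∀ (I : P.Vertex) (η : I.1 → ℂ), (P.metricMatrix (f₀ + φ) I η).PosDef}

/-- `(t, p) ↦ φ_t(p)` is smooth on `[0, 1] × M_P`. -/
def IsSmoothPath (φ : ℝ → P.ToricVariety → ℝ) : Prop :=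
  ∀ I : P.Vertex, ContDiffOn ℝ ∞ (fun q : ℝ × (I.1 → ℂ) => φ q.1 (P.chart I q.2))
    (Icc 0 1 ×ˢ univ)

/-- The velocity `φ̇_t` of a path on `[0, 1]` (one-sided at the end points). -/
def velocity {X : Type*} (φ : ℝ → X → ℝ) (t : ℝ) (p : X) : ℝ :=
  derivWithin (fun s => φ s p) (Icc 0 1) t

/-- The acceleration `φ̈_t` of a path on `[0, 1]` (one-sided at the end points). -/
def acceleration {X : Type*} (φ : ℝ → X → ℝ) (t : ℝ) (p : X) : ℝ :=
  iteratedDerivWithin 2 (fun s => φ s p) (Icc 0 1) t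

/-! ### The geodesic equation -/

/-- `½ |∇g|²_ω = ∑ g^{j k̄} ∂_j g ∂_k̄ g` at a point of the chart at `I`, for the Kähler metric
`g_{j k̄}` of `e^(-f) h_FS`. -/
def halfGradSq (f g : P.ToricVariety → ℝ) (I : P.Vertex) (η : I.1 → ℂ) : ℂ :=
  wirtingerBar (fun ξ => (g (P.chart I ξ) : ℂ)) η ⬝ᵥ
    (P.metricMatrix f I η)⁻¹.mulVec (wirtinger (fun ξ => (g (P.chart I ξ) : ℂ)) η)

/-- The geodesic equation `φ̈ - ½ |∇φ̇|²_{ω_φ} = 0` on `[0, 1] × M_P`. -/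
def IsGeodesic (f₀ : P.ToricVariety → ℝ) (φ : ℝ → P.ToricVariety → ℝ) : Prop :=
  ∀ t ∈ Icc (0 : ℝ) 1, ∀ (I : P.Vertex) (η : I.1 → ℂ),
    (acceleration φ t (P.chart I η) : ℂ) - P.halfGradSq (f₀ + φ t) (velocity φ t) I η = 0

/-- The homogeneous complex Monge–Ampère equation `(π^*ω₀ + dd^c Φ)^(m+1) = 0` on `A × M_P`, where
`A = {1 < |s| < e}` and `Φ(s, p) = φ_{log |s|}(p)`: the determinant of the complex Hessian of the
local potentials of `π^*ω₀ + dd^c Φ` in the coordinates `(s, η)` vanishes. The coordinate `s` has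
index `none`. -/
def SolvesMongeAmpere (f₀ : P.ToricVariety → ℝ) (φ : ℝ → P.ToricVariety → ℝ) : Prop :=
  ∀ (I : P.Vertex) (q : Option I.1 → ℂ), 1 < ‖q none‖ → ‖q none‖ < Real.exp 1 →
    (complexHessian (fun y : Option I.1 → ℂ =>
      P.localPotential (f₀ + φ (Real.log ‖y none‖)) I (fun r => y (some r))) q).det = 0

/-! ### Energy -/

/-- The number of vertex charts of the atlas that contain a point. -/
def chartCount (p : P.ToricVariety) : ℕ := Nat.card {I : P.Vertex // p ∈ range (P.chart I)}

/-- `‖g‖²_{g_ℋ} = ∫_{M_P} g² ω^m / m!` for the curvature `ω` of `e^(-f) h_FS`. In the chart at `I`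
the volume form `ω^m / m!` is `π^(-m) det(g_{j k̄})` times Lebesgue measure; the integral over `M_P`
is computed in the atlas with the measurable partition of unity that gives each of the `N(p)`
charts containing `p` the weight `1 / N(p)`. -/
def mabuchiNormSq (f g : P.ToricVariety → ℝ) : ENNReal :=
  ∑ I : P.Vertex, ∫⁻ η : I.1 → ℂ, ENNReal.ofReal
    (g (P.chart I η) ^ 2 / P.chartCount (P.chart I η) *
      ((P.metricMatrix f I η).det.re / Real.pi ^ m))

/-- The energy `∫₀¹ ∫_M φ̇_t² dμ_{φ_t} dt` of a path. -/
def energy (f₀ : P.ToricVariety → ℝ) (φ : ℝ → P.ToricVariety → ℝ) : ENNReal :=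
  ∫⁻ t in Icc (0 : ℝ) 1, P.mabuchiNormSq (f₀ + φ t) (velocity φ t)

/-! ### The open-orbit Kähler potential and the symplectic potential -/

/-- The Kähler potential on the open orbit, in the logarithmic coordinates `z = e^(ρ/2 + iθ)`:
`φ(ρ) = log ∑_{α ∈ P ∩ ℤᵐ} e^⟨α, ρ⟩ + f(e^(ρ/2))`. -/
def orbitPotential (f : P.ToricVariety → ℝ) (ρ : Fin m → ℝ) : ℝ :=
  Real.log (∑ α : P.LatticePoint, Real.exp (∑ i, (α.1 i : ℝ) * ρ i)) +
    f (P.torusPoint fun i =>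
      Units.mk0 (Complex.exp ((ρ i / 2 : ℝ) : ℂ)) (Complex.exp_ne_zero _))

/-- The moment map `∇_ρ φ` on the open orbit. -/
def momentMap (f : P.ToricVariety → ℝ) (ρ : Fin m → ℝ) : Fin m → ℝ :=
  fun j => fderiv ℝ (P.orbitPotential f) ρ (Pi.single j 1)

/-- The symplectic potential `u_φ`: the Legendre transform
`u_φ(x) = sup_ρ (⟨x, ρ⟩ - φ(ρ))` of the open-orbit Kähler potential. -/
def symplecticPotential (f : P.ToricVariety → ℝ) (x : Fin m → ℝ) : ℝ :=
  sSup (range fun ρ : Fin m → ℝ => x ⬝ᵥ ρ - P.orbitPotential f ρ)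

end DelzantPolytope

end

/-!
The theorem is a statement about Legendre duality once everything is moved to the open orbit. In
the logarithmic coordinates `ρ_i = log |z_i|²` a path of toric metrics is a function `Φ(t, ρ)` on
`[0, 1] × ℝᵐ`, smooth up to the end points, strictly convex in `ρ`, and at uniformly bounded
distance from the support function of the polytope `P`. These are the properties collected in
`IsConvexPath`; `DelzantPolytope.IsToricPath.isConvexPath` derives them. The bounded distance is
compactness of `M_P` in concrete form: the linear function `⟨·, ρ⟩` is maximal on `P` at some
vertex, and the point `e^(ρ/2)` lies in the closed unit polydisc of the chart there
(`DelzantPolytope.exists_maximizing_vertex`).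

For such a `Φ` the gradient map `∇Φ(t, ·)` is a bijection onto the interior of `P`: for interior
`x` the function `Φ(t, ·) - ⟨x, ·⟩` is coercive, so it has a critical point, unique by convexity,
and the supremum in the Legendre transform is attained there. Let `R(t)` be this point for fixed
`x`. Uniform coercivity gives continuity of `R`, invertibility of the Hessian gives its derivative
(one-sided at the end points), and then `u̇ = -Φ_t(t, R)` and
`ü = -(Φ_tt - ⟨∇Φ_t, (∇²Φ)⁻¹ ∇Φ_t⟩)(t, R)`, the negative of the *geodesic defect*. Hence `ü = 0`
on the interior of `P` if and only if the defect vanishes identically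
(`IsConvexPath.acceleration_legendre_eq_zero_iff`). Affinity in `t` extends to the boundary of `P`,
because a Legendre transform is continuous along segments that run into the interior.

The defect is what both partial differential equations say on the open orbit. At the points of a
vertex chart with nonzero coordinates, a torus-invariant function depends only on
`y_r = log |η_r|²`, and its complex Hessian is `K_jk / (η_j η̄_k)` with `K_jk` the real Hessian in
`y` (`complexHessian_logCoord`). The geodesic equation therefore says that the defect vanishes, and
by the Schur complement formula the Monge–Ampère determinant is a nonvanishing multiple of the
defect. The remaining points of the charts, and the end points of the time interval in the
Monge–Ampère case, follow by density and continuity.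

For the energy, every vertex chart contains the open orbit, which has full measure. Integrating out
the angles turns `π^(-m) det(g_jk̄) dη` into `det(∇²Φ) dρ`, the coordinate change between `y` and
`ρ` being unimodular by the Delzant condition, and the gradient map carries `det(∇²Φ) dρ` to
Lebesgue measure on `P`.
-/

noncomputable section

/-! ### Calculus on the closed time slab -/

section Slab

/-- The closed time slab `[0, 1] × E`. -/
def timeSlab (E : Type*) : Set (ℝ × E) := Icc 0 1 ×ˢ univ

lemma mem_timeSlab {E : Type*} {t : ℝ} {x : E} : (t, x) ∈ timeSlab E ↔ t ∈ Icc (0 : ℝ) 1 := by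
  simp [timeSlab]

lemma timeSlab_mem_nhds {E : Type*} [TopologicalSpace E] {t : ℝ} (ht : t ∈ Ioo (0 : ℝ) 1)
    (x : E) : timeSlab E ∈ nhds (t, x) :=
  prod_mem_nhds (Icc_mem_nhds ht.1 ht.2) Filter.univ_mem

variable {E : Type*} [NormedAddCommGroup E] [NormedSpace ℝ E]

/-- The derivative of `Φ` within the time slab, at `q` in the direction `v`. At the end points of
the time interval it is one-sided in time. -/
def slabDeriv (v : ℝ × E) (Φ : ℝ × E → ℝ) (q : ℝ × E) : ℝ := fderivWithin ℝ Φ (timeSlab E) q v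

lemma uniqueDiffOn_timeSlab : UniqueDiffOn ℝ (timeSlab E) :=
  (uniqueDiffOn_Icc zero_lt_one).prod uniqueDiffOn_univ

lemma contDiffOn_slabDeriv {Φ : ℝ × E → ℝ} (h : ContDiffOn ℝ ∞ Φ (timeSlab E)) (v : ℝ × E) :
    ContDiffOn ℝ ∞ (slabDeriv v Φ) (timeSlab E) :=
  (h.fderivWithin uniqueDiffOn_timeSlab (by simp)).clm_apply contDiffOn_const

lemma slabDeriv_slabDeriv {Φ : ℝ × E → ℝ} (h : ContDiffOn ℝ ∞ Φ (timeSlab E)) (v w : ℝ × E)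
    {q : ℝ × E} (hq : q ∈ timeSlab E) :
    slabDeriv v (slabDeriv w Φ) q =
      fderivWithin ℝ (fderivWithin ℝ Φ (timeSlab E)) (timeSlab E) q v w := by
  have h1 : DifferentiableWithinAt ℝ (fderivWithin ℝ Φ (timeSlab E)) (timeSlab E) q :=
    (h.fderivWithin (m := ∞) uniqueDiffOn_timeSlab (by simp)).differentiableOn (by simp) q hq
  have h2 := (h1.hasFDerivWithinAt.clm_apply (hasFDerivWithinAt_const w q _)).fderivWithin
    (uniqueDiffOn_timeSlab q hq)
  unfold slabDeriv
  rw [h2]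
  simp

/-- Mixed second derivatives commute, also at the end points of the time interval. -/
lemma slabDeriv_comm {Φ : ℝ × E → ℝ} (h : ContDiffOn ℝ ∞ Φ (timeSlab E)) (v w : ℝ × E)
    {q : ℝ × E} (hq : q ∈ timeSlab E) :
    slabDeriv v (slabDeriv w Φ) q = slabDeriv w (slabDeriv v Φ) q := by
  rw [slabDeriv_slabDeriv h _ _ hq, slabDeriv_slabDeriv h _ _ hq]
  refine (ContDiffWithinAt.isSymmSndFDerivWithinAt (n := ∞) (h q hq)
    (by
      simp only [minSmoothness_of_isRCLikeNormedField]
      exact WithTop.coe_le_coe.2 (le_top : (2 : ℕ∞) ≤ ⊤))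
    uniqueDiffOn_timeSlab ?_ hq).eq v w
  have : closure (interior (timeSlab E)) = timeSlab E := by
    rw [timeSlab, interior_prod_eq, closure_prod_eq, interior_Icc, closure_Ioo zero_ne_one]
    simp
  rw [this]
  exact hq

lemma hasFDerivWithinAt_timeSlab {Φ : ℝ × E → ℝ} (h : ContDiffOn ℝ ∞ Φ (timeSlab E))
    {q : ℝ × E} (hq : q ∈ timeSlab E) :
    HasFDerivWithinAt Φ (fderivWithin ℝ Φ (timeSlab E) q) (timeSlab E) q :=
  (h.differentiableOn (by simp) q hq).hasFDerivWithinAt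

lemma hasFDerivAt_slice {Φ : ℝ × E → ℝ} (h : ContDiffOn ℝ ∞ Φ (timeSlab E)) {t : ℝ}
    (ht : t ∈ Icc (0 : ℝ) 1) (x : E) :
    HasFDerivAt (fun y => Φ (t, y))
      ((fderivWithin ℝ Φ (timeSlab E) (t, x)).comp (ContinuousLinearMap.inr ℝ ℝ E)) x := by
  have h1 := hasFDerivWithinAt_timeSlab h (mem_timeSlab.2 ht : (t, x) ∈ timeSlab E)
  have h2 : HasFDerivWithinAt (fun y : E => (t, y)) (ContinuousLinearMap.inr ℝ ℝ E) univ x :=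
    (hasFDerivAt_prodMk_right t x).hasFDerivWithinAt
  exact hasFDerivWithinAt_univ.1
    (HasFDerivWithinAt.comp x h1 h2 fun y _ => mem_timeSlab.2 ht)

lemma fderiv_slice {Φ : ℝ × E → ℝ} (h : ContDiffOn ℝ ∞ Φ (timeSlab E)) {t : ℝ}
    (ht : t ∈ Icc (0 : ℝ) 1) (x e : E) :
    fderiv ℝ (fun y => Φ (t, y)) x e = slabDeriv (0, e) Φ (t, x) := by
  rw [(hasFDerivAt_slice h ht x).fderiv]
  simp [slabDeriv]

lemma contDiff_slice {Φ : ℝ × E → ℝ} (h : ContDiffOn ℝ ∞ Φ (timeSlab E)) {t : ℝ}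
    (ht : t ∈ Icc (0 : ℝ) 1) : ContDiff ℝ ∞ fun y => Φ (t, y) := by
  rw [← contDiffOn_univ]
  exact h.comp (contDiffOn_const.prodMk contDiffOn_id) fun y _ => mem_timeSlab.2 ht

/-- The chain rule along a curve whose time component is the time variable. -/
lemma hasDerivWithinAt_comp_curve {Φ : ℝ × E → ℝ} (h : ContDiffOn ℝ ∞ Φ (timeSlab E)) {t : ℝ}
    (ht : t ∈ Icc (0 : ℝ) 1) {R : ℝ → E} {R' : E} (hR : HasDerivWithinAt R R' (Icc 0 1) t) :
    HasDerivWithinAt (fun s => Φ (s, R s))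
      (slabDeriv (1, 0) Φ (t, R t) + slabDeriv (0, R') Φ (t, R t)) (Icc 0 1) t := by
  have h1 := hasFDerivWithinAt_timeSlab h (mem_timeSlab.2 ht : (t, R t) ∈ timeSlab E)
  have h2 : HasDerivWithinAt (fun s => (s, R s)) ((1 : ℝ), R') (Icc 0 1) t :=
    (hasDerivWithinAt_id t _).prodMk hR
  have h3 := HasFDerivWithinAt.comp_hasDerivWithinAt t h1 h2 fun s hs => mem_timeSlab.2 hs
  refine h3.congr_deriv ?_
  rw [slabDeriv, slabDeriv, ← map_add]
  simp

lemma hasDerivWithinAt_time {Φ : ℝ × E → ℝ} (h : ContDiffOn ℝ ∞ Φ (timeSlab E)) {t : ℝ}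
    (ht : t ∈ Icc (0 : ℝ) 1) (x : E) :
    HasDerivWithinAt (fun s => Φ (s, x)) (slabDeriv (1, 0) Φ (t, x)) (Icc 0 1) t := by
  refine (hasDerivWithinAt_comp_curve h ht (R := fun _ => x)
    (hasDerivWithinAt_const t _ x)).congr_deriv ?_
  have h0 : ((0 : ℝ), (0 : E)) = 0 := rfl
  simp [slabDeriv, h0]

lemma velocity_eq_slabDeriv {Φ : ℝ × E → ℝ} (h : ContDiffOn ℝ ∞ Φ (timeSlab E)) {t : ℝ}
    (ht : t ∈ Icc (0 : ℝ) 1) (x : E) :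
    DelzantPolytope.velocity (fun s y => Φ (s, y)) t x = slabDeriv (1, 0) Φ (t, x) :=
  (hasDerivWithinAt_time h ht x).derivWithin (uniqueDiffOn_Icc zero_lt_one t ht)

lemma acceleration_eq_velocity_velocity {X : Type*} (φ : ℝ → X → ℝ) (t : ℝ) (p : X) :
    DelzantPolytope.acceleration φ t p =
      DelzantPolytope.velocity (DelzantPolytope.velocity φ) t p := by
  simp only [DelzantPolytope.acceleration, DelzantPolytope.velocity]
  rw [iteratedDerivWithin_succ]
  congr 1
  funext s
  exact congrFun iteratedDerivWithin_one s

lemma velocity_congr {X Y : Type*} {φ : ℝ → X → ℝ} {ψ : ℝ → Y → ℝ} {p : X} {q : Y} {t : ℝ}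
    (ht : t ∈ Icc (0 : ℝ) 1) (h : ∀ s ∈ Icc (0 : ℝ) 1, φ s p = ψ s q) :
    DelzantPolytope.velocity φ t p = DelzantPolytope.velocity ψ t q :=
  derivWithin_congr h (h t ht)

lemma acceleration_eq_slabDeriv {Φ : ℝ × E → ℝ} (h : ContDiffOn ℝ ∞ Φ (timeSlab E)) {t : ℝ}
    (ht : t ∈ Icc (0 : ℝ) 1) (x : E) :
    DelzantPolytope.acceleration (fun s y => Φ (s, y)) t x =
      slabDeriv (1, 0) (slabDeriv (1, 0) Φ) (t, x) := by
  rw [acceleration_eq_velocity_velocity, ← velocity_eq_slabDeriv (contDiffOn_slabDeriv h _) ht]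
  exact velocity_congr ht fun s hs => velocity_eq_slabDeriv h hs x

end Slab

/-! ### Legendre duality for smooth paths of convex potentials -/

section Legendre

variable {m : ℕ}

/-- The spatial gradient of `Φ` on the slab. -/
def slabGrad (Φ : ℝ × (Fin m → ℝ) → ℝ) (q : ℝ × (Fin m → ℝ)) : Fin m → ℝ :=
  fun j => slabDeriv (0, Pi.single j 1) Φ q

/-- The spatial Hessian of `Φ` on the slab. -/
def slabHess (Φ : ℝ × (Fin m → ℝ) → ℝ) (q : ℝ × (Fin m → ℝ)) : Matrix (Fin m) (Fin m) ℝ :=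
  Matrix.of fun j k => slabDeriv (0, Pi.single j 1) (slabDeriv (0, Pi.single k 1) Φ) q

/-- The geodesic defect `Φ_tt - ⟨∇Φ_t, (∇²Φ)⁻¹ ∇Φ_t⟩`: the left-hand side of the geodesic equation
on the open orbit, in logarithmic coordinates. -/
def geodesicDefect (Φ : ℝ × (Fin m → ℝ) → ℝ) (q : ℝ × (Fin m → ℝ)) : ℝ :=
  slabDeriv (1, 0) (slabDeriv (1, 0) Φ) q -
    slabGrad (slabDeriv (1, 0) Φ) q ⬝ᵥ
      (slabHess Φ q)⁻¹.mulVec (slabGrad (slabDeriv (1, 0) Φ) q)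

/-- A smooth path `Φ(t, ·)`, `t ∈ [0, 1]`, of strictly convex functions on `ℝᵐ`, each at uniformly
bounded distance from the support function of the closed convex set `K`. -/
structure IsConvexPath (K : Set (Fin m → ℝ)) (Φ : ℝ × (Fin m → ℝ) → ℝ) : Prop where
  isClosed : IsClosed K
  convex : Convex ℝ K
  smooth : ContDiffOn ℝ ∞ Φ (timeSlab (Fin m → ℝ))
  posDef : ∀ t ∈ Icc (0 : ℝ) 1, ∀ ρ, (slabHess Φ (t, ρ)).PosDef
  lower : ∃ C : ℝ, ∀ t ∈ Icc (0 : ℝ) 1, ∀ ρ, ∀ x ∈ K, x ⬝ᵥ ρ ≤ Φ (t, ρ) + C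
  upper : ∃ C : ℝ, ∀ t ∈ Icc (0 : ℝ) 1, ∀ ρ, ∃ x ∈ K, Φ (t, ρ) ≤ x ⬝ᵥ ρ + C

/-- The Legendre transform `sup_ρ (⟨x, ρ⟩ - Φ(t, ρ))` in the space variable. -/
def legendre (Φ : ℝ × (Fin m → ℝ) → ℝ) (t : ℝ) (x : Fin m → ℝ) : ℝ :=
  sSup (range fun ρ : Fin m → ℝ => x ⬝ᵥ ρ - Φ (t, ρ))

lemma slabDeriv_space (Φ : ℝ × (Fin m → ℝ) → ℝ) (e : Fin m → ℝ) (q : ℝ × (Fin m → ℝ)) :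
    slabDeriv (0, e) Φ q = slabGrad Φ q ⬝ᵥ e := by
  have h1 : ((0 : ℝ), e) = ∑ j, e j • ((0 : ℝ), (Pi.single j 1 : Fin m → ℝ)) := by
    refine Prod.ext (by simp [Prod.fst_sum]) ?_
    rw [Prod.snd_sum]
    exact pi_eq_sum_univ' e
  rw [slabDeriv, h1, map_sum]
  refine Finset.sum_congr rfl fun j _ => ?_
  rw [map_smul, smul_eq_mul, mul_comm]
  rfl

lemma slabHess_apply {Φ : ℝ × (Fin m → ℝ) → ℝ}
    (h : ContDiffOn ℝ ∞ Φ (timeSlab (Fin m → ℝ))) {q : ℝ × (Fin m → ℝ)}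
    (hq : q ∈ timeSlab (Fin m → ℝ)) (j : Fin m) (e : Fin m → ℝ) :
    slabDeriv (0, e) (slabDeriv (0, Pi.single j 1) Φ) q = (slabHess Φ q).mulVec e j := by
  rw [slabDeriv_space]
  refine Finset.sum_congr rfl fun k _ => ?_
  simp only [slabHess, slabGrad, Matrix.of_apply]
  rw [slabDeriv_comm h _ _ hq]

lemma slabDeriv_space_space {Φ : ℝ × (Fin m → ℝ) → ℝ}
    (h : ContDiffOn ℝ ∞ Φ (timeSlab (Fin m → ℝ))) {q : ℝ × (Fin m → ℝ)}
    (hq : q ∈ timeSlab (Fin m → ℝ)) (a b : Fin m → ℝ) :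
    slabDeriv (0, a) (slabDeriv (0, b) Φ) q = a ⬝ᵥ (slabHess Φ q).mulVec b := by
  rw [slabDeriv_space, dotProduct_comm]
  refine Finset.sum_congr rfl fun j _ => ?_
  rw [← slabHess_apply h hq, slabDeriv_comm h _ _ hq]
  rfl

lemma continuousOn_slabGrad {Φ : ℝ × (Fin m → ℝ) → ℝ}
    (h : ContDiffOn ℝ ∞ Φ (timeSlab (Fin m → ℝ))) :
    ContinuousOn (slabGrad Φ) (timeSlab (Fin m → ℝ)) :=
  continuousOn_pi.2 fun _ => (contDiffOn_slabDeriv h _).continuousOn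

lemma continuousOn_slabHess {Φ : ℝ × (Fin m → ℝ) → ℝ}
    (h : ContDiffOn ℝ ∞ Φ (timeSlab (Fin m → ℝ))) :
    ContinuousOn (slabHess Φ) (timeSlab (Fin m → ℝ)) :=
  continuousOn_pi.2 fun _ => continuousOn_pi.2 fun _ =>
    (contDiffOn_slabDeriv (contDiffOn_slabDeriv h _) _).continuousOn

lemma hasDerivAt_line {Φ : ℝ × (Fin m → ℝ) → ℝ}
    (h : ContDiffOn ℝ ∞ Φ (timeSlab (Fin m → ℝ))) {t : ℝ} (ht : t ∈ Icc (0 : ℝ) 1)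
    (ρ e : Fin m → ℝ) (s : ℝ) :
    HasDerivAt (fun s : ℝ => Φ (t, ρ + s • e)) (slabDeriv (0, e) Φ (t, ρ + s • e)) s := by
  have h1 := hasFDerivAt_slice h ht (ρ + s • e)
  have h2 : HasDerivAt (fun s : ℝ => ρ + s • e) e s := by
    simpa using ((hasDerivAt_id s).smul_const e).const_add ρ
  refine (HasFDerivAt.comp_hasDerivAt s h1 h2).congr_deriv ?_
  simp [slabDeriv]

lemma hasFDerivAt_slabGrad {Φ : ℝ × (Fin m → ℝ) → ℝ}
    (h : ContDiffOn ℝ ∞ Φ (timeSlab (Fin m → ℝ))) {t : ℝ} (ht : t ∈ Icc (0 : ℝ) 1)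
    (ρ : Fin m → ℝ) :
    HasFDerivAt (fun y => slabGrad Φ (t, y))
      (LinearMap.toContinuousLinearMap (Matrix.toLin' (slabHess Φ (t, ρ)))) ρ := by
  refine hasFDerivAt_pi'' fun j => ?_
  refine (hasFDerivAt_slice (contDiffOn_slabDeriv h (0, Pi.single j 1)) ht ρ).congr_fderiv ?_
  ext1 e
  have h1 := slabHess_apply h (mem_timeSlab.2 ht : (t, ρ) ∈ timeSlab (Fin m → ℝ)) j e
  simpa [slabDeriv] using h1

variable {K : Set (Fin m → ℝ)} {Φ : ℝ × (Fin m → ℝ) → ℝ}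

namespace IsConvexPath

/-- The tangent plane inequality for strictly convex functions. -/
lemma add_grad_dot_lt (h : IsConvexPath K Φ) {t : ℝ} (ht : t ∈ Icc (0 : ℝ) 1)
    {ρ₀ ρ : Fin m → ℝ} (hρ : ρ ≠ ρ₀) :
    Φ (t, ρ₀) + slabGrad Φ (t, ρ₀) ⬝ᵥ (ρ - ρ₀) < Φ (t, ρ) := by
  set e := ρ - ρ₀ with he
  have he0 : e ≠ 0 := sub_ne_zero.2 hρ
  have h1 := hasDerivAt_line h.smooth ht ρ₀ e
  have h2 := hasDerivAt_line (contDiffOn_slabDeriv h.smooth (0, e)) ht ρ₀ e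
  have hmono : StrictMono fun s : ℝ => slabDeriv (0, e) Φ (t, ρ₀ + s • e) := by
    refine strictMono_of_deriv_pos fun s => ?_
    rw [(h2 s).deriv, slabDeriv_space_space h.smooth (mem_timeSlab.2 ht)]
    have := (h.posDef t ht (ρ₀ + s • e)).dotProduct_mulVec_pos he0
    simpa using this
  obtain ⟨c, hc, hceq⟩ := exists_hasDerivAt_eq_slope _ _ (zero_lt_one' ℝ)
    (fun s _ => (h1 s).continuousAt.continuousWithinAt) (fun s _ => h1 s)
  have h3 := hmono hc.1
  simp only [zero_smul, add_zero, one_smul, sub_zero, div_one] at hceq h3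
  rw [hceq, slabDeriv_space, he, add_sub_cancel] at h3
  linarith

lemma grad_injective (h : IsConvexPath K Φ) {t : ℝ} (ht : t ∈ Icc (0 : ℝ) 1) :
    Function.Injective fun ρ => slabGrad Φ (t, ρ) := by
  intro ρ ρ' hρ
  by_contra hne
  have h1 := h.add_grad_dot_lt ht hne
  have h2 := h.add_grad_dot_lt ht (Ne.symm hne)
  simp only at hρ
  rw [hρ] at h2
  rw [dotProduct_sub] at h1 h2
  linarith

lemma dot_sub_le (h : IsConvexPath K Φ) {t : ℝ} (ht : t ∈ Icc (0 : ℝ) 1) (ρ₀ ρ : Fin m → ℝ) :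
    slabGrad Φ (t, ρ₀) ⬝ᵥ ρ - Φ (t, ρ) ≤ slabGrad Φ (t, ρ₀) ⬝ᵥ ρ₀ - Φ (t, ρ₀) := by
  rcases eq_or_ne ρ ρ₀ with rfl | hne
  · exact le_rfl
  · have := h.add_grad_dot_lt ht hne
    rw [dotProduct_sub] at this
    linarith

lemma legendre_grad (h : IsConvexPath K Φ) {t : ℝ} (ht : t ∈ Icc (0 : ℝ) 1) (ρ : Fin m → ℝ) :
    legendre Φ t (slabGrad Φ (t, ρ)) = slabGrad Φ (t, ρ) ⬝ᵥ ρ - Φ (t, ρ) :=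
  IsGreatest.csSup_eq ⟨⟨ρ, rfl⟩, by rintro _ ⟨ρ', rfl⟩; exact h.dot_sub_le ht ρ ρ'⟩

/-- For `x` in the interior of `K` the function `Φ(t, ·) - ⟨x, ·⟩` is coercive, uniformly
in `t`. -/
lemma exists_coercive (h : IsConvexPath K Φ) {x : Fin m → ℝ} (hx : x ∈ interior K) :
    ∃ δ > 0, ∃ C : ℝ, ∀ t ∈ Icc (0 : ℝ) 1, ∀ ρ, δ * ‖ρ‖ ≤ Φ (t, ρ) - x ⬝ᵥ ρ + C := by
  obtain ⟨C, hC⟩ := h.lower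
  obtain ⟨ε, hε, hball⟩ := Metric.mem_nhds_iff.1 (mem_interior_iff_mem_nhds.1 hx)
  refine ⟨ε / 2, by positivity, C, fun t ht ρ => ?_⟩
  have hx0 := hC t ht ρ x (interior_subset hx)
  suffices hs : ‖ρ‖ ≤ (Φ (t, ρ) - x ⬝ᵥ ρ + C) / (ε / 2) by
    rwa [le_div_iff₀ (by positivity), mul_comm] at hs
  refine (pi_norm_le_iff_of_nonneg (div_nonneg (by linarith) (by positivity))).2 fun i => ?_
  rw [le_div_iff₀ (by positivity), Real.norm_eq_abs]
  have key : ∀ c : ℝ, |c| = ε / 2 → x ⬝ᵥ ρ + c * ρ i ≤ Φ (t, ρ) + C := by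
    intro c hc
    have hmem : x + Pi.single i c ∈ K := by
      refine hball ?_
      rw [Metric.mem_ball, dist_eq_norm, add_sub_cancel_left, Pi.norm_single, Real.norm_eq_abs,
        hc]
      linarith
    have := hC t ht ρ _ hmem
    rwa [add_dotProduct, single_dotProduct] at this
  have h1 := key (ε / 2) (abs_of_pos (by positivity))
  have h2 := key (-(ε / 2)) (by rw [abs_neg]; exact abs_of_pos (by positivity))
  rcases abs_cases (ρ i) with ⟨h3, _⟩ | ⟨h3, _⟩ <;> rw [h3] <;> linarith

lemma continuous_slice (h : IsConvexPath K Φ) {t : ℝ} (ht : t ∈ Icc (0 : ℝ) 1) :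
    Continuous fun ρ => Φ (t, ρ) :=
  (contDiff_slice h.smooth ht).continuous

/-- By coercivity `Φ(t, ·) - ⟨x, ·⟩` has a minimum, and its gradient vanishes there. -/
lemma exists_grad_eq (h : IsConvexPath K Φ) {t : ℝ} (ht : t ∈ Icc (0 : ℝ) 1) {x : Fin m → ℝ}
    (hx : x ∈ interior K) : ∃ ρ, slabGrad Φ (t, ρ) = x := by
  obtain ⟨δ, hδ, C, hC⟩ := h.exists_coercive hx
  have hcont : Continuous fun ρ : Fin m → ℝ => Φ (t, ρ) - x ⬝ᵥ ρ :=
    (h.continuous_slice ht).sub (continuous_const.dotProduct continuous_id)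
  have hlim : Filter.Tendsto (fun ρ : Fin m → ℝ => Φ (t, ρ) - x ⬝ᵥ ρ)
      (Filter.cocompact _) Filter.atTop := by
    refine Filter.tendsto_atTop_mono (f := fun ρ => δ * ‖ρ‖ + -C)
      (fun ρ => by have := hC t ht ρ; linarith) ?_
    exact Filter.tendsto_atTop_add_const_right _ _
      ((tendsto_norm_cocompact_atTop (E := Fin m → ℝ)).const_mul_atTop hδ)
  obtain ⟨ρ, hρ⟩ := hcont.exists_forall_le hlim
  refine ⟨ρ, funext fun j => ?_⟩
  have h1 := hasDerivAt_line h.smooth ht ρ (Pi.single j 1) 0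
  have h2 : HasDerivAt (fun s : ℝ => x ⬝ᵥ (ρ + s • Pi.single j 1)) (x j) 0 := by
    have h3 : (fun s : ℝ => x ⬝ᵥ (ρ + s • Pi.single j 1)) = fun s => x ⬝ᵥ ρ + s * x j := by
      funext s
      rw [dotProduct_add, dotProduct_smul, dotProduct_single_one, smul_eq_mul]
    rw [h3]
    simpa using ((hasDerivAt_id (0 : ℝ)).mul_const (x j)).const_add (x ⬝ᵥ ρ)
  have hmin : IsLocalMin (fun s : ℝ => Φ (t, ρ + s • Pi.single j 1) -
      x ⬝ᵥ (ρ + s • Pi.single j 1)) 0 :=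
    Filter.Eventually.of_forall fun s => by
      simp only [zero_smul, add_zero]
      exact hρ (ρ + s • Pi.single j 1)
  have := hmin.hasDerivAt_eq_zero (h1.sub h2)
  simp only [zero_smul, add_zero] at this
  simp only [slabGrad]
  linarith

/-- A gradient outside `K` would be separated from `K` by a hyperplane, and along its normal
`Φ(t, ·)` would grow faster than the support function of `K`. -/
lemma grad_mem (h : IsConvexPath K Φ) {t : ℝ} (ht : t ∈ Icc (0 : ℝ) 1) (ρ₀ : Fin m → ℝ) :
    slabGrad Φ (t, ρ₀) ∈ K := by
  by_contra hx
  set x := slabGrad Φ (t, ρ₀) with hxdef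
  obtain ⟨f, a, hfa, hfx⟩ := geometric_hahn_banach_closed_point h.convex h.isClosed hx
  set ρ : Fin m → ℝ := fun i => f (Pi.single i 1) with hρ
  have hf : ∀ y, f y = y ⬝ᵥ ρ := by
    intro y
    conv_lhs => rw [pi_eq_sum_univ' y]
    rw [map_sum]
    exact Finset.sum_congr rfl fun i _ => by rw [map_smul, smul_eq_mul]
  obtain ⟨C, hC⟩ := h.upper
  set B := x ⬝ᵥ ρ₀ - Φ (t, ρ₀) with hB
  -- `s ⟨x, ρ⟩ ≤ Φ(t, s ρ) + B ≤ s a + C + B` for all `s ≥ 0`, while `⟨x, ρ⟩ > a`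
  have key : ∀ s : ℝ, 0 ≤ s → s * (f x - a) ≤ C + B := by
    intro s hs
    obtain ⟨y, hy, hyle⟩ := hC t ht (s • ρ)
    have h1 := h.dot_sub_le ht ρ₀ (s • ρ)
    rw [← hxdef, dotProduct_smul, ← hf, smul_eq_mul, ← hB] at h1
    rw [dotProduct_smul, ← hf, smul_eq_mul] at hyle
    have h2 := mul_le_mul_of_nonneg_left (hfa y hy).le hs
    rw [mul_sub]
    linarith
  have hpos : 0 < f x - a := sub_pos.2 hfx
  have h3 := key ((|C + B| + 1) / (f x - a)) (by positivity)
  rw [div_mul_cancel₀ _ hpos.ne'] at h3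
  have := le_abs_self (C + B)
  linarith

lemma isUnit_det_hess (h : IsConvexPath K Φ) {t : ℝ} (ht : t ∈ Icc (0 : ℝ) 1)
    (ρ : Fin m → ℝ) : IsUnit (slabHess Φ (t, ρ)).det :=
  isUnit_iff_ne_zero.2 (h.posDef t ht ρ).det_pos.ne'

/-- The gradient map is open, so its image in `K` lies in the interior. -/
lemma grad_mem_interior (h : IsConvexPath K Φ) {t : ℝ} (ht : t ∈ Icc (0 : ℝ) 1)
    (ρ : Fin m → ℝ) : slabGrad Φ (t, ρ) ∈ interior K := by
  have hsm : ContDiffAt ℝ 1 (fun y => slabGrad Φ (t, y)) ρ :=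
    contDiffAt_pi.2 fun j =>
      ((contDiff_slice (contDiffOn_slabDeriv h.smooth _) ht).of_le (by simp)).contDiffAt
  have h1 := hsm.hasStrictFDerivAt' (hasFDerivAt_slabGrad h.smooth ht ρ) (by simp)
  have h2 := h1.map_nhds_eq_of_surj (LinearMap.range_eq_top.2 fun y => by
    refine ⟨(slabHess Φ (t, ρ))⁻¹.mulVec y, ?_⟩
    simp [Matrix.mulVec_mulVec, Matrix.mul_nonsing_inv _ (h.isUnit_det_hess ht ρ)])
  rw [mem_interior_iff_mem_nhds, ← h2]
  exact Filter.mem_map.2 (Filter.univ_mem' fun y => h.grad_mem ht y)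

lemma image_grad (h : IsConvexPath K Φ) {t : ℝ} (ht : t ∈ Icc (0 : ℝ) 1) :
    (fun ρ => slabGrad Φ (t, ρ)) '' univ = interior K := by
  ext x
  constructor
  · rintro ⟨ρ, _, rfl⟩
    exact h.grad_mem_interior ht ρ
  · intro hx
    obtain ⟨ρ, hρ⟩ := h.exists_grad_eq ht hx
    exact ⟨ρ, mem_univ _, hρ⟩

lemma ae_eq_interior (h : IsConvexPath K Φ) : K =ᵐ[volume] interior K := by
  refine (interior_subset.eventuallyLE.antisymm ?_).symm
  refine (ae_le_set (μ := volume)).2 (measure_mono_null ?_ (h.convex.addHaar_frontier volume))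
  rw [h.isClosed.frontier_eq]

/-- The gradient map of `Φ(t, ·)` as a change of variables. -/
lemma lintegral_eq (h : IsConvexPath K Φ) {t : ℝ} (ht : t ∈ Icc (0 : ℝ) 1)
    (g : (Fin m → ℝ) → ENNReal) :
    ∫⁻ x in K, g x =
      ∫⁻ ρ, ENNReal.ofReal (slabHess Φ (t, ρ)).det * g (slabGrad Φ (t, ρ)) := by
  rw [setLIntegral_congr h.ae_eq_interior, ← h.image_grad ht,
    lintegral_image_eq_lintegral_abs_det_fderiv_mul volume MeasurableSet.univ
      (fun ρ _ => (hasFDerivAt_slabGrad h.smooth ht ρ).hasFDerivWithinAt)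
      (h.grad_injective ht).injOn, Measure.restrict_univ]
  refine lintegral_congr fun ρ => ?_
  rw [ContinuousLinearMap.det, LinearMap.coe_toContinuousLinearMap, LinearMap.det_toLin',
    abs_of_pos (h.posDef t ht ρ).det_pos]

end IsConvexPath

end Legendre

section LegendreDynamics

variable {m : ℕ} {K : Set (Fin m → ℝ)} {Φ : ℝ × (Fin m → ℝ) → ℝ}

/-! ### Time dependence of the Legendre transform -/

lemma continuousOn_geodesicDefect (h : IsConvexPath K Φ) :
    ContinuousOn (geodesicDefect Φ) (timeSlab (Fin m → ℝ)) := by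
  have hinv : ContinuousOn (fun q => (slabHess Φ q)⁻¹) (timeSlab (Fin m → ℝ)) := by
    intro q hq
    obtain ⟨t, ρ⟩ := q
    refine ContinuousAt.comp_continuousWithinAt (g := fun A => A⁻¹)
      (continuousAt_matrix_inv _ ?_) (continuousOn_slabHess h.smooth _ hq)
    rw [Ring.inverse_eq_inv']
    exact continuousAt_inv₀ (h.isUnit_det_hess (mem_timeSlab.1 hq) ρ).ne_zero
  have hg := continuousOn_slabGrad (contDiffOn_slabDeriv h.smooth (1, 0))
  refine (contDiffOn_slabDeriv (contDiffOn_slabDeriv h.smooth _) _).continuousOn.sub ?_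
  have hc : Continuous fun p : (Fin m → ℝ) × Matrix (Fin m) (Fin m) ℝ =>
      p.1 ⬝ᵥ p.2.mulVec p.1 :=
    continuous_fst.dotProduct (continuous_snd.matrix_mulVec continuous_fst)
  exact hc.comp_continuousOn (hg.prodMk hinv)

/-- The velocity of the point where the gradient of `Φ(t, ·)` takes a given value. -/
def gradInverseVelocity (Φ : ℝ × (Fin m → ℝ) → ℝ) (q : ℝ × (Fin m → ℝ)) : Fin m → ℝ :=
  -(slabHess Φ q)⁻¹.mulVec (slabGrad (slabDeriv (1, 0) Φ) q)

namespace IsConvexPath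

variable {x : Fin m → ℝ} {R : ℝ → Fin m → ℝ}

/-- The point where `∇Φ(t, ·) = x` depends continuously on `t`: it stays in a compact set by
coercivity, and it is unique. -/
lemma continuousOn_gradInverse (h : IsConvexPath K Φ) (hx : x ∈ interior K)
    (hR : ∀ t ∈ Icc (0 : ℝ) 1, slabGrad Φ (t, R t) = x) : ContinuousOn R (Icc 0 1) := by
  obtain ⟨δ, hδ, C, hC⟩ := h.exists_coercive hx
  have hc0 : ContinuousOn (fun t : ℝ => Φ (t, (0 : Fin m → ℝ))) (Icc 0 1) := fun t ht =>
    (hasDerivWithinAt_time h.smooth ht 0).continuousWithinAt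
  obtain ⟨B, hB⟩ := isCompact_Icc.bddAbove_image hc0
  have hbound : ∀ t ∈ Icc (0 : ℝ) 1, ‖R t‖ ≤ (B + C) / δ := by
    intro t ht
    rw [le_div_iff₀ hδ, mul_comm]
    have h1 := hC t ht (R t)
    have h2 := h.dot_sub_le ht (R t) 0
    rw [hR t ht, dotProduct_zero] at h2
    have h3 : Φ (t, 0) ≤ B := hB ⟨t, ht, rfl⟩
    linarith
  intro t ht
  refine (isCompact_closedBall (0 : Fin m → ℝ) ((B + C) / δ)).tendsto_nhds_of_unique_mapClusterPt
    ?_ ?_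
  · filter_upwards [self_mem_nhdsWithin] with s hs
    simpa using hbound s hs
  · intro y _ hy
    obtain ⟨U, hU, hUy⟩ := mapClusterPt_iff_ultrafilter.1 hy
    have hmem : ∀ᶠ s in (U : Filter ℝ), s ∈ Icc (0 : ℝ) 1 := hU self_mem_nhdsWithin
    have h1 : Filter.Tendsto (fun s => (s, R s)) U (nhdsWithin (t, y) (timeSlab _)) := by
      refine tendsto_nhdsWithin_iff.2 ⟨?_, hmem.mono fun s hs => mem_timeSlab.2 hs⟩
      exact Filter.Tendsto.prodMk_nhds (hU.trans nhdsWithin_le_nhds) hUy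
    have h2 := (continuousOn_slabGrad h.smooth (t, y) (mem_timeSlab.2 ht)).tendsto.comp h1
    have h3 : Filter.Tendsto (slabGrad Φ ∘ fun s => (s, R s)) U (nhds x) :=
      tendsto_const_nhds.congr' (hmem.mono fun s hs => (hR s hs).symm)
    have h4 := tendsto_nhds_unique h2 h3
    exact h.grad_injective ht (h4.trans (hR t ht).symm)

/-- The implicit function theorem for `∇Φ(t, R(t)) = x`, one-sided at the end points: the map
`(t, ρ) ↦ (t, ∇Φ(t, ρ))` has injective derivative within the slab and sends the continuous curve
`(t, R(t))` to the smooth curve `(t, x)`. -/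
lemma hasDerivWithinAt_gradInverse (h : IsConvexPath K Φ) (hx : x ∈ interior K)
    (hR : ∀ t ∈ Icc (0 : ℝ) 1, slabGrad Φ (t, R t) = x) {t : ℝ} (ht : t ∈ Icc (0 : ℝ) 1) :
    HasDerivWithinAt R (gradInverseVelocity Φ (t, R t)) (Icc 0 1) t := by
  have hq : (t, R t) ∈ timeSlab (Fin m → ℝ) := mem_timeSlab.2 ht
  set A : ℝ × (Fin m → ℝ) →L[ℝ] ℝ × (Fin m → ℝ) :=
    (ContinuousLinearMap.fst ℝ ℝ _).prod (ContinuousLinearMap.pi fun j =>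
      fderivWithin ℝ (slabDeriv (0, Pi.single j 1) Φ) (timeSlab _) (t, R t)) with hA
  have hApply : ∀ (τ : ℝ) (e : Fin m → ℝ), A (τ, e) =
      (τ, τ • slabGrad (slabDeriv (1, 0) Φ) (t, R t) + (slabHess Φ (t, R t)).mulVec e) := by
    intro τ e
    refine Prod.ext rfl (funext fun j => ?_)
    change (A (τ, e)).2 j = τ • slabGrad (slabDeriv (1, 0) Φ) (t, R t) j +
      (slabHess Φ (t, R t)).mulVec e j
    rw [← slabHess_apply h.smooth hq, slabGrad,
      slabDeriv_comm h.smooth _ _ hq, slabDeriv, slabDeriv, ← map_smul, ← map_add]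
    simp [hA]
  have hinj : Function.Injective A := by
    refine (injective_iff_map_eq_zero A).2 ?_
    rintro ⟨τ, e⟩ he
    rw [hApply] at he
    obtain ⟨rfl, he⟩ := Prod.mk.inj he
    rw [zero_smul, zero_add] at he
    rw [Matrix.eq_zero_of_mulVec_eq_zero (h.isUnit_det_hess ht (R t)).ne_zero he]
    rfl
  have hf : HasFDerivWithinAt (fun q : ℝ × (Fin m → ℝ) => (q.1, slabGrad Φ q)) A
      (timeSlab _) (t, R t) :=
    hasFDerivWithinAt_fst.prodMk (hasFDerivWithinAt_pi.2 fun j =>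
      hasFDerivWithinAt_timeSlab (contDiffOn_slabDeriv h.smooth _) hq)
  have hh : HasFDerivWithinAt (fun s : ℝ => (s, x))
      (A ∘L ContinuousLinearMap.toSpanSingleton ℝ (1, gradInverseVelocity Φ (t, R t)))
      (Icc 0 1) t := by
    have h1 : HasDerivWithinAt (fun s : ℝ => (s, x)) ((1 : ℝ), (0 : Fin m → ℝ)) (Icc 0 1) t :=
      (hasDerivWithinAt_id t _).prodMk (hasDerivWithinAt_const t _ x)
    refine h1.hasFDerivWithinAt.congr_fderiv ?_
    ext1
    simp only [ContinuousLinearMap.comp_apply, ContinuousLinearMap.toSpanSingleton_apply,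
      one_smul]
    rw [hApply, gradInverseVelocity, Matrix.mulVec_neg, Matrix.mulVec_mulVec,
      Matrix.mul_nonsing_inv _ (h.isUnit_det_hess ht (R t))]
    simp
  have hg : Filter.Tendsto (fun s => (s, R s)) (nhdsWithin t (Icc 0 1))
      (nhdsWithin (t, R t) (timeSlab _)) :=
    tendsto_nhdsWithin_iff.2 ⟨Filter.Tendsto.prodMk_nhds nhdsWithin_le_nhds
      (h.continuousOn_gradInverse hx hR t ht),
      Filter.eventually_of_mem self_mem_nhdsWithin fun s hs => mem_timeSlab.2 hs⟩
  have h2 := HasFDerivWithinAt.of_comp_of_isEmbedding (g := fun s => (s, R s)) hg hf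
    (LinearMap.isClosedEmbedding_of_injective (LinearMap.ker_eq_bot.2 hinj)).isEmbedding hh
    (Filter.eventually_of_mem self_mem_nhdsWithin fun s hs => by
      simp only [Function.comp_apply, hR s hs]) ht
  have h3 := (hasFDerivWithinAt_snd (p := (t, R t)) (s := univ)).comp t h2 (mapsTo_univ _ _)
  exact h3.hasDerivWithinAt.congr_deriv (by simp)

lemma exists_gradInverse (h : IsConvexPath K Φ) (hx : x ∈ interior K) :
    ∃ R : ℝ → Fin m → ℝ, ∀ t ∈ Icc (0 : ℝ) 1, slabGrad Φ (t, R t) = x := by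
  choose! R hR using fun (t : ℝ) (ht : t ∈ Icc (0 : ℝ) 1) => h.exists_grad_eq ht hx
  exact ⟨R, hR⟩

lemma legendre_eq (h : IsConvexPath K Φ)
    (hR : ∀ t ∈ Icc (0 : ℝ) 1, slabGrad Φ (t, R t) = x) {t : ℝ} (ht : t ∈ Icc (0 : ℝ) 1) :
    legendre Φ t x = x ⬝ᵥ R t - Φ (t, R t) := by
  have := h.legendre_grad ht (R t)
  rwa [hR t ht] at this

/-- The terms with `R'` cancel because `∇Φ(t, R(t)) = x`. -/
lemma hasDerivWithinAt_legendre (h : IsConvexPath K Φ) (hx : x ∈ interior K)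
    (hR : ∀ t ∈ Icc (0 : ℝ) 1, slabGrad Φ (t, R t) = x) {t : ℝ} (ht : t ∈ Icc (0 : ℝ) 1) :
    HasDerivWithinAt (fun s => legendre Φ s x) (-slabDeriv (1, 0) Φ (t, R t)) (Icc 0 1) t := by
  have h1 := h.hasDerivWithinAt_gradInverse hx hR ht
  have h2 := hasDerivWithinAt_comp_curve h.smooth ht h1
  have h3 : HasDerivWithinAt (fun s => x ⬝ᵥ R s)
      (x ⬝ᵥ gradInverseVelocity Φ (t, R t)) (Icc 0 1) t := by
    simp only [dotProduct]
    exact HasDerivWithinAt.fun_sum fun i _ => (hasDerivWithinAt_pi.1 h1 i).const_mul (x i)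
  refine ((h3.sub h2).congr_deriv ?_).congr (fun s hs => h.legendre_eq hR hs)
    (h.legendre_eq hR ht)
  rw [slabDeriv_space Φ, hR t ht]
  ring

lemma velocity_legendre (h : IsConvexPath K Φ) (hx : x ∈ interior K)
    (hR : ∀ t ∈ Icc (0 : ℝ) 1, slabGrad Φ (t, R t) = x) {t : ℝ} (ht : t ∈ Icc (0 : ℝ) 1) :
    DelzantPolytope.velocity (legendre Φ) t x = -slabDeriv (1, 0) Φ (t, R t) :=
  (h.hasDerivWithinAt_legendre hx hR ht).derivWithin (uniqueDiffOn_Icc zero_lt_one t ht)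

lemma hasDerivWithinAt_velocity_legendre (h : IsConvexPath K Φ) (hx : x ∈ interior K)
    (hR : ∀ t ∈ Icc (0 : ℝ) 1, slabGrad Φ (t, R t) = x) {t : ℝ} (ht : t ∈ Icc (0 : ℝ) 1) :
    HasDerivWithinAt (fun s => DelzantPolytope.velocity (legendre Φ) s x)
      (-geodesicDefect Φ (t, R t)) (Icc 0 1) t := by
  have h1 := hasDerivWithinAt_comp_curve (contDiffOn_slabDeriv h.smooth (1, 0)) ht
    (h.hasDerivWithinAt_gradInverse hx hR ht)
  refine (h1.neg.congr_deriv ?_).congr (fun s hs => h.velocity_legendre hx hR hs)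
    (h.velocity_legendre hx hR ht)
  rw [slabDeriv_space (slabDeriv (1, 0) Φ), gradInverseVelocity, geodesicDefect, dotProduct_neg,
    ← sub_eq_add_neg]

lemma acceleration_legendre (h : IsConvexPath K Φ) (hx : x ∈ interior K)
    (hR : ∀ t ∈ Icc (0 : ℝ) 1, slabGrad Φ (t, R t) = x) {t : ℝ} (ht : t ∈ Icc (0 : ℝ) 1) :
    DelzantPolytope.acceleration (legendre Φ) t x = -geodesicDefect Φ (t, R t) := by
  rw [acceleration_eq_velocity_velocity]
  exact (h.hasDerivWithinAt_velocity_legendre hx hR ht).derivWithin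
    (uniqueDiffOn_Icc zero_lt_one t ht)

lemma contDiffOn_legendre (h : IsConvexPath K Φ) (hx : x ∈ interior K) :
    ContDiffOn ℝ 2 (fun t => legendre Φ t x) (Icc 0 1) := by
  obtain ⟨R, hR⟩ := h.exists_gradInverse hx
  have hu := uniqueDiffOn_Icc (zero_lt_one' ℝ)
  rw [show (2 : WithTop ℕ∞) = 1 + 1 from one_add_one_eq_two.symm,
    contDiffOn_succ_iff_derivWithin hu]
  refine ⟨fun t ht => (h.hasDerivWithinAt_legendre hx hR ht).differentiableWithinAt,
    by simp, ?_⟩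
  rw [contDiffOn_one_iff_derivWithin hu]
  refine ⟨fun t ht =>
    (h.hasDerivWithinAt_velocity_legendre hx hR ht).differentiableWithinAt, ?_⟩
  have hc : ContinuousOn (fun t => -geodesicDefect Φ (t, R t)) (Icc 0 1) :=
    ((continuousOn_geodesicDefect h).comp
      (continuousOn_id.prodMk (h.continuousOn_gradInverse hx hR))
      fun t ht => mem_timeSlab.2 ht).neg
  exact hc.congr fun t ht =>
    (h.hasDerivWithinAt_velocity_legendre hx hR ht).derivWithin (hu t ht)

/-- The gradient maps identify the slab with `[0, 1] × interior K`, so the geodesic equation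
becomes the linear equation `ü = 0`. -/
lemma acceleration_legendre_eq_zero_iff (h : IsConvexPath K Φ) {t : ℝ}
    (ht : t ∈ Icc (0 : ℝ) 1) :
    (∀ x ∈ interior K, DelzantPolytope.acceleration (legendre Φ) t x = 0) ↔
      ∀ ρ, geodesicDefect Φ (t, ρ) = 0 := by
  constructor
  · intro hacc ρ
    have hx := h.grad_mem_interior ht ρ
    obtain ⟨R, hR⟩ := h.exists_gradInverse hx
    have h1 := hacc _ hx
    rw [h.acceleration_legendre hx hR ht, h.grad_injective ht (hR t ht)] at h1
    exact neg_eq_zero.1 h1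
  · intro hdef x hx
    obtain ⟨R, hR⟩ := h.exists_gradInverse hx
    rw [h.acceleration_legendre hx hR ht, hdef, neg_zero]

lemma legendre_affine_of_interior (h : IsConvexPath K Φ) (hx : x ∈ interior K)
    (hacc : ∀ t ∈ Icc (0 : ℝ) 1, DelzantPolytope.acceleration (legendre Φ) t x = 0) {t : ℝ}
    (ht : t ∈ Icc (0 : ℝ) 1) :
    legendre Φ t x = legendre Φ 0 x + t * (legendre Φ 1 x - legendre Φ 0 x) := by
  obtain ⟨R, hR⟩ := h.exists_gradInverse hx
  have h0 : (0 : ℝ) ∈ Icc (0 : ℝ) 1 := ⟨le_rfl, zero_le_one⟩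
  set v := fun s => DelzantPolytope.velocity (legendre Φ) s x with hv
  have hv1 : ∀ s ∈ Icc (0 : ℝ) 1, HasDerivWithinAt v 0 (Icc 0 1) s := fun s hs =>
    (h.hasDerivWithinAt_velocity_legendre hx hR hs).congr_deriv
      (by rw [← h.acceleration_legendre hx hR hs, hacc s hs])
  have hvc : ∀ s ∈ Icc (0 : ℝ) 1, v s = v 0 := by
    refine constant_of_derivWithin_zero (fun s hs => (hv1 s hs).differentiableWithinAt)
      fun s hs => (hv1 s (Ico_subset_Icc_self hs)).derivWithin
        (uniqueDiffOn_Icc zero_lt_one s (Ico_subset_Icc_self hs))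
  have hw : ∀ s ∈ Icc (0 : ℝ) 1,
      HasDerivWithinAt (fun s => legendre Φ s x - s * v 0) 0 (Icc 0 1) s := by
    intro s hs
    have h1 := h.hasDerivWithinAt_legendre hx hR hs
    rw [← h.velocity_legendre hx hR hs] at h1
    refine (h1.sub ((hasDerivWithinAt_id s _).mul_const (v 0))).congr_deriv ?_
    rw [one_mul, ← hvc s hs, sub_self]
  have hwc : ∀ s ∈ Icc (0 : ℝ) 1, legendre Φ s x - s * v 0 = legendre Φ 0 x - 0 * v 0 := by
    refine constant_of_derivWithin_zero (fun s hs => (hw s hs).differentiableWithinAt)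
      fun s hs => (hw s (Ico_subset_Icc_self hs)).derivWithin
        (uniqueDiffOn_Icc zero_lt_one s (Ico_subset_Icc_self hs))
  have h1 := hwc t ht
  have h2 := hwc 1 ⟨zero_le_one, le_rfl⟩
  linear_combination h1 - t * h2

lemma bddAbove_legendre (h : IsConvexPath K Φ) {t : ℝ} (ht : t ∈ Icc (0 : ℝ) 1) (hx : x ∈ K) :
    BddAbove (range fun ρ : Fin m → ℝ => x ⬝ᵥ ρ - Φ (t, ρ)) := by
  obtain ⟨C, hC⟩ := h.lower
  refine ⟨C, ?_⟩
  rintro _ ⟨ρ, rfl⟩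
  have := hC t ht ρ x hx
  simp only
  linarith

/-- The Legendre transform is convex and lower semicontinuous on `K`, hence continuous along
segments in `K`. -/
lemma tendsto_legendre_segment (h : IsConvexPath K Φ) {t : ℝ} (ht : t ∈ Icc (0 : ℝ) 1)
    {c : Fin m → ℝ} (hc : c ∈ K) (hx : x ∈ K) :
    Filter.Tendsto (fun s : ℝ => legendre Φ t (s • c + (1 - s) • x)) (nhdsWithin 0 (Ioi 0))
      (nhds (legendre Φ t x)) := by
  have hmemK : ∀ s ∈ Icc (0 : ℝ) 1, s • c + (1 - s) • x ∈ K := fun s hs =>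
    h.convex hc hx hs.1 (sub_nonneg.2 hs.2) (by ring)
  have hIcc : ∀ᶠ s in nhdsWithin (0 : ℝ) (Ioi 0), s ∈ Icc (0 : ℝ) 1 :=
    Filter.mem_of_superset (Ioc_mem_nhdsGT zero_lt_one) Ioc_subset_Icc_self
  have hupper : ∀ s ∈ Icc (0 : ℝ) 1, legendre Φ t (s • c + (1 - s) • x) ≤
      s * legendre Φ t c + (1 - s) * legendre Φ t x := by
    intro s hs
    refine csSup_le (range_nonempty _) ?_
    rintro _ ⟨ρ, rfl⟩
    have h1 := mul_le_mul_of_nonneg_left (le_csSup (h.bddAbove_legendre ht hc) ⟨ρ, rfl⟩) hs.1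
    have h2 := mul_le_mul_of_nonneg_left (le_csSup (h.bddAbove_legendre ht hx) ⟨ρ, rfl⟩)
      (sub_nonneg.2 hs.2)
    simp only [add_dotProduct, smul_dotProduct, smul_eq_mul]
    change s * (c ⬝ᵥ ρ - Φ (t, ρ)) ≤ s * legendre Φ t c at h1
    change (1 - s) * (x ⬝ᵥ ρ - Φ (t, ρ)) ≤ (1 - s) * legendre Φ t x at h2
    linarith
  rw [tendsto_order]
  constructor
  · intro a ha
    obtain ⟨_, ⟨ρ, rfl⟩, hρ⟩ := exists_lt_of_lt_csSup (range_nonempty _) ha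
    have hcont : Continuous fun s : ℝ => (s • c + (1 - s) • x) ⬝ᵥ ρ - Φ (t, ρ) := by
      simp only [add_dotProduct, smul_dotProduct, smul_eq_mul]
      fun_prop
    have hev : ∀ᶠ s in nhdsWithin (0 : ℝ) (Ioi 0),
        a < (s • c + (1 - s) • x) ⬝ᵥ ρ - Φ (t, ρ) := by
      refine (hcont.tendsto' 0 _ ?_).mono_left nhdsWithin_le_nhds |>.eventually_const_lt hρ
      simp
    filter_upwards [hev, hIcc] with s hs hs'
    exact hs.trans_le (le_csSup (h.bddAbove_legendre ht (hmemK s hs')) ⟨ρ, rfl⟩)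
  · intro a ha
    have hcont : Continuous fun s : ℝ => s * legendre Φ t c + (1 - s) * legendre Φ t x := by
      fun_prop
    have hev : ∀ᶠ s in nhdsWithin (0 : ℝ) (Ioi 0),
        s * legendre Φ t c + (1 - s) * legendre Φ t x < a := by
      refine (hcont.tendsto' 0 _ ?_).mono_left nhdsWithin_le_nhds |>.eventually_lt_const ha
      simp
    filter_upwards [hev, hIcc] with s hs hs'
    exact (hupper s hs').trans_lt hs

/-- Affinity in `t` passes from interior points to the boundary along segments. -/
lemma legendre_affine (h : IsConvexPath K Φ) (hK : (interior K).Nonempty) (hx : x ∈ K)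
    (hacc : ∀ t ∈ Icc (0 : ℝ) 1, ∀ y ∈ interior K,
      DelzantPolytope.acceleration (legendre Φ) t y = 0) {t : ℝ} (ht : t ∈ Icc (0 : ℝ) 1) :
    legendre Φ t x = legendre Φ 0 x + t * (legendre Φ 1 x - legendre Φ 0 x) := by
  obtain ⟨c, hc⟩ := hK
  have hcK := interior_subset hc
  have h0 := h.tendsto_legendre_segment (t := 0) ⟨le_rfl, zero_le_one⟩ hcK hx
  have h1 := h.tendsto_legendre_segment (t := 1) ⟨zero_le_one, le_rfl⟩ hcK hx
  refine tendsto_nhds_unique (h.tendsto_legendre_segment ht hcK hx)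
    ((h0.add ((h1.sub h0).const_mul t)).congr' ?_)
  filter_upwards [Ioc_mem_nhdsGT (zero_lt_one' ℝ)] with s hs
  have hint : s • c + (1 - s) • x ∈ interior K :=
    h.convex.combo_interior_self_mem_interior hc hx hs.1 (sub_nonneg.2 hs.2) (by ring)
  exact (h.legendre_affine_of_interior hint (fun τ hτ => hacc τ hτ _ hint) ht).symm

end IsConvexPath

end LegendreDynamics

namespace DelzantPolytope

variable {m : ℕ} (P : DelzantPolytope m)

/-! ### Lattice bases at the vertices -/

/-- The `ℤ`-basis of `ℤᵐ` formed by the normals of the facets through a vertex. -/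
def normalBasis (I : P.Vertex) : Module.Basis I.1 ℤ (Fin m → ℤ) :=
  Module.Basis.mk (P.delzant I.1 I.2).1 (P.delzant I.1 I.2).2.ge

lemma normalBasis_apply (I : P.Vertex) (r : I.1) : P.normalBasis I r = P.normal r := by
  rw [normalBasis, Module.Basis.mk_apply]

/-- The primitive edge vectors at a vertex: the basis dual to the normals. -/
def edge (I : P.Vertex) (r : I.1) (i : Fin m) : ℤ :=
  (P.normalBasis I).repr (Pi.single i 1) r

lemma sum_edge_mul_normal (I : P.Vertex) (i j : Fin m) :
    ∑ r : I.1, P.edge I r i * P.normal r j = if i = j then 1 else 0 := by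
  have h := congrFun ((P.normalBasis I).sum_repr (Pi.single i 1)) j
  rw [Finset.sum_apply] at h
  simp only [normalBasis_apply, Pi.smul_apply, smul_eq_mul, Pi.single_apply] at h
  simp only [edge, h, eq_comm]

lemma sum_normal_mul_edge (I : P.Vertex) (r s : I.1) :
    ∑ i, P.normal r i * P.edge I s i = if r = s then 1 else 0 := by
  have h1 : (P.normalBasis I).repr (P.normal r) s = if r = s then 1 else 0 := by
    rw [← normalBasis_apply, Module.Basis.repr_self, Finsupp.single_apply]
  rw [← h1]
  conv_rhs => rw [pi_eq_sum_univ' (P.normal r)]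
  rw [map_sum, Finsupp.finsetSum_apply]
  exact Finset.sum_congr rfl fun i _ => by rw [map_smul, Finsupp.smul_apply, smul_eq_mul, edge]

/-- The matrix whose rows are the normals of the facets through a vertex. -/
def normalMatrix (I : P.Vertex) : Matrix I.1 (Fin m) ℝ := Matrix.of fun r i => (P.normal r i : ℝ)

/-- The matrix whose columns are the primitive edge vectors at a vertex. -/
def edgeMatrix (I : P.Vertex) : Matrix (Fin m) I.1 ℝ := Matrix.of fun i r => (P.edge I r i : ℝ)

lemma normalMatrix_mul_edgeMatrix (I : P.Vertex) : P.normalMatrix I * P.edgeMatrix I = 1 := by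
  ext r s
  rw [Matrix.mul_apply, Matrix.one_apply]
  have := P.sum_normal_mul_edge I r s
  simp only [normalMatrix, edgeMatrix, Matrix.of_apply]
  exact_mod_cast this

lemma edgeMatrix_mul_normalMatrix (I : P.Vertex) : P.edgeMatrix I * P.normalMatrix I = 1 := by
  ext i j
  rw [Matrix.mul_apply, Matrix.one_apply]
  have := P.sum_edge_mul_normal I i j
  simp only [normalMatrix, edgeMatrix, Matrix.of_apply]
  exact_mod_cast this

/-- The linear change from the logarithmic coordinates `y_r = log |η_r|²` of the chart at a vertex
to the logarithmic coordinates `ρ_i = log |z_i|²` of the open orbit. -/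
def orbitCoord (I : P.Vertex) (y : I.1 → ℝ) : Fin m → ℝ := Matrix.vecMul y (P.normalMatrix I)

/-- The inverse of `orbitCoord`. -/
def chartCoord (I : P.Vertex) (ρ : Fin m → ℝ) : I.1 → ℝ := Matrix.vecMul ρ (P.edgeMatrix I)

lemma orbitCoord_chartCoord (I : P.Vertex) (ρ : Fin m → ℝ) :
    P.orbitCoord I (P.chartCoord I ρ) = ρ := by
  rw [orbitCoord, chartCoord, Matrix.vecMul_vecMul, edgeMatrix_mul_normalMatrix, Matrix.vecMul_one]

/-! ### The charts and the open orbit -/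

variable {P} in
lemma mkPoint_eq {w w' : P.LatticePoint → ℂ} {h0 hw h0' hw'} (c : ℂ) (h : c • w' = w) :
    P.mkPoint w h0 hw = P.mkPoint w' h0' hw' :=
  Subtype.ext ((Projectivization.mk_eq_mk_iff' ℂ _ _ _ _).2 ⟨c, h⟩)

lemma monomial_mul (z w : Fin m → ℂˣ) (α : P.LatticePoint) :
    P.monomial (z * w) α = P.monomial z α * P.monomial w α := by
  simp only [monomial, ← Finset.prod_mul_distrib, Pi.mul_apply, Units.val_mul, mul_zpow]

lemma torusAction_torusPoint (z w : Fin m → ℂˣ) :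
    P.torusAction z (P.torusPoint w) = P.torusPoint (z * w) := by
  obtain ⟨c, hc⟩ := Projectivization.exists_smul_eq_mk_rep ℂ (P.monomial w)
    (fun h => P.monomial_ne_zero w (Classical.arbitrary _) (congrFun h _))
  refine mkPoint_eq (c : ℂ) (funext fun α => ?_)
  have h1 : (c : ℂ) * P.monomial w α = (P.torusPoint w).1.rep α := congrFun hc α
  rw [← h1, Pi.smul_apply, smul_eq_mul, monomial_mul]
  ring

/-- The point `e^(ρ/2)` of the open orbit. -/
def orbitPoint (ρ : Fin m → ℝ) : P.ToricVariety :=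
  P.torusPoint fun i => Units.mk0 (Complex.exp ((ρ i / 2 : ℝ) : ℂ)) (Complex.exp_ne_zero _)

variable {P} in
lemma IsTorusInvariant.torusPoint_eq {f : P.ToricVariety → ℝ} (hf : P.IsTorusInvariant f)
    (z : Fin m → ℂˣ) :
    f (P.torusPoint z) = f (P.orbitPoint fun i => 2 * Real.log ‖(z i : ℂ)‖) := by
  set w : Fin m → ℂˣ := fun i => Units.mk0
    (Complex.exp ((2 * Real.log ‖(z i : ℂ)‖ / 2 : ℝ) : ℂ)) (Complex.exp_ne_zero _) with hw
  have hnorm : ∀ i, ‖(w i : ℂ)‖ = ‖(z i : ℂ)‖ := by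
    intro i
    simp only [hw, Units.val_mk0]
    rw [Complex.norm_exp_ofReal, mul_div_cancel_left₀ _ two_ne_zero,
      Real.exp_log (norm_pos_iff.2 (z i).ne_zero)]
  have h1 := hf (z * w⁻¹) (fun i => by
    rw [Pi.mul_apply, Pi.inv_apply, Units.val_mul, Units.val_inv_eq_inv_val, norm_mul, norm_inv,
      hnorm, mul_inv_cancel₀ (norm_ne_zero_iff.2 (z i).ne_zero)]) (P.torusPoint w)
  rw [torusAction_torusPoint, inv_mul_cancel_right] at h1
  exact h1

lemma prod_zpow_sum {ι : Type*} (s : Finset ι) {a : ℂ} (ha : a ≠ 0) (n : ι → ℤ) :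
    ∏ i ∈ s, a ^ n i = a ^ ∑ i ∈ s, n i := by
  classical
  induction s using Finset.induction_on with
  | empty => simp
  | insert i s hi ih => rw [Finset.prod_insert hi, Finset.sum_insert hi, ih, zpow_add₀ ha]

/-- The torus coordinates `z_i = ∏ η_r ^ (v_r)_i` of a point of the chart at a vertex all of whose
coordinates are nonzero. -/
def torusCoord (I : P.Vertex) (η : I.1 → ℂ) (hη : ∀ r, η r ≠ 0) (i : Fin m) : ℂˣ :=
  Units.mk0 (∏ r : I.1, η r ^ P.normal r i)
    (Finset.prod_ne_zero_iff.2 fun r _ => zpow_ne_zero _ (hη r))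

lemma chart_eq_torusPoint (I : P.Vertex) (η : I.1 → ℂ) (hη : ∀ r, η r ≠ 0) :
    P.chart I η = P.torusPoint (P.torusCoord I η hη) := by
  refine mkPoint_eq (∏ r : I.1, η r ^ (-P.offset r)) (funext fun α => ?_)
  have h1 : P.monomial (P.torusCoord I η hη) α =
      ∏ r : I.1, η r ^ (∑ i, P.normal r i * α.1 i) := by
    simp only [monomial, torusCoord, Units.val_mk0, ← Finset.prod_zpow]
    rw [Finset.prod_comm]
    refine Finset.prod_congr rfl fun r _ => ?_
    simp only [← zpow_mul]
    exact prod_zpow_sum _ (hη r) _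
  rw [Pi.smul_apply, smul_eq_mul, h1, chartVec, ← Finset.prod_mul_distrib]
  refine Finset.prod_congr rfl fun r _ => ?_
  rw [← zpow_add₀ (hη r), ← zpow_natCast, Int.toNat_of_nonneg (P.ell_nonneg _ _), ell]
  congr 1
  ring

lemma torusPoint_eq_chart (J : P.Vertex) (z : Fin m → ℂˣ) :
    P.torusPoint z = P.chart J fun r => ∏ i, (z i : ℂ) ^ P.edge J r i := by
  have hη : ∀ r, ∏ i, (z i : ℂ) ^ P.edge J r i ≠ 0 := fun r =>
    Finset.prod_ne_zero_iff.2 fun i _ => zpow_ne_zero _ (z i).ne_zero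
  rw [P.chart_eq_torusPoint J _ hη]
  congr 1
  funext k
  refine Units.ext ?_
  simp only [torusCoord, Units.val_mk0, ← Finset.prod_zpow]
  rw [Finset.prod_comm]
  simp only [← zpow_mul]
  rw [Finset.prod_congr rfl fun i _ => prod_zpow_sum _ (z i).ne_zero _]
  simp only [sum_edge_mul_normal]
  rw [Finset.prod_eq_single k]
  · simp
  · intro i _ hi
    simp [hi]
  · simp

lemma orbitPoint_eq_chart (I : P.Vertex) (ρ : Fin m → ℝ) :
    P.orbitPoint ρ = P.chart I fun r => Complex.exp ((P.chartCoord I ρ r / 2 : ℝ) : ℂ) := by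
  rw [orbitPoint, torusPoint_eq_chart P I]
  congr 1
  funext r
  simp only [Units.val_mk0, ← Complex.exp_int_mul]
  rw [← Complex.exp_sum]
  congr 1
  simp only [chartCoord, Matrix.vecMul, dotProduct, edgeMatrix, Matrix.of_apply]
  push_cast
  rw [Finset.sum_div]
  exact Finset.sum_congr rfl fun i _ => by ring

/-- Logarithmic coordinates `log |z_j|²` on `(ℂ*)ⁿ`. -/
def logCoord {ι : Type*} (z : ι → ℂ) (j : ι) : ℝ := 2 * Real.log ‖z j‖

variable {P} in
lemma IsTorusInvariant.chart_eq {f : P.ToricVariety → ℝ} (hf : P.IsTorusInvariant f)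
    (I : P.Vertex) {η : I.1 → ℂ} (hη : ∀ r, η r ≠ 0) :
    f (P.chart I η) = f (P.orbitPoint (P.orbitCoord I (logCoord η))) := by
  rw [P.chart_eq_torusPoint I η hη, hf.torusPoint_eq]
  congr 2
  funext i
  simp only [torusCoord, Units.val_mk0, norm_prod, norm_zpow, orbitCoord, Matrix.vecMul,
    dotProduct, logCoord, normalMatrix, Matrix.of_apply]
  rw [Real.log_prod fun r _ => zpow_ne_zero _ (norm_ne_zero_iff.2 (hη r)), Finset.mul_sum]
  refine Finset.sum_congr rfl fun r _ => ?_
  rw [Real.log_zpow]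
  ring

lemma orbitPotential_eq (f : P.ToricVariety → ℝ) (ρ : Fin m → ℝ) :
    P.orbitPotential f ρ =
      Real.log (∑ α : P.LatticePoint, Real.exp (∑ i, (α.1 i : ℝ) * ρ i)) +
        f (P.orbitPoint ρ) := rfl

lemma norm_chartVec_sq (I : P.Vertex) {η : I.1 → ℂ} (hη : ∀ r, η r ≠ 0) (α : P.LatticePoint) :
    ‖P.chartVec I η α‖ ^ 2 = Real.exp (-∑ r : I.1, (P.offset r : ℝ) * logCoord η r) *
      Real.exp (∑ i, (α.1 i : ℝ) * P.orbitCoord I (logCoord η) i) := by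
  have h1 : ∀ r : I.1, ‖η r ^ (P.ell r α).toNat‖ ^ 2 =
      Real.exp ((P.ell r α : ℝ) * logCoord η r) := by
    intro r
    have h2 : ((P.ell r α).toNat : ℝ) = (P.ell r α : ℝ) := by
      exact_mod_cast Int.toNat_of_nonneg (P.ell_nonneg r α)
    rw [norm_pow, ← pow_mul, mul_comm, pow_mul, ← h2, Real.exp_nat_mul, logCoord,
      mul_comm (2 : ℝ), ← Real.rpow_def_of_pos (norm_pos_iff.2 (hη r)), Real.rpow_two]
  rw [chartVec, norm_prod, ← Finset.prod_pow, Finset.prod_congr rfl fun r _ => h1 r,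
    ← Real.exp_sum, ← Real.exp_add]
  congr 1
  simp only [ell, orbitCoord, Matrix.vecMul, dotProduct, normalMatrix, Matrix.of_apply]
  push_cast
  simp only [sub_mul, Finset.sum_sub_distrib, Finset.mul_sum, Finset.sum_mul]
  rw [Finset.sum_comm, neg_add_eq_sub]
  congr 1
  exact Finset.sum_congr rfl fun i _ => Finset.sum_congr rfl fun r _ => by ring

/-- On the open orbit the Kähler potentials in the chart at a vertex and in the torus coordinates
differ by a pluriharmonic function. -/
lemma localPotential_eq {f : P.ToricVariety → ℝ} (hf : P.IsTorusInvariant f)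
    (I : P.Vertex) {η : I.1 → ℂ} (hη : ∀ r, η r ≠ 0) :
    P.localPotential f I η = P.orbitPotential f (P.orbitCoord I (logCoord η)) -
      ∑ r : I.1, (P.offset r : ℝ) * logCoord η r := by
  rw [localPotential, orbitPotential_eq, hf.chart_eq I hη]
  simp only [P.norm_chartVec_sq I hη]
  rw [← Finset.mul_sum, Real.log_mul (Real.exp_pos _).ne'
    (Finset.sum_pos (fun α _ => Real.exp_pos _) Finset.univ_nonempty).ne', Real.log_exp]
  ring

/-! ### Compactness -/

lemma convex_carrier : Convex ℝ P.carrier := by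
  intro x hx y hy a b ha hb hab r
  have h1 := mul_nonneg ha (hx r)
  have h2 := mul_nonneg hb (hy r)
  have h3 : ∑ i, (P.normal r i : ℝ) * (a • x + b • y) i - P.offset r =
      a * (∑ i, (P.normal r i : ℝ) * x i - P.offset r) +
        b * (∑ i, (P.normal r i : ℝ) * y i - P.offset r) := by
    have h4 : ∑ i, (P.normal r i : ℝ) * (a • x + b • y) i =
        a * ∑ i, (P.normal r i : ℝ) * x i + b * ∑ i, (P.normal r i : ℝ) * y i := by
      rw [Finset.mul_sum, Finset.mul_sum, ← Finset.sum_add_distrib]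
      refine Finset.sum_congr rfl fun i _ => ?_
      simp only [Pi.add_apply, Pi.smul_apply, smul_eq_mul]
      ring
    rw [h4]
    linear_combination (P.offset r : ℝ) * hab
  rw [h3]
  exact add_nonneg h1 h2

lemma isClosed_carrier : IsClosed P.carrier := by
  have : P.carrier = ⋂ r, {x | 0 ≤ (∑ i, (P.normal r i : ℝ) * x i) - P.offset r} := by
    ext x
    simp [carrier, polyhedron]
  rw [this]
  exact isClosed_iInter fun r => isClosed_le continuous_const (by fun_prop)

lemma isCompact_carrier : IsCompact P.carrier :=
  Metric.isCompact_of_isClosed_isBounded P.isClosed_carrier P.bounded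

/-- A linear function `⟨·, ρ⟩` attains its maximum over the polytope at a vertex, which is a
lattice point, and it is nonincreasing along the edges from that vertex: the point `e^(ρ/2)` lies
in the closed unit polydisc of the chart there. -/
lemma exists_maximizing_vertex (ρ : Fin m → ℝ) :
    ∃ (I : P.Vertex) (α : P.LatticePoint),
      (∀ x ∈ P.carrier, x ⬝ᵥ ρ ≤ (fun i => (α.1 i : ℝ)) ⬝ᵥ ρ) ∧
      ∀ r, P.chartCoord I ρ r ≤ 0 := by
  classical
  let l : StrongDual ℝ (Fin m → ℝ) :=
    ∑ i, ρ i • ContinuousLinearMap.proj (R := ℝ) (φ := fun _ => ℝ) i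
  have hl : ∀ x, l x = x ⬝ᵥ ρ := fun x => by
    simp [l, dotProduct, mul_comm]
  set B := {x ∈ P.carrier | ∀ y ∈ P.carrier, l y ≤ l x} with hB
  have hexp : IsExposed ℝ P.carrier B := fun _ => ⟨l, rfl⟩
  have hne : B.Nonempty := by
    obtain ⟨x, hx, hmax⟩ := P.isCompact_carrier.exists_isMaxOn
      (P.interior_nonempty.mono interior_subset) l.continuous.continuousOn
    exact ⟨x, hx, fun y hy => hmax hy⟩
  obtain ⟨x, hx⟩ := (hexp.isCompact P.isCompact_carrier).extremePoints_nonempty hne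
  have hxe := hexp.isExtreme.extremePoints_subset_extremePoints hx
  have hxB : x ∈ B := hx.1
  let I : P.Vertex :=
    ⟨Finset.univ.filter fun r => (∑ i, (P.normal r i : ℝ) * x i) - P.offset r = 0,
      x, hxe, by simp⟩
  have hI : ∀ r, r ∈ I.1 ↔ (∑ i, (P.normal r i : ℝ) * x i) - P.offset r = 0 := by
    simp [I]
  obtain ⟨α, hα⟩ := P.exists_vertex_latticePoint I
  have hxα : x = fun i => (α.1 i : ℝ) := by
    have h1 : (P.normalMatrix I).mulVec x = (P.normalMatrix I).mulVec fun i => (α.1 i : ℝ) := by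
      funext r
      have h2 := (hI r).1 r.2
      have h3 := hα r r.2
      rw [ell] at h3
      have h4 : (∑ i, (P.normal r i : ℝ) * α.1 i) - P.offset r = 0 := by exact_mod_cast h3
      simp only [Matrix.mulVec, dotProduct, normalMatrix, Matrix.of_apply]
      linarith
    have h5 := congrArg (P.edgeMatrix I).mulVec h1
    rwa [Matrix.mulVec_mulVec, Matrix.mulVec_mulVec, edgeMatrix_mul_normalMatrix,
      Matrix.one_mulVec, Matrix.one_mulVec] at h5
  refine ⟨I, α, fun y hy => ?_, fun r => ?_⟩
  · rw [← hl, ← hl, ← hxα]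
    exact hxB.2 y hy
  · -- `x + ε w` stays in the polytope for small `ε > 0`, `w` the edge vector dual to `r`
    set w : Fin m → ℝ := fun i => (P.edge I r i : ℝ) with hw
    have hin : ∀ᶠ ε in nhdsWithin (0 : ℝ) (Ioi 0), x + ε • w ∈ P.carrier := by
      simp only [carrier, polyhedron, mem_ofPred_eq]
      refine Filter.eventually_all.2 fun s => ?_
      have hlin : ∀ ε : ℝ, ∑ i, (P.normal s i : ℝ) * (x + ε • w) i - P.offset s =
          (∑ i, (P.normal s i : ℝ) * x i - P.offset s) + ε * ∑ i, (P.normal s i : ℝ) * w i := by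
        intro ε
        simp only [Pi.add_apply, Pi.smul_apply, smul_eq_mul, mul_add, Finset.sum_add_distrib,
          Finset.mul_sum]
        rw [add_sub_right_comm]
        congr 1
        exact Finset.sum_congr rfl fun i _ => by ring
      by_cases hs : s ∈ I.1
      · filter_upwards [self_mem_nhdsWithin] with ε hε
        have h1 := P.sum_normal_mul_edge I ⟨s, hs⟩ r
        have h2 : ∑ i, (P.normal s i : ℝ) * (P.edge I r i : ℝ) =
            if (⟨s, hs⟩ : I.1) = r then 1 else 0 := by exact_mod_cast h1
        change ∑ i, (P.normal s i : ℝ) * w i = _ at h2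
        rw [hlin, (hI s).1 hs, h2, zero_add]
        have : (0 : ℝ) < ε := hε
        split_ifs <;> simp [this.le]
      · have hpos : 0 < ∑ i, (P.normal s i : ℝ) * x i - P.offset s :=
          lt_of_le_of_ne (hxB.1 s) fun h => hs ((hI s).2 h.symm)
        have hcont : Continuous fun ε : ℝ =>
            ∑ i, (P.normal s i : ℝ) * (x + ε • w) i - P.offset s := by fun_prop
        have := (hcont.tendsto' 0 _ (by simp)).mono_left
          (nhdsWithin_le_nhds (s := Ioi 0)) |>.eventually_const_lt hpos
        exact this.mono fun ε hε => hε.le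
    obtain ⟨ε, hε, hε0⟩ := (hin.and self_mem_nhdsWithin).exists
    have h1 := hxB.2 _ hε
    rw [map_add, map_smul, smul_eq_mul] at h1
    have h2 : P.chartCoord I ρ r = l w := by
      rw [hl, dotProduct_comm]
      rfl
    rw [h2]
    have hε0' : (0 : ℝ) < ε := hε0
    by_contra hcon
    have := mul_pos hε0' (not_le.1 hcon)
    linarith

lemma exists_chart_polydisc (ρ : Fin m → ℝ) :
    ∃ (I : P.Vertex) (η : I.1 → ℂ), (∀ r, ‖η r‖ ≤ 1) ∧ P.orbitPoint ρ = P.chart I η := by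
  obtain ⟨I, -, -, hI⟩ := P.exists_maximizing_vertex ρ
  refine ⟨I, _, fun r => ?_, P.orbitPoint_eq_chart I ρ⟩
  rw [Complex.norm_exp_ofReal, Real.exp_le_one_iff]
  linarith [hI r]

/-- A continuous path of functions on the toric variety is uniformly bounded on the open orbit. -/
lemma exists_bound_orbitPoint {F : ℝ → P.ToricVariety → ℝ}
    (hF : ∀ I : P.Vertex, ContinuousOn (fun q : ℝ × (I.1 → ℂ) => F q.1 (P.chart I q.2))
      (Icc 0 1 ×ˢ univ)) :
    ∃ C : ℝ, ∀ t ∈ Icc (0 : ℝ) 1, ∀ ρ, |F t (P.orbitPoint ρ)| ≤ C := by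
  have h1 : ∀ I : P.Vertex, ∃ C : ℝ, ∀ t ∈ Icc (0 : ℝ) 1, ∀ η : I.1 → ℂ, (∀ r, ‖η r‖ ≤ 1) →
      |F t (P.chart I η)| ≤ C := by
    intro I
    have hc : IsCompact (Icc (0 : ℝ) 1 ×ˢ Metric.closedBall (0 : I.1 → ℂ) 1) :=
      isCompact_Icc.prod (isCompact_closedBall _ _)
    obtain ⟨C, hC⟩ := hc.exists_bound_of_continuousOn
      ((hF I).mono (prod_mono_right (subset_univ _)))
    refine ⟨C, fun t ht η hη => hC (t, η) ⟨ht, ?_⟩⟩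
    rw [mem_closedBall_zero_iff]
    exact (pi_norm_le_iff_of_nonneg zero_le_one).2 hη
  choose C hC using h1
  refine ⟨∑ I, |C I|, fun t ht ρ => ?_⟩
  obtain ⟨I, η, hη, hρ⟩ := P.exists_chart_polydisc ρ
  rw [hρ]
  exact (hC I t ht η hη).trans ((le_abs_self _).trans
    (Finset.single_le_sum (f := fun I => |C I|) (fun J _ => abs_nonneg _) (Finset.mem_univ I)))

end DelzantPolytope

/-! ### Complex Hessians in logarithmic coordinates -/

section LogHessian

variable {ι : Type*}

/-- The derivative of `logCoord` at a point with nonzero coordinates. -/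
def logCoordDeriv (z : ι → ℂ) : (ι → ℂ) →L[ℝ] (ι → ℝ) :=
  ContinuousLinearMap.pi fun j =>
    ((‖z j‖ ^ 2)⁻¹ • (2 : ℝ) • innerSL ℝ (z j)).comp (ContinuousLinearMap.proj j)

lemma hasFDerivAt_logCoord [Fintype ι] {z : ι → ℂ} (hz : ∀ j, z j ≠ 0) :
    HasFDerivAt DelzantPolytope.logCoord (logCoordDeriv z) z := by
  refine hasFDerivAt_pi.2 fun j => ?_
  have h1 : HasFDerivAt (fun c : ℂ => Real.log (‖c‖ ^ 2))
      ((‖z j‖ ^ 2)⁻¹ • (2 : ℝ) • innerSL ℝ (z j)) (z j) := by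
    refine ((hasStrictFDerivAt_norm_sq (z j)).hasFDerivAt.log
      (pow_ne_zero 2 (norm_ne_zero_iff.2 (hz j)))).congr_fderiv ?_
    congr 1
    exact (two_nsmul _).trans (two_smul ℝ _).symm
  have h2 := h1.comp z (hasFDerivAt_apply (𝕜 := ℝ) j z)
  refine h2.congr_of_eventuallyEq (Filter.Eventually.of_forall fun w => ?_)
  simp [DelzantPolytope.logCoord, Real.log_pow]

lemma logCoordDeriv_single [DecidableEq ι] (z : ι → ℂ) (j : ι) (c : ℂ) :
    logCoordDeriv z (Pi.single j c) =
      Pi.single j (2 * (c.re * (z j).re + c.im * (z j).im) / ‖z j‖ ^ 2) := by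
  funext k
  rcases eq_or_ne k j with rfl | hk
  · simp [logCoordDeriv, Complex.inner]
    ring
  · simp [logCoordDeriv, hk]

lemma hasFDerivAt_ofReal_comp_logCoord [Fintype ι] {z : ι → ℂ} (hz : ∀ j, z j ≠ 0) {G : (ι → ℝ) → ℝ}
    {G' : (ι → ℝ) →L[ℝ] ℝ} (hG : HasFDerivAt G G' (DelzantPolytope.logCoord z)) :
    HasFDerivAt (fun w => (G (DelzantPolytope.logCoord w) : ℂ))
      (Complex.ofRealCLM.comp (G'.comp (logCoordDeriv z))) z :=
  Complex.ofRealCLM.hasFDerivAt.comp z (hG.comp z (hasFDerivAt_logCoord hz))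

lemma inv_eq_re_im {c : ℂ} (hc : c ≠ 0) :
    (c.re - Complex.I * c.im : ℂ) / ((‖c‖ : ℝ) : ℂ) ^ 2 = c⁻¹ := by
  have h : (c.re - Complex.I * c.im : ℂ) = starRingEnd ℂ c := by
    apply Complex.ext <;> simp
  rw [h, ← Complex.mul_conj', div_mul_cancel_right₀ ((map_ne_zero _).2 hc)]

lemma inv_conj_eq_re_im {c : ℂ} (hc : c ≠ 0) :
    (c.re + Complex.I * c.im : ℂ) / ((‖c‖ : ℝ) : ℂ) ^ 2 = (starRingEnd ℂ c)⁻¹ := by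
  have h := congrArg (starRingEnd ℂ) (inv_eq_re_im hc)
  rw [map_inv₀] at h
  rw [← h]
  simp

lemma wirtinger_logCoord [Fintype ι] [DecidableEq ι]
    {z : ι → ℂ} (hz : ∀ j, z j ≠ 0) {G : (ι → ℝ) → ℝ}
    {G' : (ι → ℝ) →L[ℝ] ℝ} (hG : HasFDerivAt G G' (DelzantPolytope.logCoord z)) (j : ι) :
    wirtinger (fun w => (G (DelzantPolytope.logCoord w) : ℂ)) z j =
      (G' (Pi.single j 1) : ℂ) * (z j)⁻¹ := by
  have key : ∀ a : ℝ, G' (Pi.single j a) = a * G' (Pi.single j 1) := fun a => by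
    rw [← smul_eq_mul, ← map_smul, ← Pi.single_smul, smul_eq_mul, mul_one]
  rw [wirtinger, (hasFDerivAt_ofReal_comp_logCoord hz hG).fderiv, ← inv_eq_re_im (hz j)]
  simp only [ContinuousLinearMap.comp_apply, logCoordDeriv_single, Complex.ofRealCLM_apply]
  rw [key (2 * _ / _), key (2 * _ / _)]
  simp only [Complex.one_re, Complex.one_im, Complex.I_re, Complex.I_im]
  push_cast
  ring

lemma wirtingerBar_logCoord [Fintype ι] [DecidableEq ι]
    {z : ι → ℂ} (hz : ∀ j, z j ≠ 0) {G : (ι → ℝ) → ℝ}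
    {G' : (ι → ℝ) →L[ℝ] ℝ} (hG : HasFDerivAt G G' (DelzantPolytope.logCoord z)) (j : ι) :
    wirtingerBar (fun w => (G (DelzantPolytope.logCoord w) : ℂ)) z j =
      (G' (Pi.single j 1) : ℂ) * (starRingEnd ℂ (z j))⁻¹ := by
  have key : ∀ a : ℝ, G' (Pi.single j a) = a * G' (Pi.single j 1) := fun a => by
    rw [← smul_eq_mul, ← map_smul, ← Pi.single_smul, smul_eq_mul, mul_one]
  rw [wirtingerBar, (hasFDerivAt_ofReal_comp_logCoord hz hG).fderiv, ← inv_conj_eq_re_im (hz j)]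
  simp only [ContinuousLinearMap.comp_apply, logCoordDeriv_single, Complex.ofRealCLM_apply]
  rw [key (2 * _ / _), key (2 * _ / _)]
  simp only [Complex.one_re, Complex.one_im, Complex.I_re, Complex.I_im]
  push_cast
  ring

lemma wirtinger_congr [DecidableEq ι] {f g : (ι → ℂ) → ℂ} {z : ι → ℂ} (h : f =ᶠ[nhds z] g) :
    wirtinger f z = wirtinger g z := by
  funext j
  simp only [wirtinger, h.fderiv_eq]

lemma wirtingerBar_congr [DecidableEq ι] {f g : (ι → ℂ) → ℂ} {z : ι → ℂ} (h : f =ᶠ[nhds z] g) :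
    wirtingerBar f z = wirtingerBar g z := by
  funext j
  simp only [wirtingerBar, h.fderiv_eq]

lemma wirtinger_mul [Fintype ι] [DecidableEq ι] {f g : (ι → ℂ) → ℂ} {z : ι → ℂ}
    (hf : DifferentiableAt ℝ f z)
    (hg : DifferentiableAt ℝ g z) (j : ι) :
    wirtinger (fun w => f w * g w) z j = wirtinger f z j * g z + f z * wirtinger g z j := by
  simp only [wirtinger, fderiv_fun_mul hf hg, add_apply, smul_apply, smul_eq_mul]
  ring

lemma hasFDerivAt_inv_conj [Fintype ι] {z : ι → ℂ} (k : ι) (hz : z k ≠ 0) :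
    HasFDerivAt (fun w : ι → ℂ => (starRingEnd ℂ (w k))⁻¹)
      ((Complex.conjCLE : ℂ →L[ℝ] ℂ).comp
        ((ContinuousLinearMap.toSpanSingleton ℂ (-((z k) ^ 2)⁻¹)).restrictScalars ℝ ∘L
          ContinuousLinearMap.proj k)) z := by
  have h1 := ((hasDerivAt_inv hz).hasFDerivAt.restrictScalars ℝ).comp z
    (hasFDerivAt_apply (𝕜 := ℝ) k z)
  have h2 := (Complex.conjCLE : ℂ →L[ℝ] ℂ).hasFDerivAt.comp z h1
  refine h2.congr_of_eventuallyEq (Filter.Eventually.of_forall fun w => ?_)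
  simp

/-- Antiholomorphic functions have vanishing `∂`-derivative. -/
lemma wirtinger_inv_conj [Fintype ι] [DecidableEq ι] {z : ι → ℂ} (k : ι) (hz : z k ≠ 0) (j : ι) :
    wirtinger (fun w : ι → ℂ => (starRingEnd ℂ (w k))⁻¹) z j = 0 := by
  rw [wirtinger, (hasFDerivAt_inv_conj k hz).fderiv]
  rcases eq_or_ne k j with rfl | hk
  · simp
    rw [← mul_assoc, Complex.I_mul_I]
    ring
  · simp [hk]

lemma eventually_forall_ne_zero [Fintype ι] {z : ι → ℂ} (hz : ∀ j, z j ≠ 0) :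
    ∀ᶠ w in nhds z, ∀ j, w j ≠ 0 :=
  Filter.eventually_all.2 fun j => (continuous_apply j).continuousAt.eventually_ne (hz j)

/-- A function that only depends on the logarithmic coordinates `y_j = log |z_j|²` has complex
Hessian `(∂²K / ∂y_j ∂y_k) / (z_j z̄_k)`. -/
lemma complexHessian_logCoord [Fintype ι] [DecidableEq ι] {f : (ι → ℂ) → ℝ} {z : ι → ℂ}
    (hz : ∀ j, z j ≠ 0)
    {K : (ι → ℝ) → ℝ} {K₁ : ι → (ι → ℝ) → ℝ} {K₂ : Matrix ι ι ℝ}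
    (hf : ∀ᶠ w in nhds z, f w = K (DelzantPolytope.logCoord w))
    (h1 : ∀ᶠ y in nhds (DelzantPolytope.logCoord z), ∃ K' : (ι → ℝ) →L[ℝ] ℝ,
      HasFDerivAt K K' y ∧ ∀ k, K' (Pi.single k 1) = K₁ k y)
    (h2 : ∀ k, ∃ K' : (ι → ℝ) →L[ℝ] ℝ,
      HasFDerivAt (K₁ k) K' (DelzantPolytope.logCoord z) ∧ ∀ j, K' (Pi.single j 1) = K₂ j k) :
    complexHessian f z = Matrix.diagonal (fun j => (z j)⁻¹) * K₂.map Complex.ofReal *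
      Matrix.diagonal fun k => (starRingEnd ℂ (z k))⁻¹ := by
  ext j k
  rw [Matrix.mul_diagonal, Matrix.diagonal_mul, Matrix.map_apply]
  have hbar : (fun w => wirtingerBar (fun w' => (f w' : ℂ)) w k) =ᶠ[nhds z]
      fun w => (K₁ k (DelzantPolytope.logCoord w) : ℂ) * (starRingEnd ℂ (w k))⁻¹ := by
    filter_upwards [hf.eventually_nhds, eventually_forall_ne_zero hz,
      (hasFDerivAt_logCoord hz).continuousAt.eventually h1] with w hw hw0 ⟨K', hK', hK1⟩
    have h3 : (fun w' => (f w' : ℂ)) =ᶠ[nhds w]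
        fun w' => (K (DelzantPolytope.logCoord w') : ℂ) := hw.mono fun w' h => by simp only [h]
    rw [wirtingerBar_congr h3, wirtingerBar_logCoord hw0 hK', hK1]
  obtain ⟨K', hK', hK2⟩ := h2 k
  simp only [complexHessian, Matrix.of_apply]
  rw [wirtinger_congr hbar, wirtinger_mul
    (hasFDerivAt_ofReal_comp_logCoord hz hK').differentiableAt
    (hasFDerivAt_inv_conj k (hz k)).differentiableAt, wirtinger_inv_conj k (hz k),
    wirtinger_logCoord hz hK', hK2]
  ring

end LogHessian

namespace DelzantPolytope

variable {m : ℕ} (P : DelzantPolytope m)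

/-! ### Paths of toric Kähler metrics on the open orbit -/

/-- A smooth path `e^(-F_t) h_FS`, `t ∈ [0, 1]`, of toric metrics with positive curvature. -/
structure IsToricPath (F : ℝ → P.ToricVariety → ℝ) : Prop where
  smooth : P.IsSmoothPath F
  invariant : ∀ t ∈ Icc (0 : ℝ) 1, P.IsTorusInvariant (F t)
  posDef : ∀ t ∈ Icc (0 : ℝ) 1, ∀ (I : P.Vertex) (η : I.1 → ℂ), (P.metricMatrix (F t) I η).PosDef

/-- The path of open-orbit Kähler potentials, as a function on the time slab. -/
def orbitPath (F : ℝ → P.ToricVariety → ℝ) (q : ℝ × (Fin m → ℝ)) : ℝ :=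
  P.orbitPotential (F q.1) q.2

instance : Nonempty P.Vertex := ⟨(P.exists_maximizing_vertex 0).choose⟩

/-- `orbitCoord` as a continuous linear map. -/
def orbitCoordCLM (I : P.Vertex) : (I.1 → ℝ) →L[ℝ] (Fin m → ℝ) :=
  LinearMap.toContinuousLinearMap (Matrix.vecMulLinear (P.normalMatrix I))

lemma orbitCoordCLM_apply (I : P.Vertex) (y : I.1 → ℝ) :
    P.orbitCoordCLM I y = P.orbitCoord I y := rfl

lemma orbitCoord_single (I : P.Vertex) (r : I.1) :
    P.orbitCoord I (Pi.single r 1) = P.normalMatrix I r := by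
  rw [orbitCoord, Matrix.single_one_vecMul]
  rfl

lemma contDiff_chartPoint (I : P.Vertex) :
    ContDiff ℝ ∞ fun (ρ : Fin m → ℝ) (r : I.1) =>
      Complex.exp ((P.chartCoord I ρ r / 2 : ℝ) : ℂ) := by
  refine contDiff_pi.2 fun r => ContDiff.cexp (Complex.ofRealCLM.contDiff.comp ?_)
  refine ContDiff.div_const ?_ 2
  simp only [chartCoord, Matrix.vecMul, dotProduct]
  fun_prop

lemma contDiffOn_orbitPath {F : ℝ → P.ToricVariety → ℝ} (hF : P.IsSmoothPath F) :
    ContDiffOn ℝ ∞ (P.orbitPath F) (timeSlab (Fin m → ℝ)) := by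
  obtain ⟨I⟩ := (inferInstance : Nonempty P.Vertex)
  have h1 : ContDiff ℝ ∞ fun q : ℝ × (Fin m → ℝ) =>
      Real.log (∑ α : P.LatticePoint, Real.exp (∑ i, (α.1 i : ℝ) * q.2 i)) := by
    refine ContDiff.log (by fun_prop) fun q => ?_
    exact (Finset.sum_pos (fun α _ => Real.exp_pos _) Finset.univ_nonempty).ne'
  have h2 : ContDiffOn ℝ ∞ (fun q : ℝ × (Fin m → ℝ) => F q.1 (P.orbitPoint q.2))
      (timeSlab (Fin m → ℝ)) := by
    have h3 := (hF I).comp (t := Icc 0 1 ×ˢ univ) (s := timeSlab (Fin m → ℝ))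
      (f := fun q : ℝ × (Fin m → ℝ) => (q.1, fun r : I.1 =>
        Complex.exp ((P.chartCoord I q.2 r / 2 : ℝ) : ℂ)))
      (contDiff_fst.prodMk ((P.contDiff_chartPoint I).comp contDiff_snd)).contDiffOn
      (fun q hq => ⟨hq.1, mem_univ _⟩)
    refine h3.congr fun q _ => ?_
    rw [P.orbitPoint_eq_chart I]
    rfl
  exact h1.contDiffOn.add h2

section Path

variable {P}
variable {F : ℝ → P.ToricVariety → ℝ}

/-- The Hessian of the open-orbit potential in the logarithmic coordinates of a chart. -/
def chartHess (F : ℝ → P.ToricVariety → ℝ) (I : P.Vertex) (q : ℝ × (Fin m → ℝ)) :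
    Matrix I.1 I.1 ℝ :=
  P.normalMatrix I * slabHess (P.orbitPath F) q * (P.normalMatrix I).transpose

lemma chartHess_apply (hF : P.IsSmoothPath F) (I : P.Vertex) {q : ℝ × (Fin m → ℝ)}
    (hq : q ∈ timeSlab (Fin m → ℝ)) (j k : I.1) :
    slabDeriv (0, P.orbitCoord I (Pi.single j 1))
      (slabDeriv (0, P.orbitCoord I (Pi.single k 1)) (P.orbitPath F)) q =
      P.chartHess F I q j k := by
  rw [slabDeriv_space_space (P.contDiffOn_orbitPath hF) hq, orbitCoord_single, orbitCoord_single,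
    chartHess, Matrix.mul_assoc]
  rfl

lemma IsToricPath.metricMatrix_eq (hF : P.IsToricPath F) {t : ℝ} (ht : t ∈ Icc (0 : ℝ) 1)
    (I : P.Vertex) {η : I.1 → ℂ} (hη : ∀ r, η r ≠ 0) :
    P.metricMatrix (F t) I η = Matrix.diagonal (fun j => (η j)⁻¹) *
      (P.chartHess F I (t, P.orbitCoord I (logCoord η))).map Complex.ofReal *
      Matrix.diagonal fun k => (starRingEnd ℂ (η k))⁻¹ := by
  have hΦ := P.contDiffOn_orbitPath hF.smooth
  set l : (I.1 → ℝ) →L[ℝ] ℝ :=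
    ∑ r : I.1, (P.offset r : ℝ) • ContinuousLinearMap.proj (R := ℝ) (φ := fun _ => ℝ) r with hl
  have hlapp : ∀ y, l y = ∑ r : I.1, (P.offset r : ℝ) * y r := fun y => by simp [hl]
  refine complexHessian_logCoord hη
    (K := fun y => P.orbitPath F (t, P.orbitCoordCLM I y) - l y)
    (K₁ := fun k y => slabDeriv (0, P.orbitCoord I (Pi.single k 1)) (P.orbitPath F)
      (t, P.orbitCoordCLM I y) - l (Pi.single k 1)) ?_ ?_ ?_
  · filter_upwards [eventually_forall_ne_zero hη] with w hw
    rw [P.localPotential_eq (hF.invariant t ht) I hw, hlapp]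
    rfl
  · refine Filter.Eventually.of_forall fun y => ⟨_, ((hasFDerivAt_slice hΦ ht _).comp y
      (P.orbitCoordCLM I).hasFDerivAt).sub l.hasFDerivAt, fun k => ?_⟩
    simp [slabDeriv, orbitCoordCLM_apply]
  · refine fun k => ⟨_, ((hasFDerivAt_slice (contDiffOn_slabDeriv hΦ _) ht _).comp _
      (P.orbitCoordCLM I).hasFDerivAt).sub_const _, fun j => ?_⟩
    have := chartHess_apply hF.smooth I (mem_timeSlab.2 ht :
      (t, P.orbitCoord I (logCoord η)) ∈ timeSlab (Fin m → ℝ)) j k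
    rw [← this]
    simp [slabDeriv, orbitCoordCLM_apply]

lemma logCoord_exp {ι : Type*} (y : ι → ℝ) :
    logCoord (fun r => Complex.exp ((y r / 2 : ℝ) : ℂ)) = y := by
  funext r
  simp only [logCoord]
  rw [Complex.norm_exp_ofReal, Real.log_exp]
  ring

/-- The Hessian at `ρ` is positive definite because it is congruent to the chart metric at the point
`e^(ρ/2)`. -/
lemma IsToricPath.posDef_slabHess (hF : P.IsToricPath F) {t : ℝ} (ht : t ∈ Icc (0 : ℝ) 1)
    (ρ : Fin m → ℝ) : (slabHess (P.orbitPath F) (t, ρ)).PosDef := by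
  have hΦ := P.contDiffOn_orbitPath hF.smooth
  have hq : (t, ρ) ∈ timeSlab (Fin m → ℝ) := mem_timeSlab.2 ht
  obtain ⟨I⟩ := (inferInstance : Nonempty P.Vertex)
  refine Matrix.PosDef.of_dotProduct_mulVec_pos ?_ fun e he => ?_
  · ext j k
    simp only [slabHess, Matrix.conjTranspose_apply, Matrix.of_apply, star_trivial]
    exact slabDeriv_comm hΦ _ _ hq
  set η : I.1 → ℂ := fun r => Complex.exp ((P.chartCoord I ρ r / 2 : ℝ) : ℂ) with hη
  have hη0 : ∀ r, η r ≠ 0 := fun r => Complex.exp_ne_zero _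
  have hM := hF.metricMatrix_eq ht I hη0
  rw [hη, logCoord_exp, orbitCoord_chartCoord, ← hη] at hM
  have hpos := hF.posDef t ht I η
  rw [hM] at hpos
  set y := P.chartCoord I e with hy
  have hye : P.orbitCoord I y = e := orbitCoord_chartCoord P I e
  set v : I.1 → ℂ := fun k => starRingEnd ℂ (η k) * y k with hv
  have hv0 : v ≠ 0 := by
    intro h0
    refine he ?_
    have hy0 : y = 0 := by
      funext k
      have h1 := congrFun h0 k
      simp only [hv, Pi.zero_apply, mul_eq_zero, map_eq_zero, hη0 k, false_or] at h1
      exact_mod_cast h1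
    rw [← hye, hy0, orbitCoord, Matrix.zero_vecMul]
  have h1 := hpos.dotProduct_mulVec_pos hv0
  have h2 : (Matrix.diagonal fun k => (starRingEnd ℂ (η k))⁻¹).mulVec v =
      fun k => ((y k : ℝ) : ℂ) := by
    funext k
    rw [Matrix.mulVec_diagonal, hv,
      inv_mul_cancel_left₀ ((map_ne_zero _).2 (hη0 k))]
  have h3 : ∀ w : I.1 → ℂ, star v ⬝ᵥ (Matrix.diagonal fun k => (η k)⁻¹).mulVec w =
      (fun k => ((y k : ℝ) : ℂ)) ⬝ᵥ w := by
    intro w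
    refine Finset.sum_congr rfl fun k _ => ?_
    rw [Matrix.mulVec_diagonal]
    simp only [hv, Pi.star_apply, RCLike.star_def, map_mul, Complex.conj_conj,
      Complex.conj_ofReal]
    field_simp [hη0 k]
  rw [← Matrix.mulVec_mulVec, h2, ← Matrix.mulVec_mulVec, h3] at h1
  have h4 : (fun k => ((y k : ℝ) : ℂ)) ⬝ᵥ
      ((P.chartHess F I (t, ρ)).map Complex.ofReal).mulVec (fun k => ((y k : ℝ) : ℂ)) =
      ((y ⬝ᵥ (P.chartHess F I (t, ρ)).mulVec y : ℝ) : ℂ) := by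
    simp [dotProduct, Matrix.mulVec]
  rw [h4, Complex.zero_lt_real, chartHess, ← Matrix.mulVec_mulVec, Matrix.mulVec_transpose,
    ← Matrix.mulVec_mulVec, Matrix.dotProduct_mulVec] at h1
  change 0 < P.orbitCoord I y ⬝ᵥ (slabHess (P.orbitPath F) (t, ρ)).mulVec (P.orbitCoord I y) at h1
  rw [hye] at h1
  simpa using h1

/-- Up to a bounded function, the open-orbit potential is the maximum of `⟨α, ρ⟩` over the lattice
points `α` of the polytope, which is its support function since the vertices are lattice points. -/
lemma IsToricPath.isConvexPath (hF : P.IsToricPath F) :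
    IsConvexPath P.carrier (P.orbitPath F) := by
  obtain ⟨C, hC⟩ := P.exists_bound_orbitPoint fun I => (hF.smooth I).continuousOn
  refine ⟨P.isClosed_carrier, P.convex_carrier, P.contDiffOn_orbitPath hF.smooth,
    fun t ht ρ => hF.posDef_slabHess ht ρ, ⟨C, fun t ht ρ x hx => ?_⟩,
    ⟨C + Real.log (Fintype.card P.LatticePoint), fun t ht ρ => ?_⟩⟩
  · obtain ⟨-, α, hα, -⟩ := P.exists_maximizing_vertex ρ
    have h1 : (fun i => (α.1 i : ℝ)) ⬝ᵥ ρ ≤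
        Real.log (∑ α : P.LatticePoint, Real.exp (∑ i, (α.1 i : ℝ) * ρ i)) := by
      rw [Real.le_log_iff_exp_le (Finset.sum_pos (fun α _ => Real.exp_pos _) Finset.univ_nonempty)]
      exact Finset.single_le_sum
        (f := fun α : P.LatticePoint => Real.exp (∑ i, (α.1 i : ℝ) * ρ i))
        (fun α _ => (Real.exp_pos _).le) (Finset.mem_univ α)
    have h2 := (abs_le.1 (hC t ht ρ)).1
    have h3 := hα x hx
    rw [orbitPath, orbitPotential_eq]
    simp only
    linarith
  · obtain ⟨-, α, hα, -⟩ := P.exists_maximizing_vertex ρ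
    refine ⟨_, α.2, ?_⟩
    have h1 : Real.log (∑ α : P.LatticePoint, Real.exp (∑ i, (α.1 i : ℝ) * ρ i)) ≤
        Real.log (Fintype.card P.LatticePoint) + (fun i => (α.1 i : ℝ)) ⬝ᵥ ρ := by
      rw [Real.log_le_iff_le_exp (Finset.sum_pos (fun α _ => Real.exp_pos _)
        Finset.univ_nonempty), Real.exp_add, Real.exp_log (by exact_mod_cast Fintype.card_pos)]
      refine (Finset.sum_le_card_nsmul Finset.univ _ _ fun β _ =>
        Real.exp_le_exp.2 (hα _ β.2)).trans ?_
      rw [nsmul_eq_mul, Finset.card_univ]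
    have h2 := (abs_le.1 (hC t ht ρ)).2
    rw [orbitPath, orbitPotential_eq]
    simp only
    linarith

lemma velocity_orbitPath (t : ℝ) (ρ : Fin m → ℝ) :
    velocity (fun s y => P.orbitPath F (s, y)) t ρ = velocity F t (P.orbitPoint ρ) := by
  simp only [velocity, orbitPath, orbitPotential_eq]
  exact derivWithin_const_add _

lemma IsToricPath.velocity_chart (hF : P.IsToricPath F) {t : ℝ} (ht : t ∈ Icc (0 : ℝ) 1)
    (I : P.Vertex) {η : I.1 → ℂ} (hη : ∀ r, η r ≠ 0) :
    velocity F t (P.chart I η) =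
      slabDeriv (1, 0) (P.orbitPath F) (t, P.orbitCoord I (logCoord η)) := by
  rw [← velocity_eq_slabDeriv (P.contDiffOn_orbitPath hF.smooth) ht, velocity_orbitPath]
  exact velocity_congr ht fun s hs => (hF.invariant s hs).chart_eq I hη

lemma IsToricPath.acceleration_chart (hF : P.IsToricPath F) {t : ℝ} (ht : t ∈ Icc (0 : ℝ) 1)
    (I : P.Vertex) {η : I.1 → ℂ} (hη : ∀ r, η r ≠ 0) :
    acceleration F t (P.chart I η) = slabDeriv (1, 0) (slabDeriv (1, 0) (P.orbitPath F))
      (t, P.orbitCoord I (logCoord η)) := by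
  rw [acceleration_eq_velocity_velocity, ← velocity_eq_slabDeriv
    (contDiffOn_slabDeriv (P.contDiffOn_orbitPath hF.smooth) _) ht]
  exact velocity_congr ht fun s hs => hF.velocity_chart hs I hη

/-- The inverse of the Hessian in the logarithmic coordinates of a chart. -/
lemma IsToricPath.chartHess_mul (hF : P.IsToricPath F) {t : ℝ} (ht : t ∈ Icc (0 : ℝ) 1)
    (I : P.Vertex) (ρ : Fin m → ℝ) :
    P.chartHess F I (t, ρ) * ((P.edgeMatrix I).transpose * (slabHess (P.orbitPath F) (t, ρ))⁻¹ *
      P.edgeMatrix I) = 1 := by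
  have h1 : (P.normalMatrix I).transpose * (P.edgeMatrix I).transpose = 1 := by
    rw [← Matrix.transpose_mul, edgeMatrix_mul_normalMatrix, Matrix.transpose_one]
  have h2 := Matrix.mul_nonsing_inv _ (hF.isConvexPath.isUnit_det_hess ht ρ)
  rw [chartHess]
  simp only [Matrix.mul_assoc]
  rw [← Matrix.mul_assoc (P.normalMatrix I).transpose, h1, Matrix.one_mul,
    ← Matrix.mul_assoc (slabHess _ _), h2, Matrix.one_mul, normalMatrix_mul_edgeMatrix]

/-- The quadratic form of the inverse Hessian does not depend on the linear coordinates. -/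
lemma IsToricPath.dotProduct_chartHess_inv (hF : P.IsToricPath F) {t : ℝ}
    (ht : t ∈ Icc (0 : ℝ) 1) (I : P.Vertex) (ρ g : Fin m → ℝ) :
    (P.normalMatrix I).mulVec g ⬝ᵥ (P.chartHess F I (t, ρ))⁻¹.mulVec ((P.normalMatrix I).mulVec g) =
      g ⬝ᵥ (slabHess (P.orbitPath F) (t, ρ))⁻¹.mulVec g := by
  rw [Matrix.inv_eq_right_inv (hF.chartHess_mul ht I ρ), Matrix.mulVec_mulVec, Matrix.mul_assoc,
    Matrix.mul_assoc, edgeMatrix_mul_normalMatrix, Matrix.mul_one, ← Matrix.mulVec_mulVec,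
    Matrix.mulVec_transpose, dotProduct_comm, ← Matrix.dotProduct_mulVec, Matrix.mulVec_mulVec,
    edgeMatrix_mul_normalMatrix, Matrix.one_mulVec, dotProduct_comm]

lemma IsToricPath.halfGradSq_eq (hF : P.IsToricPath F) {t : ℝ} (ht : t ∈ Icc (0 : ℝ) 1)
    (I : P.Vertex) {η : I.1 → ℂ} (hη : ∀ r, η r ≠ 0) :
    P.halfGradSq (F t) (velocity F t) I η =
      ((slabGrad (slabDeriv (1, 0) (P.orbitPath F)) (t, P.orbitCoord I (logCoord η)) ⬝ᵥ
        (slabHess (P.orbitPath F) (t, P.orbitCoord I (logCoord η)))⁻¹.mulVec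
          (slabGrad (slabDeriv (1, 0) (P.orbitPath F)) (t, P.orbitCoord I (logCoord η))) : ℝ) :
        ℂ) := by
  have hΦ := P.contDiffOn_orbitPath hF.smooth
  set ρ := P.orbitCoord I (logCoord η) with hρ
  set a := (P.normalMatrix I).mulVec (slabGrad (slabDeriv (1, 0) (P.orbitPath F)) (t, ρ)) with ha
  have hev : (fun ξ => (velocity F t (P.chart I ξ) : ℂ)) =ᶠ[nhds η] fun ξ =>
      (slabDeriv (1, 0) (P.orbitPath F) (t, P.orbitCoordCLM I (logCoord ξ)) : ℂ) := by
    filter_upwards [eventually_forall_ne_zero hη] with ξ hξ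
    rw [hF.velocity_chart ht I hξ]
    rfl
  have hG := (hasFDerivAt_slice (contDiffOn_slabDeriv hΦ (1, 0)) ht
    (P.orbitCoordCLM I (logCoord η))).comp (logCoord η) (P.orbitCoordCLM I).hasFDerivAt
  have hGa : ∀ j, ((fderivWithin ℝ (slabDeriv (1, 0) (P.orbitPath F)) (timeSlab (Fin m → ℝ))
      (t, P.orbitCoordCLM I (logCoord η))).comp (ContinuousLinearMap.inr ℝ ℝ _)).comp
        (P.orbitCoordCLM I) (Pi.single j 1) = a j := by
    intro j
    have h1 := slabDeriv_space (slabDeriv (1, 0) (P.orbitPath F))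
      (P.orbitCoord I (Pi.single j 1)) (t, ρ)
    rw [orbitCoord_single, dotProduct_comm] at h1
    rw [ha]
    refine Eq.trans ?_ h1
    rw [← orbitCoord_single]
    simp [slabDeriv, orbitCoordCLM_apply, hρ]
  have hw : wirtinger (fun ξ => (velocity F t (P.chart I ξ) : ℂ)) η =
      (Matrix.diagonal fun j => (η j)⁻¹).mulVec fun j => ((a j : ℝ) : ℂ) := by
    rw [wirtinger_congr hev]
    funext j
    have := wirtinger_logCoord hη hG j
    rw [hGa] at this
    rw [Matrix.mulVec_diagonal, mul_comm, ← this]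
    rfl
  have hwb : wirtingerBar (fun ξ => (velocity F t (P.chart I ξ) : ℂ)) η =
      Matrix.vecMul (fun j => ((a j : ℝ) : ℂ))
        (Matrix.diagonal fun j => (starRingEnd ℂ (η j))⁻¹) := by
    rw [wirtingerBar_congr hev]
    funext j
    have := wirtingerBar_logCoord hη hG j
    rw [hGa] at this
    rw [Matrix.vecMul_diagonal, ← this]
    rfl
  have hA := hF.chartHess_mul ht I ρ
  have hAinv := Matrix.inv_eq_right_inv hA
  rw [← hAinv] at hA
  have hAc : (P.chartHess F I (t, ρ)).map Complex.ofReal *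
      (P.chartHess F I (t, ρ))⁻¹.map Complex.ofReal = 1 := by
    have := congrArg (fun A : Matrix I.1 I.1 ℝ => A.map Complex.ofRealHom) hA
    simp only [Matrix.map_mul] at this
    exact this.trans (by simp)
  have hD1 : (Matrix.diagonal fun k => (starRingEnd ℂ (η k))⁻¹) *
      Matrix.diagonal (fun k => starRingEnd ℂ (η k)) = 1 := by
    rw [Matrix.diagonal_mul_diagonal, ← Matrix.diagonal_one]
    congr 1
    funext k
    exact inv_mul_cancel₀ ((map_ne_zero _).2 (hη k))
  have hD2 : (Matrix.diagonal fun k => (η k)⁻¹) * Matrix.diagonal (fun k => η k) = 1 := by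
    rw [Matrix.diagonal_mul_diagonal, ← Matrix.diagonal_one]
    congr 1
    funext k
    exact inv_mul_cancel₀ (hη k)
  have hinv : (P.metricMatrix (F t) I η)⁻¹ = Matrix.diagonal (fun k => starRingEnd ℂ (η k)) *
      ((P.chartHess F I (t, ρ))⁻¹.map Complex.ofReal * Matrix.diagonal (fun k => η k)) := by
    refine Matrix.inv_eq_right_inv ?_
    rw [hF.metricMatrix_eq ht I hη]
    simp only [Matrix.mul_assoc]
    rw [← Matrix.mul_assoc (Matrix.diagonal fun k => (starRingEnd ℂ (η k))⁻¹), hD1,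
      Matrix.one_mul, ← Matrix.mul_assoc (Matrix.map _ _), hAc, Matrix.one_mul, hD2]
  have hD3 : Matrix.diagonal (fun k => η k) * (Matrix.diagonal fun k => (η k)⁻¹) = 1 :=
    mul_eq_one_comm.1 hD2
  rw [halfGradSq, hw, hwb, hinv, ← hF.dotProduct_chartHess_inv ht I, ← Matrix.dotProduct_mulVec,
    Matrix.mulVec_mulVec, Matrix.mulVec_mulVec, ← Matrix.mul_assoc, ← Matrix.mul_assoc, hD1,
    Matrix.one_mul, Matrix.mul_assoc, hD3, Matrix.mul_one, ← ha]
  simp [dotProduct, Matrix.mulVec]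

/-- On the open orbit the geodesic equation is the vanishing of the geodesic defect. -/
lemma IsToricPath.geodesic_eq (hF : P.IsToricPath F) {t : ℝ} (ht : t ∈ Icc (0 : ℝ) 1)
    (I : P.Vertex) {η : I.1 → ℂ} (hη : ∀ r, η r ≠ 0) :
    (acceleration F t (P.chart I η) : ℂ) - P.halfGradSq (F t) (velocity F t) I η =
      (geodesicDefect (P.orbitPath F) (t, P.orbitCoord I (logCoord η)) : ℂ) := by
  rw [hF.acceleration_chart ht I hη, hF.halfGradSq_eq ht I hη, geodesicDefect]
  push_cast
  rfl

end Path

end DelzantPolytope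

/-! ### Smoothness of complex derivatives and density of the open orbit -/

section WirtingerSmooth

variable {ι : Type*} [Fintype ι] [DecidableEq ι]

lemma ContDiffOn.wirtinger {f : (ι → ℂ) → ℂ} {U : Set (ι → ℂ)} (hU : IsOpen U)
    (hf : ContDiffOn ℝ ∞ f U) (j : ι) : ContDiffOn ℝ ∞ (fun z => wirtinger f z j) U := by
  have h1 := hf.fderiv_of_isOpen (m := ∞) hU (by simp)
  unfold _root_.wirtinger
  exact ((h1.clm_apply contDiffOn_const).sub
    (contDiffOn_const.mul (h1.clm_apply contDiffOn_const))).div_const 2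

lemma ContDiffOn.wirtingerBar {f : (ι → ℂ) → ℂ} {U : Set (ι → ℂ)} (hU : IsOpen U)
    (hf : ContDiffOn ℝ ∞ f U) (j : ι) : ContDiffOn ℝ ∞ (fun z => wirtingerBar f z j) U := by
  have h1 := hf.fderiv_of_isOpen (m := ∞) hU (by simp)
  unfold _root_.wirtingerBar
  exact ((h1.clm_apply contDiffOn_const).add
    (contDiffOn_const.mul (h1.clm_apply contDiffOn_const))).div_const 2

lemma ContDiffOn.continuousOn_complexHessian {f : (ι → ℂ) → ℝ} {U : Set (ι → ℂ)}
    (hU : IsOpen U) (hf : ContDiffOn ℝ ∞ f U) : ContinuousOn (complexHessian f) U :=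
  continuousOn_pi.2 fun j => continuousOn_pi.2 fun k =>
    (((Complex.ofRealCLM.contDiff.comp_contDiffOn hf).wirtingerBar hU k).wirtinger hU
      j).continuousOn

lemma dense_forall_ne_zero {ι : Type*} : Dense {z : ι → ℂ | ∀ j, z j ≠ 0} := by
  have h := dense_pi (univ : Set ι) (s := fun _ => ({0}ᶜ : Set ℂ))
    fun _ _ => dense_compl_singleton 0
  exact h.mono fun (z : ι → ℂ) hz j => (mem_univ_pi.1 hz) j

end WirtingerSmooth

namespace DelzantPolytope

variable {m : ℕ} {P : DelzantPolytope m} {F : ℝ → P.ToricVariety → ℝ}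

lemma contDiff_log_sum_chartVec (I : P.Vertex) :
    ContDiff ℝ ∞ fun η : I.1 → ℂ => Real.log (∑ α, ‖P.chartVec I η α‖ ^ 2) := by
  refine ContDiff.log (ContDiff.sum fun α _ => ContDiff.norm_sq ℝ ?_) fun η => ?_
  · unfold chartVec
    fun_prop
  · obtain ⟨α, hα⟩ := Function.ne_iff.1 (P.chartVec_ne_zero I η)
    refine (Finset.sum_pos' (fun β _ => by positivity) ⟨α, Finset.mem_univ α, ?_⟩).ne'
    exact pow_pos (norm_pos_iff.2 hα) 2

lemma IsToricPath.contDiff_localPotential (hF : P.IsToricPath F) {t : ℝ}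
    (ht : t ∈ Icc (0 : ℝ) 1) (I : P.Vertex) : ContDiff ℝ ∞ (P.localPotential (F t) I) :=
  (contDiff_log_sum_chartVec I).add (contDiff_slice (hF.smooth I) ht)

lemma IsToricPath.continuous_metricMatrix (hF : P.IsToricPath F) {t : ℝ}
    (ht : t ∈ Icc (0 : ℝ) 1) (I : P.Vertex) : Continuous (P.metricMatrix (F t) I) :=
  continuousOn_univ.1
    ((hF.contDiff_localPotential ht I).contDiffOn.continuousOn_complexHessian isOpen_univ)

lemma IsToricPath.contDiff_velocity_chart (hF : P.IsToricPath F) {t : ℝ}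
    (ht : t ∈ Icc (0 : ℝ) 1) (I : P.Vertex) :
    ContDiff ℝ ∞ fun η => velocity F t (P.chart I η) := by
  have h : (fun η => velocity F t (P.chart I η)) = fun η =>
      slabDeriv (1, 0) (fun q : ℝ × (I.1 → ℂ) => F q.1 (P.chart I q.2)) (t, η) :=
    funext fun η => velocity_eq_slabDeriv (hF.smooth I) ht η
  rw [h]
  exact contDiff_slice (contDiffOn_slabDeriv (hF.smooth I) (1, 0)) ht

lemma IsToricPath.continuous_acceleration_chart (hF : P.IsToricPath F) {t : ℝ}
    (ht : t ∈ Icc (0 : ℝ) 1) (I : P.Vertex) :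
    Continuous fun η => acceleration F t (P.chart I η) :=
  (contDiff_slice (contDiffOn_slabDeriv (contDiffOn_slabDeriv (hF.smooth I) (1, 0)) (1, 0))
    ht).continuous.congr fun η => (acceleration_eq_slabDeriv (hF.smooth I) ht η).symm

lemma IsToricPath.continuous_halfGradSq (hF : P.IsToricPath F) {t : ℝ}
    (ht : t ∈ Icc (0 : ℝ) 1) (I : P.Vertex) :
    Continuous (P.halfGradSq (F t) (velocity F t) I) := by
  have hv := (Complex.ofRealCLM.contDiff.comp (hF.contDiff_velocity_chart ht I)).contDiffOn
    (s := univ)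
  have h1 : Continuous (wirtinger fun ξ => (velocity F t (P.chart I ξ) : ℂ)) :=
    continuous_pi fun j => continuousOn_univ.1 (hv.wirtinger isOpen_univ j).continuousOn
  have h2 : Continuous (wirtingerBar fun ξ => (velocity F t (P.chart I ξ) : ℂ)) :=
    continuous_pi fun j => continuousOn_univ.1 (hv.wirtingerBar isOpen_univ j).continuousOn
  have h3 : Continuous fun η => (P.metricMatrix (F t) I η)⁻¹ := by
    refine continuous_iff_continuousAt.2 fun η => ?_
    refine ContinuousAt.comp (g := fun A => A⁻¹) (continuousAt_matrix_inv _ ?_)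
      (hF.continuous_metricMatrix ht I).continuousAt
    rw [Ring.inverse_eq_inv']
    exact continuousAt_inv₀ (hF.posDef t ht I η).det_pos.ne'
  exact h2.dotProduct (h3.matrix_mulVec h1)

lemma exists_logCoord_eq (I : P.Vertex) (ρ : Fin m → ℝ) :
    ∃ η : I.1 → ℂ, (∀ r, η r ≠ 0) ∧ P.orbitCoord I (logCoord η) = ρ :=
  ⟨_, fun _ => Complex.exp_ne_zero _, by rw [logCoord_exp (P.chartCoord I ρ),
    orbitCoord_chartCoord]⟩

lemma IsToricPath.geodesic_iff (hF : P.IsToricPath F) {t : ℝ} (ht : t ∈ Icc (0 : ℝ) 1) :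
    (∀ (I : P.Vertex) (η : I.1 → ℂ),
      (acceleration F t (P.chart I η) : ℂ) - P.halfGradSq (F t) (velocity F t) I η = 0) ↔
      ∀ ρ, geodesicDefect (P.orbitPath F) (t, ρ) = 0 := by
  constructor
  · intro h ρ
    obtain ⟨I⟩ := (inferInstance : Nonempty P.Vertex)
    obtain ⟨η, hη, hρ⟩ := exists_logCoord_eq I ρ
    have h1 := h I η
    rw [hF.geodesic_eq ht I hη, hρ] at h1
    exact_mod_cast h1
  · intro h I
    have hc : Continuous fun η => (acceleration F t (P.chart I η) : ℂ) -
        P.halfGradSq (F t) (velocity F t) I η :=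
      (Complex.continuous_ofReal.comp (hF.continuous_acceleration_chart ht I)).sub
        (hF.continuous_halfGradSq ht I)
    refine congrFun (Continuous.ext_on dense_forall_ne_zero hc continuous_const fun η hη => ?_)
    simp only [hF.geodesic_eq ht I hη, h, Complex.ofReal_zero]

/-! ### The Monge–Ampère equation -/

/-- The domain `{1 < |s| < e}` of the complexified path in a chart, the coordinate `s` having
index `none`. -/
def annulusChart (ι : Type*) : Set (Option ι → ℂ) :=
  {q | 1 < ‖q none‖ ∧ ‖q none‖ < Real.exp 1}

lemma isOpen_annulusChart (ι : Type*) : IsOpen (annulusChart ι) :=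
  (isOpen_lt continuous_const (continuous_apply _).norm).inter
    (isOpen_lt (continuous_apply _).norm continuous_const)

lemma log_norm_mem_Ioo {ι : Type*} {q : Option ι → ℂ} (hq : q ∈ annulusChart ι) :
    Real.log ‖q none‖ ∈ Ioo (0 : ℝ) 1 :=
  ⟨Real.log_pos hq.1, by
    rw [Real.log_lt_iff_lt_exp (zero_lt_one.trans hq.1)]
    exact hq.2⟩

/-- The local potential of `π^*ω₀ + dd^c Φ` in a chart. -/
def complexifiedPotential (F : ℝ → P.ToricVariety → ℝ) (I : P.Vertex) (y : Option I.1 → ℂ) : ℝ :=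
  P.localPotential (F (Real.log ‖y none‖)) I (fun r => y (some r))

lemma IsToricPath.contDiffOn_complexifiedPotential (hF : P.IsToricPath F) (I : P.Vertex) :
    ContDiffOn ℝ ∞ (P.complexifiedPotential F I) (annulusChart I.1) := by
  have h0 : ContDiff ℝ ∞ fun (y : Option I.1 → ℂ) (r : I.1) => y (some r) := by fun_prop
  have h1 : ContDiffOn ℝ ∞ (fun y : Option I.1 → ℂ => Real.log ‖y none‖) (annulusChart I.1) := by
    intro y hy
    have hpos := zero_lt_one.trans hy.1
    have h2 : ContDiffAt ℝ ∞ (fun y : Option I.1 → ℂ => ‖y none‖) y :=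
      ContDiffAt.norm ℝ (by fun_prop) (norm_pos_iff.1 hpos)
    exact (h2.log hpos.ne').contDiffWithinAt
  have h3 := (hF.smooth I).comp (h1.prodMk h0.contDiffOn) fun y hy =>
    ⟨Ioo_subset_Icc_self (log_norm_mem_Ioo hy), mem_univ _⟩
  exact ((contDiff_log_sum_chartVec I).comp h0).contDiffOn.add h3

/-- The passage `y ↦ (y_s / 2, ρ)` from the logarithmic coordinates on `A × (ℂ*)ᵐ` to the time
slab; the factor `1/2` is there because `t = log |s|` and `y_s = log |s|²`. -/
def slabCoord (I : P.Vertex) : (Option I.1 → ℝ) →L[ℝ] ℝ × (Fin m → ℝ) :=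
  ((1 / 2 : ℝ) • ContinuousLinearMap.proj (R := ℝ) (φ := fun _ => ℝ) none).prod
    ((P.orbitCoordCLM I).comp (ContinuousLinearMap.pi fun r =>
      ContinuousLinearMap.proj (R := ℝ) (φ := fun _ => ℝ) (some r)))

lemma slabCoord_apply (I : P.Vertex) (y : Option I.1 → ℝ) :
    slabCoord I y = (1 / 2 * y none, P.orbitCoord I fun r => y (some r)) := rfl

lemma slabCoord_single_none (I : P.Vertex) :
    slabCoord I (Pi.single none 1) = (1 / 2 : ℝ) • ((1 : ℝ), (0 : Fin m → ℝ)) := by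
  rw [slabCoord_apply]
  have : (fun r : I.1 => (Pi.single none 1 : Option I.1 → ℝ) (some r)) = 0 := by
    funext r
    simp
  rw [this, orbitCoord, Matrix.zero_vecMul]
  simp

lemma slabCoord_single_some (I : P.Vertex) (k : I.1) :
    slabCoord I (Pi.single (some k) 1) = (0, P.orbitCoord I (Pi.single k 1)) := by
  rw [slabCoord_apply]
  have : (fun r : I.1 => (Pi.single (some k) 1 : Option I.1 → ℝ) (some r)) = Pi.single k 1 := by
    funext r
    simp [Pi.single_apply]
  rw [this]
  simp

/-- The full Hessian of the open-orbit potential in the logarithmic coordinates on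
`A × (ℂ*)ᵐ`. -/
def fullHess (F : ℝ → P.ToricVariety → ℝ) (I : P.Vertex) (q : ℝ × (Fin m → ℝ)) :
    Matrix (Option I.1) (Option I.1) ℝ :=
  Matrix.of fun j k => slabDeriv (slabCoord I (Pi.single j 1))
    (slabDeriv (slabCoord I (Pi.single k 1)) (P.orbitPath F)) q

lemma IsToricPath.complexHessian_complexifiedPotential (hF : P.IsToricPath F) (I : P.Vertex)
    {q : Option I.1 → ℂ} (hq : q ∈ annulusChart I.1) (hq0 : ∀ j, q j ≠ 0) :
    complexHessian (P.complexifiedPotential F I) q = Matrix.diagonal (fun j => (q j)⁻¹) *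
      (P.fullHess F I (slabCoord I (logCoord q))).map Complex.ofReal *
        Matrix.diagonal fun k => (starRingEnd ℂ (q k))⁻¹ := by
  have hΦ := P.contDiffOn_orbitPath hF.smooth
  set l : (Option I.1 → ℝ) →L[ℝ] ℝ := ∑ r : I.1,
    (P.offset r : ℝ) • ContinuousLinearMap.proj (R := ℝ) (φ := fun _ => ℝ) (some r) with hl
  have hlapp : ∀ y, l y = ∑ r : I.1, (P.offset r : ℝ) * y (some r) := fun y => by simp [hl]
  have hslab : ∀ᶠ y in nhds (logCoord q), timeSlab (Fin m → ℝ) ∈ nhds (slabCoord I y) := by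
    have h1 : (slabCoord I (logCoord q)).1 ∈ Ioo (0 : ℝ) 1 := by
      have : (slabCoord I (logCoord q)).1 = Real.log ‖q none‖ := by
        rw [slabCoord_apply, logCoord]
        ring
      rw [this]
      exact log_norm_mem_Ioo hq
    filter_upwards [((continuous_fst.comp (slabCoord I).continuous).continuousAt).preimage_mem_nhds
      (isOpen_Ioo.mem_nhds h1)] with y hy
    exact timeSlab_mem_nhds hy _
  have hder : ∀ {Ψ : ℝ × (Fin m → ℝ) → ℝ} (_ : ContDiffOn ℝ ∞ Ψ (timeSlab (Fin m → ℝ)))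
      {y : Option I.1 → ℝ} (_ : timeSlab (Fin m → ℝ) ∈ nhds (slabCoord I y)),
      HasFDerivAt (fun y => Ψ (slabCoord I y))
        ((fderivWithin ℝ Ψ (timeSlab _) (slabCoord I y)).comp (slabCoord I)) y :=
    fun hΨ y hy => ((hasFDerivWithinAt_timeSlab hΨ (mem_of_mem_nhds hy)).hasFDerivAt hy).comp y
      (slabCoord I).hasFDerivAt
  refine complexHessian_logCoord hq0
    (K := fun y => P.orbitPath F (slabCoord I y) - l y)
    (K₁ := fun k y => slabDeriv (slabCoord I (Pi.single k 1)) (P.orbitPath F) (slabCoord I y) -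
      l (Pi.single k 1)) ?_ ?_ ?_
  · filter_upwards [eventually_forall_ne_zero hq0, (isOpen_annulusChart I.1).mem_nhds hq]
      with w hw hwU
    have hw' : ∀ r : I.1, (fun r => w (some r)) r ≠ 0 := fun r => hw (some r)
    rw [complexifiedPotential, P.localPotential_eq
      (hF.invariant _ (Ioo_subset_Icc_self (log_norm_mem_Ioo hwU))) I hw', hlapp, orbitPath,
      slabCoord_apply]
    have h2 : 1 / 2 * logCoord w none = Real.log ‖w none‖ := by
      rw [logCoord]
      ring
    rw [h2]
    rfl
  · filter_upwards [hslab] with y hy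
    exact ⟨_, (hder hΦ hy).sub l.hasFDerivAt, fun k => rfl⟩
  · exact fun k => ⟨_, (hder (contDiffOn_slabDeriv hΦ _) hslab.self_of_nhds).sub_const _,
      fun j => rfl⟩

lemma slabDeriv_smul {E : Type*} [NormedAddCommGroup E] [NormedSpace ℝ E] (c : ℝ) (v : ℝ × E)
    (Φ : ℝ × E → ℝ) : slabDeriv (c • v) Φ = fun q => c * slabDeriv v Φ q := by
  funext q
  rw [slabDeriv, map_smul, smul_eq_mul, slabDeriv]

/-- The determinant of the full Hessian is, by the Schur complement formula, the geodesic defect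
times the determinant of the spatial Hessian, up to a constant. -/
lemma IsToricPath.det_fullHess (hF : P.IsToricPath F) (I : P.Vertex) {t : ℝ}
    (ht : t ∈ Icc (0 : ℝ) 1) (ρ : Fin m → ℝ) :
    (P.fullHess F I (t, ρ)).det =
      (P.chartHess F I (t, ρ)).det * (1 / 4 * geodesicDefect (P.orbitPath F) (t, ρ)) := by
  have hΦ := P.contDiffOn_orbitPath hF.smooth
  have hq : (t, ρ) ∈ timeSlab (Fin m → ℝ) := mem_timeSlab.2 ht
  set A := P.chartHess F I (t, ρ) with hA
  set g := slabGrad (slabDeriv (1, 0) (P.orbitPath F)) (t, ρ) with hg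
  set a := (P.normalMatrix I).mulVec g with ha
  have hmix : ∀ k : I.1, slabDeriv (0, P.orbitCoord I (Pi.single k 1))
      (slabDeriv (1, 0) (P.orbitPath F)) (t, ρ) = a k := by
    intro k
    rw [slabDeriv_space, orbitCoord_single, dotProduct_comm]
    rfl
  have hblock : (P.fullHess F I (t, ρ)).submatrix (Equiv.optionEquivSumPUnit.{0} I.1).symm
      (Equiv.optionEquivSumPUnit.{0} I.1).symm = Matrix.fromBlocks A
        (Matrix.of fun k _ => 1 / 2 * a k) (Matrix.of fun _ k => 1 / 2 * a k)
        (Matrix.of fun _ _ =>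
          1 / 4 * slabDeriv (1, 0) (slabDeriv (1, 0) (P.orbitPath F)) (t, ρ)) := by
    ext j k
    rcases j with j | j <;> rcases k with k | k
    · simp only [Matrix.submatrix_apply, Equiv.optionEquivSumPUnit_symm_inl, fullHess,
        Matrix.of_apply, Matrix.fromBlocks_apply₁₁, slabCoord_single_some]
      exact chartHess_apply hF.smooth I hq j k
    · simp only [Matrix.submatrix_apply, Equiv.optionEquivSumPUnit_symm_inl,
        Equiv.optionEquivSumPUnit_symm_inr, fullHess, Matrix.of_apply,
        Matrix.fromBlocks_apply₁₂, slabCoord_single_some, slabCoord_single_none]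
      rw [slabDeriv_comm hΦ _ _ hq, slabDeriv_smul]
      simp only
      rw [slabDeriv_comm hΦ _ _ hq, hmix]
    · simp only [Matrix.submatrix_apply, Equiv.optionEquivSumPUnit_symm_inl,
        Equiv.optionEquivSumPUnit_symm_inr, fullHess, Matrix.of_apply,
        Matrix.fromBlocks_apply₂₁, slabCoord_single_some, slabCoord_single_none]
      rw [slabDeriv_smul]
      simp only
      rw [slabDeriv_comm hΦ _ _ hq, hmix]
    · simp only [Matrix.submatrix_apply, Equiv.optionEquivSumPUnit_symm_inr, fullHess,
        Matrix.of_apply, Matrix.fromBlocks_apply₂₂, slabCoord_single_none]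
      rw [slabDeriv_smul]
      simp only
      rw [slabDeriv_comm hΦ _ _ hq, slabDeriv_smul]
      simp only
      ring
  have hAinv := hF.chartHess_mul ht I ρ
  have : Invertible A := A.invertibleOfIsUnitDet (Matrix.isUnit_det_of_right_inverse hAinv)
  rw [← Matrix.det_submatrix_equiv_self (Equiv.optionEquivSumPUnit.{0} I.1).symm, hblock,
    Matrix.det_fromBlocks₁₁]
  congr 1
  rw [Matrix.det_unique, geodesicDefect, ← hF.dotProduct_chartHess_inv ht I, ← hg, ← ha, ← hA,
    Matrix.invOf_eq_nonsing_inv, Matrix.mul_assoc]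
  simp only [Matrix.sub_apply, Matrix.of_apply, Matrix.mul_apply, dotProduct, Matrix.mulVec,
    mul_sub, Finset.mul_sum]
  congr 1
  refine Finset.sum_congr rfl fun j _ => Finset.sum_congr rfl fun k _ => ?_
  ring

lemma IsToricPath.det_complexHessian_eq_zero_iff (hF : P.IsToricPath F) (I : P.Vertex)
    {q : Option I.1 → ℂ} (hq : q ∈ annulusChart I.1) (hq0 : ∀ j, q j ≠ 0) :
    (complexHessian (P.complexifiedPotential F I) q).det = 0 ↔
      geodesicDefect (P.orbitPath F)
        (Real.log ‖q none‖, P.orbitCoord I (logCoord fun r => q (some r))) = 0 := by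
  have ht := Ioo_subset_Icc_self (log_norm_mem_Ioo hq)
  have h1 : slabCoord I (logCoord q) =
      (Real.log ‖q none‖, P.orbitCoord I (logCoord fun r => q (some r))) := by
    rw [slabCoord_apply, logCoord]
    refine Prod.ext ?_ rfl
    simp only
    ring
  have h2 : ((P.fullHess F I (slabCoord I (logCoord q))).map Complex.ofReal).det =
      ((P.fullHess F I (slabCoord I (logCoord q))).det : ℂ) :=
    (Complex.ofRealHom.map_det _).symm
  have h3 : (P.chartHess F I (slabCoord I (logCoord q))).det ≠ 0 := by
    rw [h1]
    exact (Matrix.isUnit_det_of_right_inverse (hF.chartHess_mul ht I _)).ne_zero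
  rw [hF.complexHessian_complexifiedPotential I hq hq0, Matrix.det_mul, Matrix.det_mul,
    Matrix.det_diagonal, Matrix.det_diagonal, h2]
  rw [h1] at h3 ⊢
  rw [hF.det_fullHess I ht]
  simp [Finset.prod_eq_zero_iff, hq0, h3]

lemma IsToricPath.mongeAmpere_iff (hF : P.IsToricPath F) :
    (∀ (I : P.Vertex) (q : Option I.1 → ℂ), q ∈ annulusChart I.1 →
      (complexHessian (P.complexifiedPotential F I) q).det = 0) ↔
      ∀ t ∈ Icc (0 : ℝ) 1, ∀ ρ, geodesicDefect (P.orbitPath F) (t, ρ) = 0 := by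
  constructor
  · intro h t ht ρ
    have hIoo : ∀ s ∈ Ioo (0 : ℝ) 1, geodesicDefect (P.orbitPath F) (s, ρ) = 0 := by
      intro s hs
      obtain ⟨I⟩ := (inferInstance : Nonempty P.Vertex)
      obtain ⟨η, hη, hρ⟩ := exists_logCoord_eq I ρ
      set q : Option I.1 → ℂ := fun o => o.elim (Complex.exp s) η with hq
      have hn : ‖q none‖ = Real.exp s := Complex.norm_exp_ofReal s
      have hqU : q ∈ annulusChart I.1 := by
        refine ⟨?_, ?_⟩ <;> rw [hn]
        · exact Real.one_lt_exp_iff.2 hs.1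
        · exact Real.exp_lt_exp.2 hs.2
      have hq0 : ∀ j, q j ≠ 0 := by
        rintro (_ | r)
        · exact Complex.exp_ne_zero _
        · exact hη r
      have h1 := (hF.det_complexHessian_eq_zero_iff I hqU hq0).1 (h I q hqU)
      rw [hn, Real.log_exp] at h1
      rw [← hρ]
      exact h1
    have hc : ContinuousOn (fun s => geodesicDefect (P.orbitPath F) (s, ρ)) (Icc 0 1) :=
      (continuousOn_geodesicDefect hF.isConvexPath).comp
        (continuousOn_id.prodMk continuousOn_const) fun s hs => mem_timeSlab.2 hs
    have hcl : t ∈ closure (Ioo (0 : ℝ) 1) := by rwa [closure_Ioo zero_ne_one]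
    have := ((hc t ht).mono Ioo_subset_Icc_self).mem_closure hcl (t := {0}) hIoo
    simpa using this
  · intro h I q hq
    have hc : ContinuousOn (fun q => (complexHessian (P.complexifiedPotential F I) q).det)
        (annulusChart I.1) := (continuous_id.matrix_det).comp_continuousOn
      ((hF.contDiffOn_complexifiedPotential I).continuousOn_complexHessian
        (isOpen_annulusChart I.1))
    have hcl := dense_forall_ne_zero.open_subset_closure_inter (isOpen_annulusChart I.1) hq
    have := ((hc q hq).mono inter_subset_left).mem_closure hcl (t := {0}) fun w hw =>
      (hF.det_complexHessian_eq_zero_iff I hw.1 hw.2).2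
        (h _ (Ioo_subset_Icc_self (log_norm_mem_Ioo hw.1)) _)
    simpa using this

end DelzantPolytope

/-! ### Integration in logarithmic coordinates -/

section LogIntegral

variable {ι : Type*} [Fintype ι]

/-- The substitution `r_i = e^(y_i / 2)`. -/
lemma lintegral_pi_Ioi_eq (G : (ι → ℝ) → ENNReal) :
    ∫⁻ r in univ.pi fun _ : ι => Ioi (0 : ℝ), G r =
      ∫⁻ y : ι → ℝ, ENNReal.ofReal (∏ i, Real.exp (y i / 2) / 2) *
        G fun i => Real.exp (y i / 2) := by
  set f : (ι → ℝ) → ι → ℝ := fun y i => Real.exp (y i / 2) with hf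
  set f' : (ι → ℝ) → (ι → ℝ) →L[ℝ] (ι → ℝ) := fun y => ContinuousLinearMap.pi fun i =>
    ((Real.exp (y i / 2) / 2) • ContinuousLinearMap.id ℝ ℝ).comp
      (ContinuousLinearMap.proj (R := ℝ) (φ := fun _ : ι => ℝ) i) with hf'
  have himage : f '' univ = univ.pi fun _ : ι => Ioi (0 : ℝ) := by
    ext r
    constructor
    · rintro ⟨y, -, rfl⟩
      exact fun i _ => Real.exp_pos _
    · intro hr
      refine ⟨fun i => 2 * Real.log (r i), mem_univ _, funext fun i => ?_⟩
      simp only [hf]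
      rw [mul_div_cancel_left₀ _ two_ne_zero, Real.exp_log (hr i (mem_univ i))]
  have hder : ∀ y ∈ univ, HasFDerivWithinAt f (f' y) univ y := by
    refine fun y _ => (hasFDerivAt_pi.2 fun i => ?_).hasFDerivWithinAt
    have h1 : HasDerivAt (fun s : ℝ => Real.exp (s / 2)) (Real.exp (y i / 2) / 2) (y i) := by
      have := ((hasDerivAt_id (y i)).div_const 2).exp
      simpa [div_eq_mul_inv] using this
    refine (h1.hasFDerivAt.comp y (hasFDerivAt_apply (𝕜 := ℝ) i y)).congr_fderiv ?_
    ext v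
    simp [mul_comm]
  have hinj : InjOn f univ := by
    intro y _ z _ h
    funext i
    have := congrFun h i
    simp only [hf, Real.exp_eq_exp] at this
    linarith
  rw [← himage, lintegral_image_eq_lintegral_abs_det_fderiv_mul volume MeasurableSet.univ hder
    hinj, Measure.restrict_univ]
  refine lintegral_congr fun y => ?_
  have hdet : (f' y).det = ∏ i, Real.exp (y i / 2) / 2 := by
    simp only [hf']
    rw [ContinuousLinearMap.det_pi]
    refine Finset.prod_congr rfl fun i _ => ?_
    rw [ContinuousLinearMap.det, LinearMap.det_ring]
    simp
  rw [hdet, abs_of_nonneg (Finset.prod_nonneg fun i _ => by positivity)]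

/-- In the coordinates `y_j = log |η_j|²` the measure `∏ |η_j|⁻² dη` on `(ℂ*)ⁿ` becomes `πⁿ` times
Lebesgue measure, after integration over the angles. -/
lemma lintegral_logCoord {h : (ι → ℝ) → ENNReal} (hh : Measurable h) :
    ∫⁻ η : ι → ℂ, h (DelzantPolytope.logCoord η) * ∏ j, ENNReal.ofReal ((‖η j‖ ^ 2)⁻¹) =
      ENNReal.ofReal Real.pi ^ Fintype.card ι * ∫⁻ y, h y := by
  set G : (ι → ℝ) → ENNReal := fun r =>
    h (fun i => 2 * Real.log (r i)) * ∏ i, ENNReal.ofReal (r i)⁻¹ with hG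
  have hGm : Measurable G := by
    refine (hh.comp (by fun_prop)).mul (Finset.measurable_prod _ fun i _ => ?_)
    fun_prop
  rw [← Complex.lintegral_comp_pi_polarCoord_symm]
  have hset : (univ.pi fun _ : ι => Complex.polarCoord.target) =
      MeasurableEquiv.arrowProdEquivProdArrow ℝ ℝ ι ⁻¹'
        ((univ.pi fun _ => Ioi (0 : ℝ)) ×ˢ univ.pi fun _ => Ioo (-Real.pi) Real.pi) := by
    ext p
    simp only [Complex.polarCoord_target, mem_univ_pi, mem_prod, mem_preimage]
    exact forall_and
  have hmeas : MeasurableSet (univ.pi fun _ : ι => Complex.polarCoord.target) :=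
    MeasurableSet.univ_pi fun _ => Complex.polarCoord.open_target.measurableSet
  have h1 : ∀ p ∈ univ.pi fun _ : ι => Complex.polarCoord.target,
      (∏ i, ENNReal.ofReal (p i).1) *
        (h (DelzantPolytope.logCoord fun i => Complex.polarCoord.symm (p i)) *
          ∏ j, ENNReal.ofReal ((‖Complex.polarCoord.symm (p j)‖ ^ 2)⁻¹)) =
      G (MeasurableEquiv.arrowProdEquivProdArrow ℝ ℝ ι p).1 := by
    intro p hp
    have hpos : ∀ i, 0 < (p i).1 := fun i => by
      have := hp i (mem_univ i)
      rw [Complex.polarCoord_target] at this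
      exact this.1
    have hnorm : ∀ i, ‖Complex.polarCoord.symm (p i)‖ = (p i).1 := fun i => by
      rw [Complex.norm_polarCoord_symm, abs_of_pos (hpos i)]
    have h2 : DelzantPolytope.logCoord (fun i => Complex.polarCoord.symm (p i)) =
        fun i => 2 * Real.log (p i).1 := by
      funext i
      rw [DelzantPolytope.logCoord, hnorm]
    rw [h2, mul_left_comm, ← Finset.prod_mul_distrib]
    change _ = h (fun i => 2 * Real.log (p i).1) * ∏ i, ENNReal.ofReal ((p i).1)⁻¹
    congr 1
    refine Finset.prod_congr rfl fun i _ => ?_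
    rw [← ENNReal.ofReal_mul (hpos i).le, hnorm]
    congr 1
    have := (hpos i).ne'
    field_simp
  rw [setLIntegral_congr_fun hmeas h1, hset,
    (volume_measurePreserving_arrowProdEquivProdArrow ℝ ℝ ι).setLIntegral_comp_preimage_emb
      (MeasurableEquiv.measurableEmbedding _) (fun q => G q.1),
    Measure.volume_eq_prod, ← Measure.prod_restrict,
    lintegral_prod (fun q : (ι → ℝ) × (ι → ℝ) => G q.1) (hGm.comp measurable_fst).aemeasurable]
  have h3 : volume (univ.pi fun _ : ι => Ioo (-Real.pi) Real.pi) =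
      ENNReal.ofReal (2 * Real.pi) ^ Fintype.card ι := by
    rw [volume_pi_pi]
    simp only [Real.volume_Ioo, Finset.prod_const, Finset.card_univ]
    congr 2
    ring
  simp only [lintegral_const, Measure.restrict_apply_univ, h3]
  rw [lintegral_mul_const _ hGm, lintegral_pi_Ioi_eq, mul_comm]
  have h4 : ∀ y : ι → ℝ, ENNReal.ofReal (∏ i, Real.exp (y i / 2) / 2) *
      G (fun i => Real.exp (y i / 2)) = ENNReal.ofReal (1 / 2) ^ Fintype.card ι * h y := by
    intro y
    have h5 : (fun i => 2 * Real.log (Real.exp (y i / 2))) = y := by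
      funext i
      rw [Real.log_exp]
      ring
    simp only [hG]
    rw [h5, mul_left_comm, mul_comm, ENNReal.ofReal_prod_of_nonneg fun i _ => by positivity,
      ← Finset.prod_mul_distrib]
    congr 1
    rw [← Finset.card_univ, ← Finset.prod_const]
    refine Finset.prod_congr rfl fun i _ => ?_
    rw [← ENNReal.ofReal_mul (by positivity)]
    congr 1
    have := (Real.exp_pos (y i / 2)).ne'
    field_simp
  simp only [h4]
  rw [lintegral_const_mul _ hh, ← mul_assoc, ← mul_pow, ← ENNReal.ofReal_mul (by positivity)]
  congr 3
  ring

end LogIntegral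

namespace DelzantPolytope

variable {m : ℕ} {P : DelzantPolytope m} {F : ℝ → P.ToricVariety → ℝ}

/-- An enumeration of the facets through a vertex; there are `m` of them. -/
def facetEquiv (I : P.Vertex) : I.1 ≃ Fin m :=
  (P.normalBasis I).indexEquiv (Pi.basisFun ℤ (Fin m))

/-- The normals at a vertex form a `ℤ`-basis, so their matrix has determinant `±1`. -/
lemma abs_det_normalMatrix (I : P.Vertex) :
    |((P.normalMatrix I).submatrix (facetEquiv I).symm id).det| = 1 := by
  set A : Matrix (Fin m) (Fin m) ℤ :=
    Matrix.of fun i j => P.normal ((facetEquiv I).symm i) j with hA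
  set B : Matrix (Fin m) (Fin m) ℤ :=
    Matrix.of fun i j => P.edge I ((facetEquiv I).symm j) i with hB
  have hAB : A * B = 1 := by
    ext i j
    rw [Matrix.mul_apply, Matrix.one_apply]
    have := P.sum_normal_mul_edge I ((facetEquiv I).symm i) ((facetEquiv I).symm j)
    simpa [hA, hB] using this
  have hunit : IsUnit A.det := Matrix.isUnit_det_of_right_inverse hAB
  have h1 : (P.normalMatrix I).submatrix (facetEquiv I).symm id = A.map (Int.castRingHom ℝ) := by
    ext i j
    simp [normalMatrix, hA]
  rw [h1, ← RingHom.mapMatrix_apply, ← RingHom.map_det]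
  rcases Int.isUnit_iff.1 hunit with h | h <;> simp [h]

lemma measurePreserving_orbitCoord (I : P.Vertex) :
    MeasurePreserving (P.orbitCoord I) volume volume := by
  set M := ((P.normalMatrix I).submatrix (facetEquiv I).symm id).transpose with hM
  have hdet : |M.det| = 1 := by rw [hM, Matrix.det_transpose, abs_det_normalMatrix]
  have h1 : MeasurePreserving (Matrix.toLin' M) volume volume := by
    refine ⟨(Matrix.toLin' M).continuous_of_finiteDimensional.measurable, ?_⟩
    rw [Real.map_matrix_volume_pi_eq_smul_volume_pi (fun h => by simp [h] at hdet), abs_inv, hdet]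
    simp
  have h2 := h1.comp (volume_measurePreserving_piCongrLeft (fun _ : Fin m => ℝ) (facetEquiv I))
  convert h2 using 1
  funext y
  have h3 : MeasurableEquiv.piCongrLeft (fun _ : Fin m => ℝ) (facetEquiv I) y =
      fun i => y ((facetEquiv I).symm i) := by
    funext i
    obtain ⟨r, rfl⟩ := (facetEquiv I).surjective i
    rw [Equiv.symm_apply_apply]
    exact Equiv.piCongrLeft_apply_apply (fun _ : Fin m => ℝ) (facetEquiv I) y r
  rw [Function.comp_apply, h3, Matrix.toLin'_apply, hM, Matrix.mulVec_transpose]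
  funext j
  simp only [orbitCoord, Matrix.vecMul, dotProduct, Matrix.submatrix_apply, id]
  exact ((facetEquiv I).symm.sum_comp fun r => y r * P.normalMatrix I r j).symm

lemma det_chartHess (I : P.Vertex) (q : ℝ × (Fin m → ℝ)) :
    (P.chartHess F I q).det = (slabHess (P.orbitPath F) q).det := by
  set N := (P.normalMatrix I).submatrix (facetEquiv I).symm id with hN
  have h1 : (P.chartHess F I q).submatrix (facetEquiv I).symm (facetEquiv I).symm =
      N * slabHess (P.orbitPath F) q * N.transpose := by
    ext i j
    simp [chartHess, hN, Matrix.mul_apply]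
  have h2 : N.det * N.det = 1 := by rw [← abs_mul_abs_self, hN, abs_det_normalMatrix, one_mul]
  rw [← Matrix.det_submatrix_equiv_self (facetEquiv I).symm, h1, Matrix.det_mul, Matrix.det_mul,
    Matrix.det_transpose, mul_right_comm, h2, one_mul]

lemma chartCount_chart (I : P.Vertex) {η : I.1 → ℂ} (hη : ∀ r, η r ≠ 0) :
    P.chartCount (P.chart I η) = Fintype.card P.Vertex := by
  have h : ∀ J : P.Vertex, P.chart I η ∈ range (P.chart J) := fun J => by
    rw [P.chart_eq_torusPoint I η hη, P.torusPoint_eq_chart J]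
    exact mem_range_self _
  rw [chartCount, Nat.card_congr (Equiv.subtypeUnivEquiv h), Nat.card_eq_fintype_card]

lemma IsToricPath.det_metricMatrix_re (hF : P.IsToricPath F) {t : ℝ} (ht : t ∈ Icc (0 : ℝ) 1)
    (I : P.Vertex) {η : I.1 → ℂ} (hη : ∀ r, η r ≠ 0) :
    (P.metricMatrix (F t) I η).det.re =
      (slabHess (P.orbitPath F) (t, P.orbitCoord I (logCoord η))).det *
        ∏ r, (‖η r‖ ^ 2)⁻¹ := by
  have h1 : ((P.chartHess F I (t, P.orbitCoord I (logCoord η))).map Complex.ofReal).det =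
      ((P.chartHess F I (t, P.orbitCoord I (logCoord η))).det : ℂ) :=
    (Complex.ofRealHom.map_det _).symm
  have h2 : (∏ r, (η r)⁻¹) * ∏ r, (starRingEnd ℂ (η r))⁻¹ =
      ((∏ r, (‖η r‖ ^ 2)⁻¹ : ℝ) : ℂ) := by
    rw [← Finset.prod_mul_distrib]
    push_cast
    refine Finset.prod_congr rfl fun r _ => ?_
    rw [← mul_inv, Complex.mul_conj']
  rw [hF.metricMatrix_eq ht I hη, Matrix.det_mul, Matrix.det_mul, Matrix.det_diagonal,
    Matrix.det_diagonal, h1, det_chartHess, mul_right_comm, h2, ← Complex.ofReal_mul,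
    Complex.ofReal_re, mul_comm]

lemma IsToricPath.velocity_legendre_grad (hF : P.IsToricPath F) {t : ℝ}
    (ht : t ∈ Icc (0 : ℝ) 1) (ρ : Fin m → ℝ) :
    velocity (legendre (P.orbitPath F)) t (slabGrad (P.orbitPath F) (t, ρ)) =
      -slabDeriv (1, 0) (P.orbitPath F) (t, ρ) := by
  have h := hF.isConvexPath
  have hx := h.grad_mem_interior ht ρ
  obtain ⟨R, hR⟩ := h.exists_gradInverse hx
  rw [h.velocity_legendre hx hR ht, h.grad_injective ht (hR t ht)]

/-- Each chart contains the open orbit, which has full measure; there the gradient map carries the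
volume form of the metric to Lebesgue measure on the polytope. -/
lemma IsToricPath.lintegral_chart (hF : P.IsToricPath F) {t : ℝ} (ht : t ∈ Icc (0 : ℝ) 1)
    (I : P.Vertex) :
    ∫⁻ η : I.1 → ℂ, ENNReal.ofReal (velocity F t (P.chart I η) ^ 2 /
      P.chartCount (P.chart I η) * ((P.metricMatrix (F t) I η).det.re / Real.pi ^ m)) =
      (Fintype.card P.Vertex : ENNReal)⁻¹ *
        ∫⁻ x in P.carrier, ENNReal.ofReal (velocity (legendre (P.orbitPath F)) t x ^ 2) := by
  have hΦ := P.contDiffOn_orbitPath hF.smooth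
  set D : (Fin m → ℝ) → ℝ := fun ρ => slabDeriv (1, 0) (P.orbitPath F) (t, ρ) with hD
  set H : (Fin m → ℝ) → ℝ := fun ρ => (slabHess (P.orbitPath F) (t, ρ)).det with hH
  have hDc : Continuous D := (contDiff_slice (contDiffOn_slabDeriv hΦ _) ht).continuous
  have hHc : Continuous H := by
    have : Continuous fun ρ => slabHess (P.orbitPath F) (t, ρ) := by
      rw [← continuousOn_univ]
      exact (continuousOn_slabHess hΦ).comp (by fun_prop) fun ρ _ => mem_timeSlab.2 ht
    exact this.matrix_det
  have hHpos : ∀ ρ, 0 < H ρ := fun ρ => (hF.posDef_slabHess ht ρ).det_pos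
  set N : ℝ := ((Fintype.card P.Vertex : ℕ) : ℝ) with hN
  have hNpos : 0 < N := by
    rw [hN]
    exact_mod_cast Fintype.card_pos
  set k : (Fin m → ℝ) → ENNReal := fun ρ =>
    ENNReal.ofReal (N⁻¹ * (Real.pi ^ m)⁻¹) * (ENNReal.ofReal (H ρ) * ENNReal.ofReal (D ρ ^ 2))
    with hk
  have hm : Measurable fun ρ => ENNReal.ofReal (H ρ) * ENNReal.ofReal (D ρ ^ 2) :=
    (ENNReal.measurable_ofReal.comp hHc.measurable).mul
      (ENNReal.measurable_ofReal.comp (hDc.pow 2).measurable)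
  have hkm : Measurable k := hm.const_mul _
  have hae : ∀ᵐ η : I.1 → ℂ, ∀ r, η r ≠ 0 :=
    ae_all_iff.2 fun r => Measure.ae_eval_ne (fun _ => volume) r 0
  have h1 : (fun η : I.1 → ℂ => ENNReal.ofReal (velocity F t (P.chart I η) ^ 2 /
      P.chartCount (P.chart I η) * ((P.metricMatrix (F t) I η).det.re / Real.pi ^ m)))
      =ᵐ[volume] fun η => k (P.orbitCoord I (logCoord η)) *
        ∏ r, ENNReal.ofReal ((‖η r‖ ^ 2)⁻¹) := by
    filter_upwards [hae] with η hη
    rw [chartCount_chart I hη, hF.det_metricMatrix_re ht I hη, hF.velocity_chart ht I hη,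
      ← ENNReal.ofReal_prod_of_nonneg fun r _ => by positivity]
    have hp := hHpos (P.orbitCoord I (logCoord η))
    simp only [hk]
    rw [← ENNReal.ofReal_mul hp.le, ← ENNReal.ofReal_mul (by positivity),
      ← ENNReal.ofReal_mul (by positivity)]
    congr 1
    simp only [hD, hH, hN]
    ring
  have hmp := measurePreserving_orbitCoord I
  have hcard : Fintype.card I.1 = m := by rw [Fintype.card_congr (facetEquiv I), Fintype.card_fin]
  have hrhs := hF.isConvexPath.lintegral_eq ht
    fun x => ENNReal.ofReal (velocity (legendre (P.orbitPath F)) t x ^ 2)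
  simp only [hF.velocity_legendre_grad ht, neg_sq] at hrhs
  rw [lintegral_congr_ae h1, lintegral_logCoord (h := fun y => k (P.orbitCoord I y))
    (hkm.comp hmp.measurable), hmp.lintegral_comp hkm, hcard, hrhs]
  simp only [hk]
  rw [lintegral_const_mul _ hm, ← mul_assoc,
    ← ENNReal.ofReal_pow Real.pi_pos.le, ← ENNReal.ofReal_mul (by positivity)]
  congr 1
  rw [mul_comm N⁻¹, mul_inv_cancel_left₀ (by positivity), ENNReal.ofReal_inv_of_pos hNpos, hN,
    ENNReal.ofReal_natCast]

lemma IsToricPath.mabuchiNormSq_eq (hF : P.IsToricPath F) {t : ℝ} (ht : t ∈ Icc (0 : ℝ) 1) :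
    P.mabuchiNormSq (F t) (velocity F t) =
      ∫⁻ x in P.carrier, ENNReal.ofReal (velocity (legendre (P.orbitPath F)) t x ^ 2) := by
  rw [mabuchiNormSq, Finset.sum_congr rfl fun I _ => hF.lintegral_chart ht I, Finset.sum_const,
    nsmul_eq_mul, Finset.card_univ, ← mul_assoc, ENNReal.mul_inv_cancel
      (by exact_mod_cast Fintype.card_ne_zero) (ENNReal.natCast_ne_top _), one_mul]

lemma IsToricPath.exists_bound_velocity_legendre (hF : P.IsToricPath F) :
    ∃ C : ℝ, ∀ t ∈ Icc (0 : ℝ) 1, ∀ x ∈ interior P.carrier,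
      |velocity (legendre (P.orbitPath F)) t x| ≤ C := by
  obtain ⟨C, hC⟩ := P.exists_bound_orbitPoint (F := velocity F) fun I =>
    (contDiffOn_slabDeriv (hF.smooth I) (1, 0)).continuousOn.congr fun q hq =>
      velocity_eq_slabDeriv (hF.smooth I) hq.1 q.2
  refine ⟨C, fun t ht x hx => ?_⟩
  obtain ⟨ρ, rfl⟩ := hF.isConvexPath.exists_grad_eq ht hx
  rw [hF.velocity_legendre_grad ht, abs_neg,
    ← velocity_eq_slabDeriv (P.contDiffOn_orbitPath hF.smooth) ht, velocity_orbitPath]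
  exact hC t ht ρ

lemma IsToricPath.lintegral_velocity_ne_top (hF : P.IsToricPath F) :
    ∫⁻ t in Icc (0 : ℝ) 1, ∫⁻ x in P.carrier,
      ENNReal.ofReal (velocity (legendre (P.orbitPath F)) t x ^ 2) ≠ ⊤ := by
  obtain ⟨C, hC⟩ := hF.exists_bound_velocity_legendre
  have h1 : ∀ t ∈ Icc (0 : ℝ) 1, ∫⁻ x in P.carrier,
      ENNReal.ofReal (velocity (legendre (P.orbitPath F)) t x ^ 2) ≤
        ENNReal.ofReal (C ^ 2) * volume P.carrier := by
    intro t ht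
    rw [setLIntegral_congr hF.isConvexPath.ae_eq_interior]
    calc _ ≤ ∫⁻ _ in interior P.carrier, ENNReal.ofReal (C ^ 2) :=
          setLIntegral_mono measurable_const fun x hx =>
            ENNReal.ofReal_le_ofReal (sq_le_sq' (abs_le.1 (hC t ht x hx)).1
              (abs_le.1 (hC t ht x hx)).2)
      _ = ENNReal.ofReal (C ^ 2) * volume (interior P.carrier) := by
          rw [lintegral_const, Measure.restrict_apply_univ]
      _ ≤ _ := by gcongr; exact interior_subset
  refine ne_top_of_le_ne_top ?_ (setLIntegral_mono measurable_const h1)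
  rw [lintegral_const, Measure.restrict_apply_univ, Real.volume_Icc]
  exact ENNReal.mul_ne_top (ENNReal.mul_ne_top ENNReal.ofReal_ne_top
    P.isCompact_carrier.measure_lt_top.ne) ENNReal.ofReal_ne_top

end DelzantPolytope

namespace DelzantPolytope

variable {m : ℕ} {P : DelzantPolytope m}

/-! ### Linearization of the geodesic equation -/

lemma isToricPath_add {f₀ : P.ToricVariety → ℝ} (hf₀ : f₀ ∈ P.toricPotentials 0)
    {φ : ℝ → P.ToricVariety → ℝ} (hφ : ∀ t ∈ Icc (0 : ℝ) 1, φ t ∈ P.toricPotentials f₀)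
    (hsmooth : P.IsSmoothPath φ) : P.IsToricPath fun t => f₀ + φ t where
  smooth I := ((hf₀.1 I).comp contDiff_snd).contDiffOn.add (hsmooth I)
  invariant t ht z hz p := by
    rw [Pi.add_apply, Pi.add_apply, hf₀.2.1 z hz p, (hφ t ht).2.1 z hz p]
  posDef t ht := (hφ t ht).2.2

lemma velocity_const_add {X : Type*} (f : X → ℝ) (φ : ℝ → X → ℝ) :
    velocity (fun t => f + φ t) = velocity φ := by
  funext t p
  exact derivWithin_const_add (f p)

lemma momentMap_eq_slabGrad {F : ℝ → P.ToricVariety → ℝ} (hF : P.IsSmoothPath F) {t : ℝ}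
    (ht : t ∈ Icc (0 : ℝ) 1) (ρ : Fin m → ℝ) :
    P.momentMap (F t) ρ = slabGrad (P.orbitPath F) (t, ρ) :=
  funext fun j => fderiv_slice (P.contDiffOn_orbitPath hF) ht ρ (Pi.single j 1)

end DelzantPolytope

end

theorem mainTheorem7 {m : ℕ} (P : DelzantPolytope m)
    (f₀ : P.ToricVariety → ℝ) (hf₀ : f₀ ∈ P.toricPotentials 0)
    (φ : ℝ → P.ToricVariety → ℝ)
    (hφ : ∀ t ∈ Set.Icc (0 : ℝ) 1, φ t ∈ P.toricPotentials f₀)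
    (hsmooth : P.IsSmoothPath φ)
    (u : ℝ → (Fin m → ℝ) → ℝ)
    (hu : u = fun t => P.symplecticPotential (f₀ + φ t)) :
    -- the Legendre transform is the one given by the moment map
    (∀ t ∈ Set.Icc (0 : ℝ) 1, ∀ x ∈ interior P.carrier,
      ∃! ρ : Fin m → ℝ, P.momentMap (f₀ + φ t) ρ = x) ∧
    (∀ t ∈ Set.Icc (0 : ℝ) 1, ∀ x ∈ interior P.carrier, ∀ ρ : Fin m → ℝ,
      P.momentMap (f₀ + φ t) ρ = x → u t x = x ⬝ᵥ ρ - P.orbitPotential (f₀ + φ t) ρ) ∧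
    (∀ x ∈ interior P.carrier, ContDiffOn ℝ 2 (fun t => u t x) (Set.Icc 0 1)) ∧
    -- linearization of the geodesic equation and of the Monge–Ampère equation
    (P.IsGeodesic f₀ φ ↔
      ∀ t ∈ Set.Icc (0 : ℝ) 1, ∀ x ∈ interior P.carrier,
        DelzantPolytope.acceleration u t x = 0) ∧
    (P.SolvesMongeAmpere f₀ φ ↔
      ∀ t ∈ Set.Icc (0 : ℝ) 1, ∀ x ∈ interior P.carrier,
        DelzantPolytope.acceleration u t x = 0) ∧
    -- the form of geodesics
    (P.IsGeodesic f₀ φ →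
      ∀ t ∈ Set.Icc (0 : ℝ) 1, ∀ x ∈ P.carrier, u t x = u 0 x + t * (u 1 x - u 0 x)) ∧
    -- the energy
    (∀ t ∈ Set.Icc (0 : ℝ) 1,
      P.mabuchiNormSq (f₀ + φ t) (DelzantPolytope.velocity φ t) =
        ∫⁻ x in P.carrier, ENNReal.ofReal (DelzantPolytope.velocity u t x ^ 2)) ∧
    P.energy f₀ φ =
      ∫⁻ t in Set.Icc (0 : ℝ) 1, ∫⁻ x in P.carrier,
        ENNReal.ofReal (DelzantPolytope.velocity u t x ^ 2) ∧
    P.energy f₀ φ ≠ ⊤ := by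
  set F : ℝ → P.ToricVariety → ℝ := fun t => f₀ + φ t with hFdef
  have hF : P.IsToricPath F := DelzantPolytope.isToricPath_add hf₀ hφ hsmooth
  have h := hF.isConvexPath
  have hvel : DelzantPolytope.velocity F = DelzantPolytope.velocity φ :=
    DelzantPolytope.velocity_const_add f₀ φ
  have hul : u = legendre (P.orbitPath F) := hu
  subst hul
  have hmoment := fun (t : ℝ) (ht : t ∈ Icc (0 : ℝ) 1) (ρ : Fin m → ℝ) =>
    DelzantPolytope.momentMap_eq_slabGrad hF.smooth ht ρ
  have hgeo : P.IsGeodesic f₀ φ ↔ ∀ t ∈ Icc (0 : ℝ) 1, ∀ x ∈ interior P.carrier,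
      DelzantPolytope.acceleration (legendre (P.orbitPath F)) t x = 0 := by
    refine forall₂_congr fun t ht => ?_
    rw [h.acceleration_legendre_eq_zero_iff ht, ← hF.geodesic_iff ht]
    refine forall₂_congr fun I η => ?_
    rw [acceleration_eq_velocity_velocity,
      acceleration_eq_velocity_velocity, hvel]
  have hnorm : ∀ t ∈ Icc (0 : ℝ) 1,
      P.mabuchiNormSq (f₀ + φ t) (DelzantPolytope.velocity φ t) = ∫⁻ x in P.carrier,
        ENNReal.ofReal (DelzantPolytope.velocity (legendre (P.orbitPath F)) t x ^ 2) := by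
    intro t ht
    rw [← hvel]
    exact hF.mabuchiNormSq_eq ht
  have henergy : P.energy f₀ φ = ∫⁻ t in Icc (0 : ℝ) 1, ∫⁻ x in P.carrier,
      ENNReal.ofReal (DelzantPolytope.velocity (legendre (P.orbitPath F)) t x ^ 2) :=
    setLIntegral_congr_fun measurableSet_Icc hnorm
  refine ⟨fun t ht x hx => ?_, fun t ht x hx ρ hρ => ?_, fun x hx => h.contDiffOn_legendre hx,
    hgeo, ?_, fun hg t ht x hx => ?_, hnorm, henergy, ?_⟩
  · obtain ⟨ρ, hρ⟩ := h.exists_grad_eq ht hx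
    refine ⟨ρ, (hmoment t ht ρ).trans hρ, fun ρ' hρ' => h.grad_injective ht ?_⟩
    exact ((hmoment t ht ρ').symm.trans hρ').trans hρ.symm
  · have h1 := h.legendre_grad ht ρ
    rw [← hmoment t ht ρ] at h1
    change P.momentMap (F t) ρ = x at hρ
    rw [hρ] at h1
    exact h1
  · have hma : P.SolvesMongeAmpere f₀ φ ↔ ∀ t ∈ Icc (0 : ℝ) 1, ∀ ρ,
        geodesicDefect (P.orbitPath F) (t, ρ) = 0 := by
      rw [← hF.mongeAmpere_iff]
      exact forall₂_congr fun I q => and_imp.symm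
    rw [hma]
    exact forall₂_congr fun t ht => (h.acceleration_legendre_eq_zero_iff ht).symm
  · exact h.legendre_affine P.interior_nonempty hx (hgeo.1 hg) ht
  · rw [henergy]
    exact hF.lintegral_velocity_ne_top
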